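/- **Conventions.** For $m,n\ge 0$ let $\mathrm{Cob}^m_n$ be the (dotted) Bar-Natan category. Its objects are formal shifts $q^k a$ ($k\in\mathbb Z$) of properly embedded $1$-submanifolds $a$ of the square $[0,1]^2$ with $m$ boundary points on the top side and $n$ on the bottom side. Its morphisms are $\mathbb Z[\alpha]$-linear combinations of embedded dotted cobordisms in $[0,1]^3$, up to isotopy rel boundary and modulo the local relations: a sphere with $0,1,2,3$ dots equals $0,1,0,\alpha$ respectively; a tube equals the sum of the two ways of replacing it by two disks, exactly one of which carries a dot; a handle equals twice a dot. Composition is stacking. With $\deg\alpha=4$ and $\deg(S)=l-k-\chi(S)+\frac{m+n}{2}$ for a cobordism $S: q^k a\to q^l b$ (a dot contributing $2$), this is a graded category. Let $\mathrm{BN}^m_n$, $(\mathrm{BN}^m_n)^{\oplus}$, $(\mathrm{BN}^m_n)^{\Pi}$ be the categories of formal finite direct sums, countable direct sums, and countable direct products of objects of $\mathrm{Cob}^m_n$. Morphisms are matrices of morphisms; in the case of $\oplus$, for each source index only finitely many entries are nonzero, and in the case of $\Pi$, for each target index only finitely many entries are nonzero. $\mathrm{Ch}(-)$ denotes the cochain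 complexes, possibly unbounded, whose differentials have homological degree $1$ and $q$-degree $0$; $\simeq$ denotes homotopy equivalence. For $a\in \mathrm{Cob}^m_k$, $b\in\mathrm{Cob}^k_n$ let $a\otimes b\in\mathrm{Cob}^m_n$ be obtained by gluing $a$ on top of $b$. For complexes put $(A\otimes B)^k=\bigoplus_{i+j=k}A^i\otimes B^j$ over the $\oplus$-categories and $(A\,\bar\otimes\, B)^k=\prod_{i+j=k}A^i\otimes B^j$ over the $\Pi$-categories, both with differential $d_A\otimes 1+(-1)^i\,1\otimes d_B$ on $A^i\otimes B^j$. Complexes over $\mathrm{BN}^m_n$ are also regarded as complexes over $(\mathrm{BN}^m_n)^\oplus$ or $(\mathrm{BN}^m_n)^\Pi$. The dual $A^\vee$ of a complex $A$ over $\mathrm{BN}^m_n$ is the complex over $\mathrm{BN}^n_m$ with $(A^\vee)^k=(A^{-k})^\vee$, obtained by reflecting all diagrams in the horizontal axis, reversing all $q$-shifts, applying $(x,y,z)\mapsto(x,1-y,1-z)$ to cobordisms, transposing matrices, and taking $(-1)^{k+1}(d_A^{-k-1})^\vee$ as the differential $(A^\vee)^k\to (A^\vee)^{k+1}$. Let $1_n\in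 \mathrm{Cob}^n_n$ be the diagram of $n$ vertical strands. A *universal projector* $P_n$ is a complex over $\mathrm{BN}^n_n$ that is concentrated in nonpositive homological degrees, such that $(P_n)^0\cong 1_n$, no $q^s1_n$ is a direct summand of any other chain group, and $P_n$ kills turnbacks: $a\otimes P_n\simeq 0$ for every diagram $a\in\mathrm{Cob}^{n-2}_n$ that consists of $n-2$ strands and one arc joining two neighbouring bottom points, and $P_n\otimes b\simeq 0$ for every diagram $b\in\mathrm{Cob}^n_{n-2}$ that consists of $n-2$ strands and one arc joining two neighbouring top points. **Proposition (semi-orthogonality rule).** Let $0\le i<j$ be integers and let $P_i$, $P_j$ be universal projectors over $\mathrm{BN}^i_i$ and $\mathrm{BN}^j_j$. 1. For every $A\in\mathrm{Ch}((\mathrm{BN}^i_j)^\oplus)$, the complex $P_i\otimes A\otimes P_j^\vee$ over $(\mathrm{BN}^i_j)^\oplus$ is contractible. 2. For every $A\in\mathrm{Ch}((\mathrm{BN}^j_i)^\Pi)$, the complex $P_j\,\bar\otimes\, A\,\bar\otimes\, P_i^\vee$ over $(\mathrm{BN}^j_i)^\Pi$ is contractible. -/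

import Mathlib

open CategoryTheory Polynomial

namespace BarNatan

/-! ## Planar diagrams -/

/-- Crossingless diagrams in the square with `m` endpoints on top and `n` on the bottom, presented
as vertical gluings (first argument above the second) of parallel strands and of single turnbacks:
`cap n i` has `i` strands, an arc joining the bottom points `i` and `i + 1`, and `n - i` more
strands; `cup n i` is its reflection. -/
inductive Diag : ℕ → ℕ → Type
  | strands (n : ℕ) : Diag n n
  | cap (n : ℕ) (i : Fin (n + 1)) : Diag n (n + 2)
  | cup (n : ℕ) (i : Fin (n + 1)) : Diag (n + 2) n
  | glue {m k n : ℕ} (a : Diag m k) (b : Diag k n) : Diag m n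

/-- The piece of `cap n i` (or `cup n i`) that contains the `j`-th endpoint on the side with
`n + 2` endpoints; `none` is the turnback, `some l` is the `l`-th through strand. -/
def bend (n : ℕ) (i : Fin (n + 1)) (j : Fin (n + 2)) : Option (Fin n) :=
  if h : j.val < i.val then some ⟨j.val, by omega⟩
  else if h' : j.val < i.val + 2 then none
  else some ⟨j.val - 2, by omega⟩

/-- The relation on a disjoint union generated by relations on the two parts and by linking
`f i` with `g i` for every `i`. -/
inductive GlueRel {X Y I : Type} (r : X → X → Prop) (s : Y → Y → Prop) (f : I → X) (g : I → Y) :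
    X ⊕ Y → X ⊕ Y → Prop
  | left {x x' : X} (h : r x x') : GlueRel r s f g (.inl x) (.inl x')
  | right {y y' : Y} (h : s y y') : GlueRel r s f g (.inr y) (.inr y')
  | link (i : I) : GlueRel r s f g (.inl (f i)) (.inr (g i))

namespace Diag

/-- The elementary pieces (strands and turnbacks) of a diagram. -/
def Piece : {m n : ℕ} → Diag m n → Type
  | _, _, strands n => Fin n
  | _, _, cap n _ => Option (Fin n)
  | _, _, cup n _ => Option (Fin n)
  | _, _, glue a b => a.Piece ⊕ b.Piece

/-- The piece that contains a given endpoint on top. -/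
def top : {m n : ℕ} → (a : Diag m n) → Fin m → a.Piece
  | _, _, strands _ => id
  | _, _, cap _ _ => some
  | _, _, cup n i => bend n i
  | _, _, glue a _ => fun j => .inl (a.top j)

/-- The piece that contains a given endpoint on the bottom. -/
def bot : {m n : ℕ} → (a : Diag m n) → Fin n → a.Piece
  | _, _, strands _ => id
  | _, _, cap n i => bend n i
  | _, _, cup _ _ => some
  | _, _, glue _ b => fun j => .inr (b.bot j)

/-- Two pieces are adjacent if they share an endpoint along which diagrams are glued. -/
def Adj : {m n : ℕ} → (a : Diag m n) → a.Piece → a.Piece → Prop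
  | _, _, strands _ => fun _ _ => False
  | _, _, cap _ _ => fun _ _ => False
  | _, _, cup _ _ => fun _ _ => False
  | _, _, glue a b => GlueRel a.Adj b.Adj a.bot b.top

/-- There are finitely many pieces. -/
noncomputable instance fintypePiece : {m n : ℕ} → (a : Diag m n) → Fintype a.Piece
  | _, _, strands n => inferInstanceAs (Fintype (Fin n))
  | _, _, cap n _ => inferInstanceAs (Fintype (Option (Fin n)))
  | _, _, cup n _ => inferInstanceAs (Fintype (Option (Fin n)))
  | _, _, glue a b =>
    have := fintypePiece a
    have := fintypePiece b
    inferInstanceAs (Fintype (a.Piece ⊕ b.Piece))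

/-- The connected components (arcs and circles) of a diagram. -/
def Comp {m n : ℕ} (a : Diag m n) : Type := Quot a.Adj

/-- The component that contains a piece. -/
def comp {m n : ℕ} (a : Diag m n) (p : a.Piece) : a.Comp := Quot.mk _ p

noncomputable instance {m n : ℕ} (a : Diag m n) : Fintype a.Comp :=
  have : Finite (Quot a.Adj) := inferInstance
  Fintype.ofFinite (Quot a.Adj)

/-- Reflection about the horizontal axis. -/
def reflect : {m n : ℕ} → Diag m n → Diag n m
  | _, _, strands n => strands n
  | _, _, cap n i => cup n i
  | _, _, cup n i => cap n i
  | _, _, glue a b => glue b.reflect a.reflect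

/-- The reflection of a piece. -/
def reflectPiece : {m n : ℕ} → (a : Diag m n) → a.Piece ≃ a.reflect.Piece
  | _, _, strands n => Equiv.refl (Fin n)
  | _, _, cap n _ => Equiv.refl (Option (Fin n))
  | _, _, cup n _ => Equiv.refl (Option (Fin n))
  | _, _, glue a b =>
    (Equiv.sumCongr a.reflectPiece b.reflectPiece).trans (Equiv.sumComm _ _)

/-- `n` parallel strands with a circle inserted after the first `i` of them. -/
def circle (n : ℕ) (i : Fin (n + 1)) : Diag n n := glue (cap n i) (cup n i)

/-- The two halves of the inserted circle. -/
def half (n : ℕ) (i : Fin (n + 1)) (t : Bool) : (circle n i).Piece :=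
  if t then .inl (none : Option (Fin n)) else .inr (none : Option (Fin n))

/-- `n + 2` endpoints on either side, with the points `i` and `i + 1` joined by turnbacks. -/
def turn (n : ℕ) (i : Fin (n + 1)) : Diag (n + 2) (n + 2) := glue (cup n i) (cap n i)

theorem reflect_reflect : {m n : ℕ} → (a : Diag m n) → a.reflect.reflect = a
  | _, _, strands _ => rfl
  | _, _, cap _ _ => rfl
  | _, _, cup _ _ => rfl
  | _, _, glue a b => congrArg₂ glue a.reflect_reflect b.reflect_reflect

theorem reflectPiece_top : {m n : ℕ} → (a : Diag m n) → (j : Fin m) →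
    a.reflectPiece (a.top j) = a.reflect.bot j
  | _, _, strands _, _ => rfl
  | _, _, cap _ _, _ => rfl
  | _, _, cup _ _, _ => rfl
  | _, _, glue a _, j => congrArg Sum.inr (a.reflectPiece_top j)

theorem reflectPiece_bot : {m n : ℕ} → (a : Diag m n) → (j : Fin n) →
    a.reflectPiece (a.bot j) = a.reflect.top j
  | _, _, strands _, _ => rfl
  | _, _, cap _ _, _ => rfl
  | _, _, cup _ _, _ => rfl
  | _, _, glue _ b, j => congrArg Sum.inl (b.reflectPiece_bot j)

end Diag

theorem GlueRel.mk_left {X Y I : Type} {r : X → X → Prop} {s : Y → Y → Prop} {f : I → X}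
    {g : I → Y} {x x' : X} (h : Quot.mk r x = Quot.mk r x') :
    Quot.mk (GlueRel r s f g) (.inl x) = Quot.mk (GlueRel r s f g) (.inl x') :=
  congrArg (Quot.map Sum.inl fun _ _ h => GlueRel.left h) h

theorem GlueRel.mk_right {X Y I : Type} {r : X → X → Prop} {s : Y → Y → Prop} {f : I → X}
    {g : I → Y} {y y' : Y} (h : Quot.mk s y = Quot.mk s y') :
    Quot.mk (GlueRel r s f g) (.inr y) = Quot.mk (GlueRel r s f g) (.inr y') :=
  congrArg (Quot.map Sum.inr fun _ _ h => GlueRel.right h) h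

theorem Diag.reflectPiece_adj {m n : ℕ} (a : Diag m n) (x y : a.Piece) (h : a.Adj x y) :
    a.reflect.comp (a.reflectPiece x) = a.reflect.comp (a.reflectPiece y) := by
  induction a with
  | strands n => exact h.elim
  | cap n i => exact h.elim
  | cup n i => exact h.elim
  | glue a b iha ihb =>
    change GlueRel a.Adj b.Adj a.bot b.top x y at h
    cases h with
    | left h => exact GlueRel.mk_right (iha _ _ h)
    | right h => exact GlueRel.mk_left (ihb _ _ h)
    | link i =>
      refine (Quot.sound ?_).symm
      have h := GlueRel.link (r := b.reflect.Adj) (s := a.reflect.Adj) (f := b.reflect.bot)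
        (g := a.reflect.top) i
      rw [← b.reflectPiece_top, ← a.reflectPiece_bot] at h
      exact h

theorem Diag.reflectPiece_adj' {m n : ℕ} (a : Diag m n) (x y : a.reflect.Piece)
    (h : a.reflect.Adj x y) :
    a.comp (a.reflectPiece.symm x) = a.comp (a.reflectPiece.symm y) := by
  induction a with
  | strands n => exact h.elim
  | cap n i => exact h.elim
  | cup n i => exact h.elim
  | glue a b iha ihb =>
    change GlueRel b.reflect.Adj a.reflect.Adj b.reflect.bot a.reflect.top x y at h
    cases h with
    | left h => exact GlueRel.mk_right (ihb _ _ h)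
    | right h => exact GlueRel.mk_left (iha _ _ h)
    | link i =>
      refine (Quot.sound ?_).symm
      have h := GlueRel.link (r := a.Adj) (s := b.Adj) (f := a.bot) (g := b.top) i
      rw [← a.reflectPiece.symm_apply_apply (a.bot i), a.reflectPiece_bot,
        ← b.reflectPiece.symm_apply_apply (b.top i), b.reflectPiece_top] at h
      exact h

/-- The reflection of a component. -/
def Diag.reflectComp {m n : ℕ} (a : Diag m n) : a.Comp ≃ a.reflect.Comp where
  toFun := Quot.lift (fun x => a.reflect.comp (a.reflectPiece x)) a.reflectPiece_adj
  invFun := Quot.lift (fun x => a.comp (a.reflectPiece.symm x)) a.reflectPiece_adj'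
  left_inv := by rintro ⟨x⟩; exact congrArg a.comp (a.reflectPiece.symm_apply_apply x)
  right_inv := by rintro ⟨x⟩; exact congrArg a.reflect.comp (a.reflectPiece.apply_symm_apply x)

/-! ## Abstract dotted surfaces -/

/-- An abstract compact dotted surface that is a cobordism between two diagrams (with the boundary
points times an interval as vertical boundary), recorded by a finite graph of cells whose connected
components are the components of the surface, and by the components to which the pieces of the
two diagrams belong. The weight of a component is the sum of the weights of its cells: the second
entry is its number of dots and the first is `e / 2 - χ`, where `χ` is its Euler characteristic
and `e` the number of endpoints of the diagrams on it. This normalization is additive under all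
gluings. -/
structure Surf {m n : ℕ} (a b : Diag m n) where
  Cell : Type
  fin : Fintype Cell
  adj : Cell → Cell → Prop
  src : a.Piece → Cell
  tgt : b.Piece → Cell
  wt : Cell → ℤ × ℕ
  src_adj : ∀ x y, a.Adj x y → Quot.mk adj (src x) = Quot.mk adj (src y)
  tgt_adj : ∀ x y, b.Adj x y → Quot.mk adj (tgt x) = Quot.mk adj (tgt y)
  side_top : ∀ i, Quot.mk adj (src (a.top i)) = Quot.mk adj (tgt (b.top i))
  side_bot : ∀ i, Quot.mk adj (src (a.bot i)) = Quot.mk adj (tgt (b.bot i))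

namespace Surf

variable {m n k : ℕ}

/-- The component of a surface that contains a cell. -/
def cl {a b : Diag m n} (S : Surf a b) (x : S.Cell) : Quot S.adj := Quot.mk _ x

open scoped Classical in
/-- The weight of a component. -/
noncomputable def total {a b : Diag m n} (S : Surf a b) (c : Quot S.adj) : ℤ × ℕ :=
  letI := S.fin
  ∑ x with S.cl x = c, S.wt x

/-- Two surfaces are homeomorphic relative to the boundary: a bijection between components that
respects the boundary, Euler characteristics and numbers of dots. -/
def Same {a b : Diag m n} (S T : Surf a b) : Prop :=
  ∃ e : Quot S.adj ≃ Quot T.adj,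
    (∀ p, e (S.cl (S.src p)) = T.cl (T.src p)) ∧ (∀ p, e (S.cl (S.tgt p)) = T.cl (T.tgt p)) ∧
      ∀ c, T.total (e c) = S.total c

/-- The identity surface with additional weights. -/
noncomputable def id (a : Diag m n) (w : a.Piece → ℤ × ℕ) : Surf a a where
  Cell := a.Piece
  fin := inferInstance
  adj := a.Adj
  src := _root_.id
  tgt := _root_.id
  wt := w
  src_adj _ _ h := Quot.sound h
  tgt_adj _ _ h := Quot.sound h
  side_top _ := rfl
  side_bot _ := rfl

/-- Stacking of surfaces in the cobordism direction. -/
def comp {a b c : Diag m n} (S : Surf a b) (T : Surf b c) : Surf a c where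
  Cell := S.Cell ⊕ T.Cell
  fin := letI := S.fin; letI := T.fin; inferInstance
  adj := GlueRel S.adj T.adj S.tgt T.src
  src p := .inl (S.src p)
  tgt p := .inr (T.tgt p)
  wt := Sum.elim S.wt T.wt
  src_adj x y h := GlueRel.mk_left (S.src_adj x y h)
  tgt_adj x y h := GlueRel.mk_right (T.tgt_adj x y h)
  side_top i := (GlueRel.mk_left (S.side_top i)).trans
    ((Quot.sound (GlueRel.link (b.top i))).trans
      (GlueRel.mk_right (T.side_top i)))
  side_bot i := (GlueRel.mk_left (S.side_bot i)).trans
    ((Quot.sound (GlueRel.link (b.bot i))).trans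
      (GlueRel.mk_right (T.side_bot i)))

/-- Gluing of surfaces in the planar direction, `S` above `T`. -/
def glue {a b : Diag m k} {a' b' : Diag k n} (S : Surf a b) (T : Surf a' b') :
    Surf (a.glue a') (b.glue b') where
  Cell := S.Cell ⊕ T.Cell
  fin := letI := S.fin; letI := T.fin; inferInstance
  adj := GlueRel S.adj T.adj (fun i => S.src (a.bot i)) (fun i => T.src (a'.top i))
  src := Sum.map S.src T.src
  tgt := Sum.map S.tgt T.tgt
  wt := Sum.elim S.wt T.wt
  src_adj x y h := by
    cases h with
    | left h => exact GlueRel.mk_left (S.src_adj _ _ h)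
    | right h => exact GlueRel.mk_right (T.src_adj _ _ h)
    | link i => exact Quot.sound (GlueRel.link i)
  tgt_adj x y h := by
    cases h with
    | left h => exact GlueRel.mk_left (S.tgt_adj _ _ h)
    | right h => exact GlueRel.mk_right (T.tgt_adj _ _ h)
    | link i =>
      exact (GlueRel.mk_left (S.side_bot i)).symm.trans
        ((Quot.sound (GlueRel.link i)).trans
          (GlueRel.mk_right (T.side_top i)))
  side_top i := GlueRel.mk_left (S.side_top i)
  side_bot i := GlueRel.mk_right (T.side_bot i)

/-- The image of a surface under reflection of the square and of the cobordism direction. -/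
def reflect {a b : Diag m n} (S : Surf a b) : Surf b.reflect a.reflect where
  Cell := S.Cell
  fin := S.fin
  adj := S.adj
  src p := S.tgt (b.reflectPiece.symm p)
  tgt p := S.src (a.reflectPiece.symm p)
  wt := S.wt
  src_adj x y h := congrArg (Quot.lift (fun p => S.cl (S.tgt p)) S.tgt_adj)
    (b.reflectPiece_adj' x y h)
  tgt_adj x y h := congrArg (Quot.lift (fun p => S.cl (S.src p)) S.src_adj)
    (a.reflectPiece_adj' x y h)
  side_top i := by
    rw [← a.reflectPiece_bot, ← b.reflectPiece_bot, Equiv.symm_apply_apply,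
      Equiv.symm_apply_apply]
    exact (S.side_bot i).symm
  side_bot i := by
    rw [← a.reflectPiece_top, ← b.reflectPiece_top, Equiv.symm_apply_apply,
      Equiv.symm_apply_apply]
    exact (S.side_top i).symm

/-- A criterion for two surfaces to be homeomorphic. -/
theorem Same.of_map {a b : Diag m n} {S T : Surf a b} (f : S.Cell → T.Cell) (g : T.Cell → S.Cell)
    (hf : ∀ x y, S.adj x y → T.cl (f x) = T.cl (f y))
    (hg : ∀ x y, T.adj x y → S.cl (g x) = S.cl (g y))
    (hgf : ∀ x, S.cl (g (f x)) = S.cl x) (hfg : ∀ y, f (g y) = y)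
    (hs : ∀ p, T.cl (f (S.src p)) = T.cl (T.src p))
    (ht : ∀ p, T.cl (f (S.tgt p)) = T.cl (T.tgt p))
    (hw : ∀ x, (x ≠ g (f x) → S.wt x = 0) ∧ (x = g (f x) → S.wt x = T.wt (f x))) :
    S.Same T := by
  classical
  let := S.fin
  let := T.fin
  let e : Quot S.adj ≃ Quot T.adj :=
    { toFun := Quot.lift (fun x => T.cl (f x)) hf
      invFun := Quot.lift (fun x => S.cl (g x)) hg
      left_inv := by rintro ⟨x⟩; exact hgf x
      right_inv := by rintro ⟨x⟩; exact congrArg T.cl (hfg x) }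
  refine ⟨e, hs, ht, ?_⟩
  intro c
  unfold total
  have h1 : ∀ x, S.cl x = c ↔ T.cl (f x) = e c := fun x => (e.apply_eq_iff_eq (x := S.cl x)).symm
  refine Finset.sum_bij_ne_zero (fun y _ _ => g y) ?_ ?_ ?_ ?_
  · intro y hy _
    simp only [Finset.mem_filter, Finset.mem_univ, true_and] at hy ⊢
    rw [h1, hfg, hy]
  · intro y _ _ y' _ _ h
    rw [← hfg y, ← hfg y', h]
  · intro x hx h0
    have hx' : x = g (f x) := by
      by_contra h
      exact h0 ((hw x).1 h)
    simp only [Finset.mem_filter, Finset.mem_univ, true_and] at hx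
    refine ⟨f x, ?_, ?_, hx'.symm⟩
    · simp only [Finset.mem_filter, Finset.mem_univ, true_and]
      rw [← h1, hx]
    · rw [← (hw x).2 hx']; exact h0
  · intro y _ _
    rw [(hw (g y)).2 (by rw [hfg]), hfg]

theorem Same.refl {a b : Diag m n} (S : Surf a b) : S.Same S :=
  ⟨Equiv.refl _, fun _ => rfl, fun _ => rfl, fun _ => rfl⟩

theorem Same.symm {a b : Diag m n} {S T : Surf a b} (h : S.Same T) : T.Same S := by
  obtain ⟨e, h1, h2, h3⟩ := h
  refine ⟨e.symm, fun p => ?_, fun p => ?_, fun c => ?_⟩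
  · rw [← h1, Equiv.symm_apply_apply]
  · rw [← h2, Equiv.symm_apply_apply]
  · rw [← h3, Equiv.apply_symm_apply]

theorem Same.trans {a b : Diag m n} {S T U : Surf a b} (h : S.Same T) (h' : T.Same U) :
    S.Same U := by
  obtain ⟨e, h1, h2, h3⟩ := h
  obtain ⟨e', h1', h2', h3'⟩ := h'
  refine ⟨e.trans e', fun p => ?_, fun p => ?_, fun c => ?_⟩
  · rw [Equiv.trans_apply, h1, h1']
  · rw [Equiv.trans_apply, h2, h2']
  · rw [Equiv.trans_apply, h3', h3]

theorem Same.reflect {a b : Diag m n} {S T : Surf a b} (h : S.Same T) :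
    S.reflect.Same T.reflect := by
  obtain ⟨e, h1, h2, h3⟩ := h
  exact ⟨e, fun p => h2 _, fun p => h1 _, h3⟩

theorem id_comp_same {a b : Diag m n} (S : Surf a b) : ((Surf.id a 0).comp S).Same S := by
  refine Same.of_map (Sum.elim S.src _root_.id) Sum.inr ?_ ?_ ?_ ?_ ?_ ?_ ?_
  · rintro _ _ (h | h | i)
    · exact S.src_adj _ _ h
    · exact Quot.sound h
    · rfl
  · exact fun _ _ h => Quot.sound (GlueRel.right h)
  · rintro (x | x)
    · exact (Quot.sound (GlueRel.link x)).symm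
    · rfl
  · exact fun _ => rfl
  · exact fun _ => rfl
  · exact fun _ => rfl
  · rintro (x | x)
    · exact ⟨fun _ => rfl, fun h => by cases h⟩
    · exact ⟨fun h => (h rfl).elim, fun _ => rfl⟩

theorem comp_id_same {a b : Diag m n} (S : Surf a b) : (S.comp (Surf.id b 0)).Same S := by
  refine Same.of_map (Sum.elim _root_.id S.tgt) Sum.inl ?_ ?_ ?_ ?_ ?_ ?_ ?_
  · rintro _ _ (h | h | i)
    · exact Quot.sound h
    · exact S.tgt_adj _ _ h
    · rfl
  · exact fun _ _ h => Quot.sound (GlueRel.left h)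
  · rintro (x | x)
    · rfl
    · exact Quot.sound (GlueRel.link x)
  · exact fun _ => rfl
  · exact fun _ => rfl
  · exact fun _ => rfl
  · rintro (x | x)
    · exact ⟨fun h => (h rfl).elim, fun _ => rfl⟩
    · exact ⟨fun _ => rfl, fun h => by cases h⟩

theorem assoc_same {a b c d : Diag m n} (S : Surf a b) (T : Surf b c) (U : Surf c d) :
    ((S.comp T).comp U).Same (S.comp (T.comp U)) := by
  refine Same.of_map (Equiv.sumAssoc _ _ _) (Equiv.sumAssoc _ _ _).symm ?_ ?_ ?_ ?_ ?_ ?_ ?_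
  · rintro _ _ ((h | h | i) | h | i)
    · exact Quot.sound (.left h)
    · exact Quot.sound (.right (.left h))
    · exact Quot.sound (.link i)
    · exact Quot.sound (.right (.right h))
    · exact Quot.sound (.right (.link i))
  · rintro _ _ (h | (h | h | i) | i)
    · exact Quot.sound (.left (.left h))
    · exact Quot.sound (.left (.right h))
    · exact Quot.sound (.right h)
    · exact Quot.sound (.link i)
    · exact Quot.sound (.left (.link i))
  · rintro ((x | x) | x) <;> rfl
  · rintro (x | x | x) <;> rfl
  · exact fun _ => rfl
  · exact fun _ => rfl
  · rintro ((x | x) | x) <;> exact ⟨fun h => (h rfl).elim, fun _ => rfl⟩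

theorem glue_comp_same {a b c : Diag m k} {a' b' c' : Diag k n} (S : Surf a b) (T : Surf b c)
    (S' : Surf a' b') (T' : Surf b' c') :
    ((S.comp T).glue (S'.comp T')).Same ((S.glue S').comp (T.glue T')) := by
  refine Same.of_map (Equiv.sumSumSumComm _ _ _ _) (Equiv.sumSumSumComm _ _ _ _).symm
    ?_ ?_ ?_ ?_ ?_ ?_ ?_
  · rintro _ _ ((h | h | i) | (h | h | i) | i)
    · exact Quot.sound (.left (.left h))
    · exact Quot.sound (.right (.left h))
    · exact Quot.sound (.link (Sum.inl i))
    · exact Quot.sound (.left (.right h))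
    · exact Quot.sound (.right (.right h))
    · exact Quot.sound (.link (Sum.inr i))
    · exact Quot.sound (.left (.link i))
  · rintro _ _ ((h | h | i) | (h | h | i) | (i | i))
    · exact Quot.sound (.left (.left h))
    · exact Quot.sound (.right (.left h))
    · exact Quot.sound (.link i)
    · exact Quot.sound (.left (.right h))
    · exact Quot.sound (.right (.right h))
    · let R := ((S.comp T).glue (S'.comp T'))
      have e1 : R.cl (.inl (.inr (T.src (b.bot i)))) = R.cl (.inl (.inl (S.tgt (b.bot i)))) :=
        (Quot.sound (.left (.link (b.bot i)))).symm
      have e2 : R.cl (.inl (.inl (S.tgt (b.bot i)))) = R.cl (.inl (.inl (S.src (a.bot i)))) :=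
        (GlueRel.mk_left (GlueRel.mk_left (S.side_bot i))).symm
      have e3 : R.cl (.inl (.inl (S.src (a.bot i)))) = R.cl (.inr (.inl (S'.src (a'.top i)))) :=
        Quot.sound (.link i)
      have e4 : R.cl (.inr (.inl (S'.src (a'.top i)))) = R.cl (.inr (.inl (S'.tgt (b'.top i)))) :=
        GlueRel.mk_right (GlueRel.mk_left (S'.side_top i))
      have e5 : R.cl (.inr (.inl (S'.tgt (b'.top i)))) = R.cl (.inr (.inr (T'.src (b'.top i)))) :=
        Quot.sound (.right (.link (b'.top i)))
      exact e1.trans (e2.trans (e3.trans (e4.trans e5)))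
    · exact Quot.sound (.left (.link i))
    · exact Quot.sound (.right (.link i))
  · rintro ((x | x) | (x | x)) <;> rfl
  · rintro ((x | x) | (x | x)) <;> rfl
  · rintro (p | p) <;> rfl
  · rintro (p | p) <;> rfl
  · rintro ((x | x) | (x | x)) <;> exact ⟨fun h => (h rfl).elim, fun _ => rfl⟩

theorem glue_id_same (a : Diag m k) (b : Diag k n) :
    ((Surf.id a 0).glue (Surf.id b 0)).Same (Surf.id (a.glue b) 0) := by
  refine Same.of_map _root_.id _root_.id ?_ ?_ ?_ ?_ ?_ ?_ ?_
  · exact fun _ _ h => Quot.sound h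
  · exact fun _ _ h => Quot.sound h
  · exact fun _ => rfl
  · exact fun _ => rfl
  · rintro (p | p) <;> rfl
  · rintro (p | p) <;> rfl
  · rintro (x | x) <;> exact ⟨fun h => (h rfl).elim, fun _ => rfl⟩

end Surf

/-! ## Cobordisms -/

/-- A bijection between the components of two diagrams that fixes the endpoints. -/
structure Diag.Match {m n : ℕ} (a b : Diag m n) where
  e : a.Comp ≃ b.Comp
  top : ∀ i, e (a.comp (a.top i)) = b.comp (b.top i)
  bot : ∀ i, e (a.comp (a.bot i)) = b.comp (b.bot i)

theorem exists_bend (n : ℕ) (i : Fin (n + 1)) (l : Fin n) : ∃ j, bend n i j = some l := by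
  by_cases h : l.val < i.val
  · exact ⟨⟨l.val, by omega⟩, by simp [bend, h]⟩
  · refine ⟨⟨l.val + 2, by omega⟩, ?_⟩
    have h1 : ¬ (l.val + 2 < i.val) := by omega
    simp [bend, h, h1]

namespace Surf

/-- The disjoint union of cylinders that join corresponding components of two diagrams. -/
noncomputable def cyl {m n : ℕ} {a b : Diag m n} (e : a.Match b) : Surf a b where
  Cell := a.Comp
  fin := inferInstance
  adj _ _ := False
  src := a.comp
  tgt p := e.e.symm (b.comp p)
  wt _ := 0
  src_adj _ _ h := congrArg _ (Quot.sound h)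
  tgt_adj _ _ h := congrArg (fun c => Quot.mk _ (e.e.symm c)) (Quot.sound h)
  side_top i := by rw [← e.top, Equiv.symm_apply_apply]
  side_bot i := by rw [← e.bot, Equiv.symm_apply_apply]

/-- The cobordism read backwards. -/
def flip {m n : ℕ} {a b : Diag m n} (S : Surf a b) : Surf b a where
  Cell := S.Cell
  fin := S.fin
  adj := S.adj
  src := S.tgt
  tgt := S.src
  wt := S.wt
  src_adj := S.tgt_adj
  tgt_adj := S.src_adj
  side_top i := (S.side_top i).symm
  side_bot i := (S.side_bot i).symm

/-- The creation of a circle: a disk (of Euler characteristic `1`, without endpoints). -/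
noncomputable def birth (n : ℕ) (i : Fin (n + 1)) : Surf (.strands n) (.circle n i) where
  Cell := (Diag.circle n i).Piece
  fin := inferInstance
  adj := (Diag.circle n i).Adj
  src j := .inl (some j : Option (Fin n))
  tgt := _root_.id
  wt := Sum.elim (fun o : Option (Fin n) => o.elim (-1, 0) fun _ => 0) fun _ => 0
  src_adj _ _ h := h.elim
  tgt_adj _ _ h := Quot.sound h
  side_top _ := rfl
  side_bot l := by
    obtain ⟨j, hj⟩ := exists_bend n i l
    have h := Quot.sound (GlueRel.link (r := (Diag.cap n i).Adj) (s := (Diag.cup n i).Adj)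
      (f := (Diag.cap n i).bot) (g := (Diag.cup n i).top) j)
    change Quot.mk _ (Sum.inl (bend n i j)) = Quot.mk _ (Sum.inr (bend n i j)) at h
    rw [hj] at h
    exact h

/-- The saddle (of Euler characteristic `1`, with four endpoints) that replaces the strands `i` and
`i + 1` by two turnbacks. -/
noncomputable def saddle (n : ℕ) (i : Fin (n + 1)) : Surf (.strands (n + 2)) (.turn n i) where
  Cell := Option (Fin n)
  fin := inferInstance
  adj _ _ := False
  src := bend n i
  tgt := Sum.elim _root_.id _root_.id
  wt o := o.elim (1, 0) fun _ => 0
  src_adj _ _ h := h.elim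
  tgt_adj x y h := by
    change GlueRel (fun _ _ => False) (fun _ _ => False) some some x y at h
    rcases h with h | h | j
    · exact h.elim
    · exact h.elim
    · rfl
  side_top _ := rfl
  side_bot _ := rfl

/-- The degree `-χ + (m + n) / 2`, where each dot counts `2`. -/
def deg {m n : ℕ} {a b : Diag m n} (S : Surf a b) : ℤ :=
  letI := S.fin
  ∑ x, ((S.wt x).1 + 2 * (S.wt x).2)

theorem deg_comp {m n : ℕ} {a b c : Diag m n} (S : Surf a b) (T : Surf b c) :
    (S.comp T).deg = S.deg + T.deg :=
  letI := S.fin; letI := T.fin; Fintype.sum_sum_type _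

theorem deg_glue {m k n : ℕ} {a b : Diag m k} {a' b' : Diag k n} (S : Surf a b)
    (T : Surf a' b') : (S.glue T).deg = S.deg + T.deg :=
  letI := S.fin; letI := T.fin; Fintype.sum_sum_type _

theorem deg_id {m n : ℕ} (a : Diag m n) : (Surf.id a 0).deg = 0 :=
  Finset.sum_eq_zero fun _ _ => rfl

theorem deg_reflect {m n : ℕ} {a b : Diag m n} (S : Surf a b) : S.reflect.deg = S.deg := rfl

/-- A strong form of `Same`, at the level of cells. -/
def CellIso {m n : ℕ} {a b : Diag m n} (S T : Surf a b) : Prop :=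
  ∃ f : S.Cell ≃ T.Cell,
    (∀ x y, S.adj x y → T.cl (f x) = T.cl (f y)) ∧
    (∀ x y, T.adj x y → S.cl (f.symm x) = S.cl (f.symm y)) ∧
    (∀ p, T.cl (f (S.src p)) = T.cl (T.src p)) ∧ (∀ p, T.cl (f (S.tgt p)) = T.cl (T.tgt p)) ∧
    ∀ x, S.wt x = T.wt (f x)

theorem CellIso.same {m n : ℕ} {a b : Diag m n} {S T : Surf a b} (h : S.CellIso T) :
    S.Same T := by
  obtain ⟨f, h1, h2, h3, h4, h5⟩ := h
  exact Same.of_map f f.symm h1 h2 (fun x => by rw [f.symm_apply_apply])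
    f.apply_symm_apply h3 h4
    fun x => ⟨fun h => (h (f.symm_apply_apply x).symm).elim, fun _ => h5 x⟩

theorem CellIso.deg_eq {m n : ℕ} {a b : Diag m n} {S T : Surf a b} (h : S.CellIso T) :
    S.deg = T.deg := by
  obtain ⟨f, -, -, -, -, h5⟩ := h
  let := S.fin
  let := T.fin
  exact Fintype.sum_equiv f _ _ fun x => by rw [h5]

end Surf

/-- Cobordisms between diagrams, composed from elementary ones by stacking in the cobordism
direction (`comp`) and by planar gluing (`glue`): identities, cylinders between diagrams with the
same components, dotted identities, disks that create or annihilate a circle, and saddles. -/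
inductive Mov : {m n : ℕ} → Diag m n → Diag m n → Type
  | id {m n : ℕ} (a : Diag m n) : Mov a a
  | comp {m n : ℕ} {a b c : Diag m n} (S : Mov a b) (T : Mov b c) : Mov a c
  | glue {m k n : ℕ} {a b : Diag m k} {a' b' : Diag k n} (S : Mov a b) (T : Mov a' b') :
      Mov (a.glue a') (b.glue b')
  | cyl {m n : ℕ} {a b : Diag m n} (e : a.Match b) : Mov a b
  | dot {m n : ℕ} (a : Diag m n) (p : a.Piece) : Mov a a
  | birth (n : ℕ) (i : Fin (n + 1)) : Mov (.strands n) (.circle n i)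
  | death (n : ℕ) (i : Fin (n + 1)) : Mov (.circle n i) (.strands n)
  | saddle (n : ℕ) (i : Fin (n + 1)) : Mov (.strands (n + 2)) (.turn n i)
  | unsaddle (n : ℕ) (i : Fin (n + 1)) : Mov (.turn n i) (.strands (n + 2))

open scoped Classical in
/-- The identity surface with additional weight `w` on the sheet over the piece `p`. -/
noncomputable def Surf.decorated {m n : ℕ} (a : Diag m n) (p : a.Piece) (w : ℤ × ℕ) : Surf a a :=
  Surf.id a (Pi.single p w)

theorem Surf.decorated_reflect {m n : ℕ} (a : Diag m n) (p : a.Piece) (w : ℤ × ℕ) :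
    (Surf.decorated a.reflect (a.reflectPiece p) w).CellIso (Surf.decorated a p w).reflect := by
  classical
  refine ⟨a.reflectPiece.symm, a.reflectPiece_adj', ?_, fun _ => rfl, fun _ => rfl, ?_⟩
  · intro x y h
    exact a.reflectPiece_adj x y h
  · intro x
    obtain ⟨y, rfl⟩ := a.reflectPiece.surjective x
    change Pi.single (M := fun _ => ℤ × ℕ) (a.reflectPiece p) w (a.reflectPiece y) =
      Pi.single (M := fun _ => ℤ × ℕ) p w (a.reflectPiece.symm (a.reflectPiece y))
    rw [Equiv.symm_apply_apply]
    simp only [Pi.single_apply, EmbeddingLike.apply_eq_iff_eq]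

namespace Mov

/-- The underlying abstract surface of a cobordism. -/
noncomputable def surf : {m n : ℕ} → {a b : Diag m n} → Mov a b → Surf a b
  | _, _, _, _, id a => Surf.id a 0
  | _, _, _, _, comp S T => S.surf.comp T.surf
  | _, _, _, _, glue S T => S.surf.glue T.surf
  | _, _, _, _, cyl e => Surf.cyl e
  | _, _, _, _, dot a p => Surf.decorated a p (0, 1)
  | _, _, _, _, birth n i => Surf.birth n i
  | _, _, _, _, death n i => (Surf.birth n i).flip
  | _, _, _, _, saddle n i => Surf.saddle n i
  | _, _, _, _, unsaddle n i => (Surf.saddle n i).flip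

/-- The reflection of a matching. -/
def _root_.BarNatan.Diag.Match.reflect {m n : ℕ} {a b : Diag m n} (e : a.Match b) :
    b.reflect.Match a.reflect where
  e := (b.reflectComp.symm.trans e.e.symm).trans a.reflectComp
  top i := by
    have h : b.reflect.comp (b.reflect.top i) = b.reflectComp (b.comp (b.bot i)) :=
      congrArg b.reflect.comp (b.reflectPiece_bot i).symm
    have h' : a.reflect.comp (a.reflect.top i) = a.reflectComp (a.comp (a.bot i)) :=
      congrArg a.reflect.comp (a.reflectPiece_bot i).symm
    rw [h, h', ← e.bot, Equiv.trans_apply, Equiv.trans_apply, Equiv.symm_apply_apply,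
      Equiv.symm_apply_apply]
  bot i := by
    have h : b.reflect.comp (b.reflect.bot i) = b.reflectComp (b.comp (b.top i)) :=
      congrArg b.reflect.comp (b.reflectPiece_top i).symm
    have h' : a.reflect.comp (a.reflect.bot i) = a.reflectComp (a.comp (a.top i)) :=
      congrArg a.reflect.comp (a.reflectPiece_top i).symm
    rw [h, h', ← e.top, Equiv.trans_apply, Equiv.trans_apply, Equiv.symm_apply_apply,
      Equiv.symm_apply_apply]

/-- The image of a cobordism under reflection of the square and of the cobordism direction. -/
noncomputable def reflect : {m n : ℕ} → {a b : Diag m n} → Mov a b → Mov b.reflect a.reflect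
  | _, _, _, _, id a => id a.reflect
  | _, _, _, _, comp S T => comp T.reflect S.reflect
  | _, _, _, _, glue S T => glue T.reflect S.reflect
  | _, _, _, _, cyl e => cyl e.reflect
  | _, _, _, _, dot a p => dot a.reflect (a.reflectPiece p)
  | _, _, _, _, birth n i => death n i
  | _, _, _, _, death n i => birth n i
  | _, _, _, _, saddle n i => unsaddle n i
  | _, _, _, _, unsaddle n i => saddle n i

end Mov

theorem exists_bend_option (n : ℕ) (i : Fin (n + 1)) (o : Option (Fin n)) :
    ∃ j, bend n i j = o := by
  cases o with
  | some l => exact exists_bend n i l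
  | none => exact ⟨⟨i.val, by omega⟩, by simp [bend]⟩

theorem Diag.circle_comp (n : ℕ) (i : Fin (n + 1)) (o : Option (Fin n)) :
    (Diag.circle n i).comp (.inl o) = (Diag.circle n i).comp (.inr o) := by
  obtain ⟨j, rfl⟩ := exists_bend_option n i o
  exact Quot.sound (GlueRel.link (r := (Diag.cap n i).Adj) (s := (Diag.cup n i).Adj)
    (f := (Diag.cap n i).bot) (g := (Diag.cup n i).top) j)

theorem Surf.CellIso.comp_reflect {m n : ℕ} {a b c : Diag m n} {S : Surf a b} {T : Surf b c}
    {S' : Surf b.reflect a.reflect} {T' : Surf c.reflect b.reflect}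
    (hS : S'.CellIso S.reflect) (hT : T'.CellIso T.reflect) :
    (T'.comp S').CellIso (S.comp T).reflect := by
  obtain ⟨f, h1, h2, h3, h4, h5⟩ := hS
  obtain ⟨g, k1, k2, k3, k4, k5⟩ := hT
  refine ⟨(Equiv.sumCongr g f).trans (Equiv.sumComm _ _), ?_, ?_, ?_, ?_, ?_⟩
  · rintro _ _ (h | h | i)
    · exact GlueRel.mk_right (k1 _ _ h)
    · exact GlueRel.mk_left (h1 _ _ h)
    · have e1 := GlueRel.mk_right (r := S.adj) (f := S.tgt) (g := T.src) (k4 i)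
      have e2 := GlueRel.mk_left (s := T.adj) (f := S.tgt) (g := T.src) (h3 i)
      exact e1.trans ((Quot.sound (GlueRel.link (b.reflectPiece.symm i))).symm.trans e2.symm)
  · rintro _ _ (h | h | i)
    · exact GlueRel.mk_right (h2 _ _ h)
    · exact GlueRel.mk_left (k2 _ _ h)
    · obtain ⟨i, rfl⟩ := b.reflectPiece.symm.surjective i
      have e1 : S'.cl (f.symm (S.tgt (b.reflectPiece.symm i))) = S'.cl (S'.src i) := by
        have := congrArg (Quot.lift (fun x => S'.cl (f.symm x)) h2) (h3 i)
        change S'.cl (f.symm (f (S'.src i))) = S'.cl (f.symm (S.tgt (b.reflectPiece.symm i))) at this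
        rw [← this, f.symm_apply_apply]
      have e2 : T'.cl (g.symm (T.src (b.reflectPiece.symm i))) = T'.cl (T'.tgt i) := by
        have := congrArg (Quot.lift (fun x => T'.cl (g.symm x)) k2) (k4 i)
        change T'.cl (g.symm (g (T'.tgt i))) = T'.cl (g.symm (T.src (b.reflectPiece.symm i))) at this
        rw [← this, g.symm_apply_apply]
      exact (GlueRel.mk_right e1).trans
        ((Quot.sound (GlueRel.link i)).symm.trans (GlueRel.mk_left e2).symm)
  · exact fun p => GlueRel.mk_right (k3 p)
  · exact fun p => GlueRel.mk_left (h4 p)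
  · rintro (x | x)
    · exact k5 x
    · exact h5 x

theorem Surf.CellIso.glue_reflect {m k n : ℕ} {a b : Diag m k} {a' b' : Diag k n} {S : Surf a b}
    {T : Surf a' b'} {S' : Surf b.reflect a.reflect} {T' : Surf b'.reflect a'.reflect}
    (hS : S'.CellIso S.reflect) (hT : T'.CellIso T.reflect) :
    (T'.glue S').CellIso (S.glue T).reflect := by
  obtain ⟨f, h1, h2, h3, h4, h5⟩ := hS
  obtain ⟨g, k1, k2, k3, k4, k5⟩ := hT
  have link : ∀ i, (S.glue T).cl (.inr (g (T'.src (b'.reflect.bot i)))) =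
      (S.glue T).cl (.inl (f (S'.src (b.reflect.top i)))) := by
    intro i
    have e1 := GlueRel.mk_right (r := S.adj) (f := fun i => S.src (a.bot i))
      (g := fun i => T.src (a'.top i)) (k3 (b'.reflect.bot i))
    have e2 := GlueRel.mk_left (s := T.adj) (f := fun i => S.src (a.bot i))
      (g := fun i => T.src (a'.top i)) (h3 (b.reflect.top i))
    refine e1.trans (Eq.trans ?_ e2.symm)
    change Quot.mk _ (Sum.inr (T.tgt (b'.reflectPiece.symm (b'.reflect.bot i)))) =
      Quot.mk _ (Sum.inl (S.tgt (b.reflectPiece.symm (b.reflect.top i))))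
    rw [← b'.reflectPiece_top, ← b.reflectPiece_bot, Equiv.symm_apply_apply,
      Equiv.symm_apply_apply]
    exact (GlueRel.mk_right (T.side_top i)).symm.trans ((Quot.sound (GlueRel.link i)).symm.trans
      (GlueRel.mk_left (S.side_bot i)))
  refine ⟨(Equiv.sumCongr g f).trans (Equiv.sumComm _ _), ?_, ?_, ?_, ?_, ?_⟩
  · rintro _ _ (h | h | i)
    · exact GlueRel.mk_right (k1 _ _ h)
    · exact GlueRel.mk_left (h1 _ _ h)
    · exact link i
  · rintro _ _ (h | h | i)
    · exact GlueRel.mk_right (h2 _ _ h)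
    · exact GlueRel.mk_left (k2 _ _ h)
    · have e1 : S'.cl (f.symm (S.src (a.bot i))) = S'.cl (S'.tgt (a.reflect.top i)) := by
        have := congrArg (Quot.lift (fun x => S'.cl (f.symm x)) h2) (h4 (a.reflect.top i))
        change S'.cl (f.symm (f (S'.tgt (a.reflect.top i)))) =
          S'.cl (f.symm (S.src (a.reflectPiece.symm (a.reflect.top i)))) at this
        rw [f.symm_apply_apply, ← a.reflectPiece_bot, Equiv.symm_apply_apply] at this
        rw [← this, a.reflectPiece_bot]
      have e2 : T'.cl (g.symm (T.src (a'.top i))) = T'.cl (T'.tgt (a'.reflect.bot i)) := by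
        have := congrArg (Quot.lift (fun x => T'.cl (g.symm x)) k2) (k4 (a'.reflect.bot i))
        change T'.cl (g.symm (g (T'.tgt (a'.reflect.bot i)))) =
          T'.cl (g.symm (T.src (a'.reflectPiece.symm (a'.reflect.bot i)))) at this
        rw [g.symm_apply_apply, ← a'.reflectPiece_top, Equiv.symm_apply_apply] at this
        rw [← this, a'.reflectPiece_top]
      have e3 : (T'.glue S').cl (.inl (T'.tgt (a'.reflect.bot i))) =
          (T'.glue S').cl (.inr (S'.tgt (a.reflect.top i))) :=
        (GlueRel.mk_left (T'.side_bot i)).symm.trans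
          ((Quot.sound (GlueRel.link i)).trans (GlueRel.mk_right (S'.side_top i)))
      exact (GlueRel.mk_right e1).trans (e3.symm.trans (GlueRel.mk_left e2).symm)
  · rintro (p | p)
    · exact GlueRel.mk_right (k3 p)
    · exact GlueRel.mk_left (h3 p)
  · rintro (p | p)
    · exact GlueRel.mk_right (k4 p)
    · exact GlueRel.mk_left (h4 p)
  · rintro (x | x)
    · exact k5 x
    · exact h5 x

theorem Mov.surf_reflect {m n : ℕ} {a b : Diag m n} (S : Mov a b) :
    S.reflect.surf.CellIso S.surf.reflect := by
  induction S with
  | id a =>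
    exact ⟨a.reflectPiece.symm, a.reflectPiece_adj', a.reflectPiece_adj, fun _ => rfl,
      fun _ => rfl, fun _ => rfl⟩
  | comp S T hS hT => exact hS.comp_reflect hT
  | glue S T hS hT => exact hS.glue_reflect hT
  | @cyl m n a b e =>
    refine ⟨b.reflectComp.symm.trans e.e.symm, fun _ _ h => h.elim, fun _ _ h => h.elim,
      fun _ => rfl, fun p => ?_, fun _ => rfl⟩
    change Quot.mk _ (e.e.symm (b.reflectComp.symm (e.reflect.e.symm (a.reflect.comp p)))) =
      Quot.mk _ (a.reflectComp.symm (a.reflect.comp p))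
    congr 1
    simp only [Diag.Match.reflect, Equiv.symm_trans_apply, Equiv.symm_symm,
      Equiv.symm_apply_apply]
  | dot a p => exact Surf.decorated_reflect a p _
  | birth n i =>
    refine ⟨Equiv.refl _, fun _ _ h => Quot.sound h, fun _ _ h => Quot.sound h, ?_, ?_,
      fun _ => rfl⟩
    · rintro (o | o)
      · exact Diag.circle_comp n i o
      · exact (Diag.circle_comp n i o).symm
    · exact fun _ => rfl
  | death n i =>
    refine ⟨Equiv.refl _, fun _ _ h => Quot.sound h, fun _ _ h => Quot.sound h, ?_, ?_,
      fun _ => rfl⟩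
    · exact fun _ => rfl
    · rintro (o | o)
      · exact Diag.circle_comp n i o
      · exact (Diag.circle_comp n i o).symm
  | saddle n i =>
    refine ⟨Equiv.refl _, fun _ _ h => h.elim, fun _ _ h => h.elim, ?_, ?_, fun _ => rfl⟩
    · rintro (o | o) <;> rfl
    · exact fun _ => rfl
  | unsaddle n i =>
    refine ⟨Equiv.refl _, fun _ _ h => h.elim, fun _ _ h => h.elim, ?_, ?_, fun _ => rfl⟩
    · exact fun _ => rfl
    · rintro (o | o) <;> rfl

namespace Mov

/-- The identity with `k` dots on the sheet over the piece `p`. -/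
def dots {m n : ℕ} (a : Diag m n) (p : a.Piece) : ℕ → Mov a a
  | 0 => id a
  | k + 1 => comp (dots a p k) (dot a p)

/-- The identity of `n` strands together with a sphere that has `k` dots. -/
def sphere (n : ℕ) (i : Fin (n + 1)) (t : Bool) (k : ℕ) : Mov (.strands n) (.strands n) :=
  comp (birth n i) (comp (dots (.circle n i) (Diag.half n i t) k) (death n i))

end Mov

open Finsupp (single)

/-- The elements of the free `ℤ[α]`-modules on cobordisms that are set to zero: differences of
homeomorphic surfaces, and the local relations, closed under stacking and planar gluing. -/
inductive Rel : {m n : ℕ} → {a b : Diag m n} → (Mov a b →₀ ℤ[X]) → Prop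
  | same {m n : ℕ} {a b : Diag m n} (S T : Mov a b) (h : S.surf.Same T.surf) :
      Rel (single S 1 - single T 1)
  /-- Spheres with `0`, `1`, `2`, `3` dots are `0`, `1`, `0`, `α`. -/
  | sphere (n : ℕ) (i : Fin (n + 1)) (t : Bool) (k : Fin 4) :
      Rel (single (Mov.sphere n i t k) 1 - single (Mov.id (.strands n)) (![0, 1, 0, X] k))
  /-- A tube is the sum of the two ways to put a dot on one of the disks that close it. -/
  | neck (n : ℕ) (i : Fin (n + 1)) (t : Bool) :
      Rel (single (Mov.id (.circle n i)) 1
        - single (.comp (.dot (.circle n i) (Diag.half n i t))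
            (.comp (.death n i) (.birth n i))) 1
        - single (.comp (.comp (.death n i) (.birth n i))
            (.dot (.circle n i) (Diag.half n i t))) 1)
  /-- A handle is twice a dot. -/
  | handle {m n : ℕ} (a : Diag m n) (p : a.Piece) (S : Mov a a)
      (h : S.surf.Same (Surf.decorated a p (2, 0))) :
      Rel (single S 1 - single (Mov.dot a p) 2)
  | comp_left {m n : ℕ} {a b c : Diag m n} (S : Mov a b) (u : Mov b c →₀ ℤ[X]) (h : Rel u) :
      Rel (u.mapDomain fun T => S.comp T)
  | comp_right {m n : ℕ} {a b c : Diag m n} (T : Mov b c) (u : Mov a b →₀ ℤ[X]) (h : Rel u) :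
      Rel (u.mapDomain fun S => S.comp T)
  | glue_left {m k n : ℕ} {a b : Diag m k} {a' b' : Diag k n} (S : Mov a b)
      (u : Mov a' b' →₀ ℤ[X]) (h : Rel u) : Rel (u.mapDomain fun T => S.glue T)
  | glue_right {m k n : ℕ} {a b : Diag m k} {a' b' : Diag k n} (T : Mov a' b')
      (u : Mov a b →₀ ℤ[X]) (h : Rel u) : Rel (u.mapDomain fun S => S.glue T)

/-- `ℤ[α]`-linear combinations of dotted cobordisms modulo the relations (`α` is `X`). -/
def CobHom {m n : ℕ} (a b : Diag m n) : Type :=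
  (Mov a b →₀ ℤ[X]) ⧸ Submodule.span ℤ[X] {u : Mov a b →₀ ℤ[X] | Rel u}

noncomputable instance {m n : ℕ} (a b : Diag m n) : AddCommGroup (CobHom a b) :=
  inferInstanceAs (AddCommGroup
    ((Mov a b →₀ ℤ[X]) ⧸ Submodule.span ℤ[X] {u : Mov a b →₀ ℤ[X] | Rel u}))

noncomputable instance {m n : ℕ} (a b : Diag m n) : Module ℤ[X] (CobHom a b) :=
  inferInstanceAs (Module ℤ[X]
    ((Mov a b →₀ ℤ[X]) ⧸ Submodule.span ℤ[X] {u : Mov a b →₀ ℤ[X] | Rel u}))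

namespace CobHom

variable {m n k : ℕ}

/-- The class of a linear combination of cobordisms. -/
noncomputable def mk (a b : Diag m n) : (Mov a b →₀ ℤ[X]) →ₗ[ℤ[X]] CobHom a b :=
  Submodule.mkQ _

/-- The class of a cobordism. -/
noncomputable def of {a b : Diag m n} (S : Mov a b) : CobHom a b := mk a b (single S 1)

theorem smul_of {a b : Diag m n} (r : ℤ[X]) (S : Mov a b) :
    r • of S = mk a b (single S r) := by
  rw [of, ← map_smul, Finsupp.smul_single, smul_eq_mul, mul_one]

theorem mk_eq_zero {a b : Diag m n} {u : Mov a b →₀ ℤ[X]} (h : Rel u) :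
    mk a b u = 0 :=
  (Submodule.Quotient.mk_eq_zero _).2 (Submodule.subset_span h)

theorem of_eq {a b : Diag m n} {S T : Mov a b} (h : S.surf.Same T.surf) : of S = of T :=
  sub_eq_zero.1 ((map_sub (mk a b) _ _).symm.trans (mk_eq_zero (Rel.same S T h)))

theorem hom_ext {a b : Diag m n} {M : Type} [AddCommGroup M] [Module ℤ[X] M]
    {f g : CobHom a b →ₗ[ℤ[X]] M} (h : ∀ S, f (of S) = g (of S)) : f = g := by
  refine Submodule.linearMap_qext _ (Finsupp.lhom_ext' fun S => LinearMap.ext_ring ?_)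
  exact h S

/-- The linear map given on cobordisms by a function that respects the relations. -/
noncomputable def lift {a b : Diag m n} {M : Type} [AddCommGroup M] [Module ℤ[X] M]
    (f : Mov a b → M) (hf : ∀ u, Rel u → Finsupp.linearCombination ℤ[X] f u = 0) :
    CobHom a b →ₗ[ℤ[X]] M :=
  Submodule.liftQ _ (Finsupp.linearCombination ℤ[X] f) (Submodule.span_le.2 hf)

theorem lift_of {a b : Diag m n} {M : Type} [AddCommGroup M] [Module ℤ[X] M]
    (f : Mov a b → M) (hf : ∀ u, Rel u → Finsupp.linearCombination ℤ[X] f u = 0) (S : Mov a b) :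
    lift f hf (of S) = f S := by
  refine (Submodule.liftQ_apply _ _ _).trans ?_
  rw [Finsupp.linearCombination_single, one_smul]

theorem linearCombination_of {m' n' : ℕ} {a b : Diag m n} {a' b' : Diag m' n'}
    (f : Mov a b → Mov a' b') (u : Mov a b →₀ ℤ[X]) :
    Finsupp.linearCombination ℤ[X] (fun S => of (f S)) u =
      mk a' b' (u.mapDomain f) := by
  induction u using Finsupp.induction_linear with
  | zero => rw [map_zero, Finsupp.mapDomain_zero, map_zero]
  | add u v hu hv => rw [map_add, hu, hv, Finsupp.mapDomain_add, map_add]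
  | single S r =>
    rw [Finsupp.linearCombination_single, Finsupp.mapDomain_single, smul_of]

/-- Composition: stacking in the cobordism direction. -/
noncomputable def comp {a b c : Diag m n} :
    CobHom a b →ₗ[ℤ[X]] CobHom b c →ₗ[ℤ[X]] CobHom a c :=
  lift (fun S => lift (fun T => of (S.comp T)) fun u hu =>
    (linearCombination_of _ u).trans (mk_eq_zero (hu.comp_left S u))) fun u hu => by
      refine hom_ext fun T => ?_
      rw [Finsupp.linearCombination_apply, Finsupp.sum, LinearMap.sum_apply, LinearMap.zero_apply]
      simp only [LinearMap.smul_apply, lift_of]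
      exact (linearCombination_of (fun S => S.comp T) u).trans (mk_eq_zero (hu.comp_right T u))

/-- Gluing in the planar direction. -/
noncomputable def glue {a b : Diag m k} {a' b' : Diag k n} :
    CobHom a b →ₗ[ℤ[X]] CobHom a' b' →ₗ[ℤ[X]] CobHom (a.glue a') (b.glue b') :=
  lift (fun S => lift (fun T => of (S.glue T)) fun u hu =>
    (linearCombination_of _ u).trans (mk_eq_zero (hu.glue_left S u))) fun u hu => by
      refine hom_ext fun T => ?_
      rw [Finsupp.linearCombination_apply, Finsupp.sum, LinearMap.sum_apply, LinearMap.zero_apply]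
      simp only [LinearMap.smul_apply, lift_of]
      exact (linearCombination_of (fun S => S.glue T) u).trans (mk_eq_zero (hu.glue_right T u))

theorem comp_of {a b c : Diag m n} (S : Mov a b) (T : Mov b c) :
    comp (of S) (of T) = of (S.comp T) := by
  rw [comp, lift_of, lift_of]

theorem glue_of {a b : Diag m k} {a' b' : Diag k n} (S : Mov a b) (T : Mov a' b') :
    glue (of S) (of T) = of (S.glue T) := by
  rw [glue, lift_of, lift_of]

theorem induction_on {a b : Diag m n} {p : CobHom a b → Prop} (x : CobHom a b)
    (h0 : p 0) (ha : ∀ x y, p x → p y → p (x + y)) (hs : ∀ (r : ℤ[X]) S, p (r • of S)) : p x := by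
  obtain ⟨u, rfl⟩ : ∃ u, mk a b u = x := Submodule.mkQ_surjective _ x
  induction u using Finsupp.induction_linear with
  | zero => rw [map_zero]; exact h0
  | add u v hu hv => rw [map_add]; exact ha _ _ hu hv
  | single S r =>
    exact smul_of r S ▸ hs r S

theorem id_comp {a b : Diag m n} (x : CobHom a b) : comp (of (Mov.id a)) x = x := by
  have : comp (of (Mov.id a)) = (LinearMap.id : CobHom a b →ₗ[ℤ[X]] CobHom a b) := by
    refine hom_ext fun S => ?_
    rw [comp_of]
    exact of_eq S.surf.id_comp_same
  rw [this, LinearMap.id_apply]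

theorem comp_id {a b : Diag m n} (x : CobHom a b) : comp x (of (Mov.id b)) = x := by
  have : comp.flip (of (Mov.id b)) = (LinearMap.id : CobHom a b →ₗ[ℤ[X]] CobHom a b) := by
    refine hom_ext fun S => ?_
    rw [LinearMap.flip_apply, comp_of]
    exact of_eq S.surf.comp_id_same
  exact congrArg (fun f => f x) this

theorem assoc {a b c d : Diag m n} (x : CobHom a b) (y : CobHom b c) (z : CobHom c d) :
    comp (comp x y) z = comp x (comp y z) := by
  induction x using induction_on with
  | h0 => simp only [map_zero, LinearMap.zero_apply]
  | ha x x' h h' => simp only [map_add, LinearMap.add_apply, h, h']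
  | hs r S =>
    simp only [map_smul, LinearMap.smul_apply]
    congr 1
    induction y using induction_on with
    | h0 => simp only [map_zero, LinearMap.zero_apply]
    | ha x x' h h' => simp only [map_add, LinearMap.add_apply, h, h']
    | hs r T =>
      simp only [map_smul, LinearMap.smul_apply]
      congr 1
      induction z using induction_on with
      | h0 => simp only [map_zero]
      | ha x x' h h' => simp only [map_add, h, h']
      | hs r U =>
        simp only [map_smul, comp_of]
        congr 1
        exact of_eq (Surf.assoc_same _ _ _)

theorem glue_comp {a b c : Diag m k} {a' b' c' : Diag k n} (x : CobHom a b) (y : CobHom b c)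
    (x' : CobHom a' b') (y' : CobHom b' c') :
    glue (comp x y) (comp x' y') = comp (glue x x') (glue y y') := by
  induction x using induction_on with
  | h0 => simp only [map_zero, LinearMap.zero_apply]
  | ha u v h h' => simp only [map_add, LinearMap.add_apply, h, h']
  | hs r S =>
    simp only [map_smul, LinearMap.smul_apply]
    congr 1
    induction y using induction_on with
    | h0 => simp only [map_zero, LinearMap.zero_apply]
    | ha u v h h' => simp only [map_add, LinearMap.add_apply, h, h']
    | hs r T =>
      simp only [map_smul, LinearMap.smul_apply]
      congr 1
      induction x' using induction_on with
      | h0 => simp only [map_zero, LinearMap.zero_apply]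
      | ha u v h h' => simp only [map_add, LinearMap.add_apply, h, h']
      | hs r S' =>
        simp only [map_smul, LinearMap.smul_apply]
        congr 1
        induction y' using induction_on with
        | h0 => simp only [map_zero]
        | ha u v h h' => simp only [map_add, h, h']
        | hs r T' =>
          simp only [map_smul, comp_of, glue_of]
          congr 1
          exact of_eq (Surf.glue_comp_same _ _ _ _)

theorem glue_id (a : Diag m k) (b : Diag k n) :
    glue (of (Mov.id a)) (of (Mov.id b)) = of (Mov.id (a.glue b)) := by
  rw [glue_of]
  exact of_eq (Surf.glue_id_same a b)

/-! ### Reflection -/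

theorem dot_comp_dots (a : Diag m n) (p : a.Piece) (j : ℕ) :
    comp (of (Mov.dot a p)) (of (Mov.dots a p j)) = of (Mov.dots a p (j + 1)) := by
  induction j with
  | zero =>
    refine Eq.trans ?_ (comp_of _ _)
    exact (comp_id _).trans (id_comp _).symm
  | succ j ih => rw [Mov.dots, ← comp_of, ← assoc, ih, comp_of]; rfl

theorem of_dots_reflect (a : Diag m n) (p : a.Piece) (j : ℕ) :
    of (Mov.dots a p j).reflect = of (Mov.dots a.reflect (a.reflectPiece p) j) := by
  induction j with
  | zero => rfl
  | succ j ih => rw [← dot_comp_dots, ← ih, comp_of]; rfl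

theorem reflect_rel {a b : Diag m n} (u : Mov a b →₀ ℤ[X]) (h : Rel u) :
    Finsupp.linearCombination ℤ[X] (fun S : Mov a b => of S.reflect) u = 0 := by
  induction h with
  | same S T h =>
    rw [map_sub, Finsupp.linearCombination_single, Finsupp.linearCombination_single, one_smul,
      one_smul, sub_eq_zero]
    exact of_eq (S.surf_reflect.same.trans (h.reflect.trans T.surf_reflect.same.symm))
  | sphere n i t k =>
    rw [map_sub, Finsupp.linearCombination_single, Finsupp.linearCombination_single, one_smul]
    have h1 : of (Mov.sphere n i t k).reflect = of (Mov.sphere n i (!t) k) := by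
      have h2 : (Diag.circle n i).reflectPiece (Diag.half n i t) = Diag.half n i (!t) := by
        cases t <;> rfl
      have h3 := of_dots_reflect (Diag.circle n i) (Diag.half n i t) k
      rw [h2] at h3
      have h4 : ∀ D D' : Mov (Diag.circle n i) (Diag.circle n i), of D = of D' →
          of (Mov.comp (Mov.comp (Mov.birth n i) D) (Mov.death n i)) =
            of (Mov.comp (Mov.birth n i) (Mov.comp D' (Mov.death n i))) := fun D D' h => by
        rw [← comp_of, ← comp_of, ← comp_of, ← comp_of, h, assoc]
      exact h4 _ _ h3
    have h4 := mk_eq_zero (Rel.sphere n i (!t) k)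
    rw [h1]
    refine Eq.trans ?_ h4
    rw [map_sub]
    refine congrArg (fun y => of (Mov.sphere n i (!t) k) - y) ?_
    exact smul_of _ (Mov.id (Diag.strands n))
  | neck n i t =>
    simp only [map_sub, Finsupp.linearCombination_single, one_smul]
    have h2 : (Diag.circle n i).reflectPiece (Diag.half n i t) = Diag.half n i (!t) := by
      cases t <;> rfl
    have h4 := mk_eq_zero (Rel.neck n i (!t))
    rw [map_sub, map_sub, sub_right_comm] at h4
    refine Eq.trans ?_ h4
    rw [← h2]
    rfl
  | handle a p S h =>
    rw [map_sub, Finsupp.linearCombination_single, Finsupp.linearCombination_single, one_smul]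
    have h4 := mk_eq_zero (Rel.handle a.reflect (a.reflectPiece p) S.reflect
      (S.surf_reflect.same.trans (h.reflect.trans (Surf.decorated_reflect a p _).same.symm)))
    refine Eq.trans ?_ h4
    rw [map_sub]
    refine congrArg (fun y => of S.reflect - y) ?_
    exact smul_of _ (Mov.dot a.reflect (a.reflectPiece p))
  | comp_left S u h ih =>
    rw [Finsupp.linearCombination_mapDomain]
    refine Eq.trans ?_ ((congrArg (comp.flip (of S.reflect)) ih).trans (map_zero _))
    rw [Finsupp.apply_linearCombination]
    exact congrArg (fun f => Finsupp.linearCombination ℤ[X] f u)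
      (funext fun T => (comp_of T.reflect S.reflect).symm)
  | comp_right T u h ih =>
    rw [Finsupp.linearCombination_mapDomain]
    refine Eq.trans ?_ ((congrArg (comp (of T.reflect)) ih).trans (map_zero _))
    rw [Finsupp.apply_linearCombination]
    exact congrArg (fun f => Finsupp.linearCombination ℤ[X] f u)
      (funext fun S => (comp_of T.reflect S.reflect).symm)
  | glue_left S u h ih =>
    rw [Finsupp.linearCombination_mapDomain]
    refine Eq.trans ?_ ((congrArg (glue.flip (of S.reflect)) ih).trans (map_zero _))
    rw [Finsupp.apply_linearCombination]
    exact congrArg (fun f => Finsupp.linearCombination ℤ[X] f u)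
      (funext fun T => (glue_of T.reflect S.reflect).symm)
  | glue_right T u h ih =>
    rw [Finsupp.linearCombination_mapDomain]
    refine Eq.trans ?_ ((congrArg (glue (of T.reflect)) ih).trans (map_zero _))
    rw [Finsupp.apply_linearCombination]
    exact congrArg (fun f => Finsupp.linearCombination ℤ[X] f u)
      (funext fun S => (glue_of T.reflect S.reflect).symm)

/-- The image under reflection of the square and of the cobordism direction. -/
noncomputable def reflect {a b : Diag m n} :
    CobHom a b →ₗ[ℤ[X]] CobHom b.reflect a.reflect :=
  lift (fun S => of S.reflect) reflect_rel

theorem reflect_of {a b : Diag m n} (S : Mov a b) : reflect (of S) = of S.reflect :=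
  lift_of _ _ _

theorem reflect_comp {a b c : Diag m n} (x : CobHom a b) (y : CobHom b c) :
    reflect (comp x y) = comp (reflect y) (reflect x) := by
  induction x using induction_on with
  | h0 => simp only [map_zero, LinearMap.zero_apply]
  | ha u v h h' => simp only [map_add, LinearMap.add_apply, h, h']
  | hs r S =>
    simp only [map_smul, LinearMap.smul_apply]
    congr 1
    induction y using induction_on with
    | h0 => simp only [map_zero, LinearMap.zero_apply]
    | ha u v h h' => simp only [map_add, LinearMap.add_apply, h, h']
    | hs r T =>
      simp only [map_smul, LinearMap.smul_apply, comp_of, reflect_of]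
      rfl

end CobHom

namespace CobHom

variable {m n k : ℕ}

/-- The homogeneous morphisms of degree `d` (the degree of `α` is `4`). -/
noncomputable def part {m n : ℕ} (a b : Diag m n) (d : ℤ) : AddSubgroup (CobHom a b) :=
  AddSubgroup.closure
    {x | ∃ (S : Mov a b) (r : ℕ), S.surf.deg + 4 * r = d ∧ x = (X : ℤ[X]) ^ r • of S}

theorem part_congr {a b : Diag m n} {d e : ℤ} (h : d = e) {x : CobHom a b} (hx : x ∈ part a b d) :
    x ∈ part a b e := h ▸ hx

theorem id_mem (a : Diag m n) : of (Mov.id a) ∈ part a a 0 :=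
  AddSubgroup.subset_closure ⟨Mov.id a, 0, by rw [Mov.surf, Surf.deg_id]; rfl,
    by rw [pow_zero, one_smul]⟩

/-- A bilinear operation that is additive on degrees of cobordisms preserves homogeneity. -/
theorem bilin_mem {m' n' m'' n'' : ℕ} {a b : Diag m n} {a' b' : Diag m' n'} {a'' b'' : Diag m'' n''}
    (f : CobHom a b →ₗ[ℤ[X]] CobHom a' b' →ₗ[ℤ[X]] CobHom a'' b'')
    (hf : ∀ S T, ∃ U : Mov a'' b'', f (of S) (of T) = of U ∧
      U.surf.deg = S.surf.deg + T.surf.deg) {d e : ℤ} {x : CobHom a b} {y : CobHom a' b'}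
    (hx : x ∈ part a b d) (hy : y ∈ part a' b' e) : f x y ∈ part a'' b'' (d + e) := by
  induction hx using AddSubgroup.closure_induction with
  | zero => rw [map_zero, LinearMap.zero_apply]; exact zero_mem _
  | add x x' _ _ h h' => rw [map_add, LinearMap.add_apply]; exact add_mem h h'
  | neg x _ h => rw [map_neg, LinearMap.neg_apply]; exact neg_mem h
  | mem x h =>
    obtain ⟨S, r, hr, rfl⟩ := h
    induction hy using AddSubgroup.closure_induction with
    | zero => rw [map_zero]; exact zero_mem _
    | add x x' _ _ h h' => rw [map_add]; exact add_mem h h'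
    | neg x _ h => rw [map_neg]; exact neg_mem h
    | mem x h =>
      obtain ⟨T, s, hs, rfl⟩ := h
      obtain ⟨U, hU, hd⟩ := hf S T
      refine AddSubgroup.subset_closure ⟨U, r + s, ?_, ?_⟩
      · rw [hd, ← hr, ← hs]; push_cast; ring
      · rw [map_smul, map_smul, LinearMap.smul_apply, hU, smul_smul, ← pow_add, add_comm s r]

theorem comp_mem {a b c : Diag m n} {d e : ℤ} {x : CobHom a b} {y : CobHom b c}
    (hx : x ∈ part a b d) (hy : y ∈ part b c e) : comp x y ∈ part a c (d + e) :=
  bilin_mem comp (fun S T => ⟨S.comp T, comp_of S T, by rw [Mov.surf, Surf.deg_comp]⟩) hx hy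

theorem glue_mem {a b : Diag m k} {a' b' : Diag k n} {d e : ℤ} {x : CobHom a b}
    {y : CobHom a' b'} (hx : x ∈ part a b d) (hy : y ∈ part a' b' e) :
    glue x y ∈ part (a.glue a') (b.glue b') (d + e) :=
  bilin_mem glue (fun S T => ⟨S.glue T, glue_of S T, by rw [Mov.surf, Surf.deg_glue]⟩) hx hy

theorem reflect_mem {a b : Diag m n} {d : ℤ} {x : CobHom a b} (hx : x ∈ part a b d) :
    reflect x ∈ part b.reflect a.reflect d := by
  induction hx using AddSubgroup.closure_induction with
  | zero => rw [map_zero]; exact zero_mem _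
  | add x x' _ _ h h' => rw [map_add]; exact add_mem h h'
  | neg x _ h => rw [map_neg]; exact neg_mem h
  | mem x h =>
    obtain ⟨S, r, hr, rfl⟩ := h
    refine AddSubgroup.subset_closure ⟨S.reflect, r, ?_, ?_⟩
    · rw [S.surf_reflect.deg_eq, Surf.deg_reflect, hr]
    · rw [map_smul, reflect_of]

end CobHom

/-- Formally shifted diagrams `q ^ shift diag` with `m` endpoints on top and `n` on the bottom. -/
structure Cob (m n : ℕ) where
  shift : ℤ
  diag : Diag m n

namespace Cob

variable {m n k : ℕ}

/-- Morphisms of `Cob m n` are the morphisms of degree `0`: a cobordism `S` has, as a morphism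
from `q ^ k a` to `q ^ l b`, the degree `l - k - χ(S) + (m + n) / 2`. -/
noncomputable instance : Category (Cob m n) where
  Hom Y Z := CobHom.part Y.diag Z.diag (Y.shift - Z.shift)
  id Y := ⟨CobHom.of (Mov.id Y.diag), CobHom.part_congr (sub_self _).symm (CobHom.id_mem _)⟩
  comp f g := ⟨CobHom.comp f.1 g.1,
    CobHom.part_congr (sub_add_sub_cancel _ _ _) (CobHom.comp_mem f.2 g.2)⟩
  id_comp f := Subtype.ext (CobHom.id_comp f.1)
  comp_id f := Subtype.ext (CobHom.comp_id f.1)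
  assoc f g h := Subtype.ext (CobHom.assoc f.1 g.1 h.1)

noncomputable instance : Preadditive (Cob m n) where
  homGroup Y Z := inferInstanceAs
    (AddCommGroup (CobHom.part Y.diag Z.diag (Y.shift - Z.shift)))
  add_comp _ _ _ f f' g := Subtype.ext
    (by exact (congrArg (fun h => h g.1) (map_add CobHom.comp f.1 f'.1)))
  comp_add _ _ _ f g g' := Subtype.ext (map_add (CobHom.comp f.1) g.1 g'.1)

theorem hom_ext {Y Z : Cob m n} {f g : Y ⟶ Z} (h : f.1 = g.1) : f = g := Subtype.ext h

/-- Gluing of a diagram above another one. -/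
def glueObj (Y : Cob m k) (Z : Cob k n) : Cob m n := ⟨Y.shift + Z.shift, Y.diag.glue Z.diag⟩

/-- Gluing of morphisms. -/
noncomputable def glueHom {Y Y' : Cob m k} {Z Z' : Cob k n} (f : Y ⟶ Y') (g : Z ⟶ Z') :
    glueObj Y Z ⟶ glueObj Y' Z' :=
  ⟨CobHom.glue f.1 g.1, CobHom.part_congr (by simp only [glueObj]; ring)
    (CobHom.glue_mem f.2 g.2)⟩

theorem glueHom_id (Y : Cob m k) (Z : Cob k n) : glueHom (𝟙 Y) (𝟙 Z) = 𝟙 (glueObj Y Z) :=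
  hom_ext (CobHom.glue_id _ _)

theorem glueHom_comp {Y Y' Y'' : Cob m k} {Z Z' Z'' : Cob k n} (f : Y ⟶ Y') (f' : Y' ⟶ Y'')
    (g : Z ⟶ Z') (g' : Z' ⟶ Z'') :
    glueHom (f ≫ f') (g ≫ g') = glueHom f g ≫ glueHom f' g' :=
  hom_ext (CobHom.glue_comp _ _ _ _)

/-- Gluing as a bifunctor. -/
noncomputable def gluing (m k n : ℕ) : Cob m k ⥤ Cob k n ⥤ Cob m n where
  obj Y :=
    { obj := fun Z => glueObj Y Z
      map := fun g => glueHom (𝟙 Y) g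
      map_id := fun Z => glueHom_id Y Z
      map_comp := fun g g' => by rw [← glueHom_comp, Category.comp_id] }
  map f :=
    { app := fun Z => glueHom f (𝟙 Z)
      naturality := fun Z Z' g => by
        rw [← glueHom_comp, ← glueHom_comp]
        simp only [Category.comp_id, Category.id_comp] }
  map_id Y := by
    ext Z
    exact glueHom_id Y Z
  map_comp f f' := by
    ext Z
    change glueHom (f ≫ f') (𝟙 Z) = glueHom f (𝟙 Z) ≫ glueHom f' (𝟙 Z)
    rw [← glueHom_comp, Category.comp_id]

noncomputable instance (Y : Cob m k) : ((gluing m k n).obj Y).Additive where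
  map_add {_ _ g g'} := hom_ext (map_add (CobHom.glue (CobHom.of (Mov.id Y.diag))) g.1 g'.1)

noncomputable instance : (gluing m k n).Additive where
  map_add {_ _ f f'} := by
    ext Z
    exact hom_ext
      (congrArg (fun h => h (CobHom.of (Mov.id Z.diag))) (map_add CobHom.glue f.1 f'.1))

/-- The contravariant duality functor: reflection of the square and of the cobordism direction,
and reversal of the `q`-degree. -/
noncomputable def duality (m n : ℕ) : (Cob m n)ᵒᵖ ⥤ Cob n m where
  obj Y := ⟨-Y.unop.shift, Y.unop.diag.reflect⟩
  map f := ⟨CobHom.reflect f.unop.1,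
    CobHom.part_congr (by ring) (CobHom.reflect_mem f.unop.2)⟩
  map_id Y := hom_ext (CobHom.reflect_of _)
  map_comp f g := hom_ext (CobHom.reflect_comp _ _)

noncomputable instance : (duality m n).Additive where
  map_add {_ _ f g} := hom_ext (map_add CobHom.reflect f.unop.1 g.unop.1)

/-- An unshifted diagram. -/
def ofDiag (a : Diag m n) : Cob m n := ⟨0, a⟩

end Cob

/-! ## Formal sums and products -/

/-- The three completions of an additive category: formal finite sums, countable sums, and
countable products. -/
inductive Kind
  | fin
  | sum
  | prod

namespace Kind

/-- The admissible index types: finite ones, respectively countable ones. -/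
def Index : Kind → Type → Prop
  | fin, ι => Finite ι
  | sum, ι => Countable ι
  | prod, ι => Countable ι

/-- The completion in which duals live. -/
def dual : Kind → Kind
  | fin => fin
  | sum => prod
  | prod => sum

/-- The finiteness condition on a matrix with source indices `I` and target indices `J`, where
`P i j` says that the entry from `i` to `j` is nonzero: for sums, every source index has finitely
many nonzero entries, and for products every target index has. -/
def Supp {I J : Type} : Kind → (I → J → Prop) → Prop
  | fin, _ => True
  | sum, P => ∀ i, {j | P i j}.Finite
  | prod, P => ∀ j, {i | P i j}.Finite

variable {I J K L : Type} {κ : Kind}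

theorem Index.countable {κ : Kind} {ι : Type} (h : κ.Index ι) : Countable ι := by
  cases κ
  · have : Finite ι := h
    infer_instance
  · exact h
  · exact h

theorem Index.of_finite (κ : Kind) (ι : Type) [Finite ι] : κ.Index ι := by
  cases κ
  · assumption
  · exact inferInstanceAs (Countable ι)
  · exact inferInstanceAs (Countable ι)

theorem Index.dual {ι : Type} (h : κ.Index ι) : κ.dual.Index ι := by cases κ <;> exact h

theorem Index.prod {ι ι' : Type} (h : κ.Index ι) (h' : κ.Index ι') : κ.Index (ι × ι') := by
  cases κ
  · have : Finite ι := h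
    have : Finite ι' := h'
    exact inferInstanceAs (Finite (ι × ι'))
  all_goals
    have : Countable ι := h
    have : Countable ι' := h'
    exact inferInstanceAs (Countable (ι × ι'))

theorem Index.sigma {ι : Type} {ι' : ι → Type} (h : κ.Index ι) (h' : ∀ i, κ.Index (ι' i)) :
    κ.Index (Σ i, ι' i) := by
  cases κ
  · have : Finite ι := h
    have : ∀ i, Finite (ι' i) := h'
    exact inferInstanceAs (Finite (Σ i, ι' i))
  all_goals
    have : Countable ι := h
    have : ∀ i, Countable (ι' i) := h'
    exact inferInstanceAs (Countable (Σ i, ι' i))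

theorem Supp.mono {P Q : I → J → Prop} (h : ∀ i j, P i j → Q i j) (hQ : κ.Supp Q) : κ.Supp P := by
  cases κ
  · trivial
  · exact fun i => (hQ i).subset fun j => h i j
  · exact fun j => (hQ j).subset fun i => h i j

theorem Supp.or {P Q : I → J → Prop} (hP : κ.Supp P) (hQ : κ.Supp Q) :
    κ.Supp fun i j => P i j ∨ Q i j := by
  cases κ
  · trivial
  · exact fun i => (hP i).union (hQ i)
  · exact fun j => (hP j).union (hQ j)

theorem Supp.of_finite {P : I → J → Prop} (h : ∀ i, {j | P i j}.Finite)
    (h' : ∀ j, {i | P i j}.Finite) : κ.Supp P := by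
  cases κ
  · trivial
  · exact h
  · exact h'

theorem Supp.eq : κ.Supp fun i j : I => i = j :=
  Supp.of_finite (fun i => (Set.finite_singleton i).subset fun _ h => h.symm)
    fun j => (Set.finite_singleton j).subset fun _ h => h

theorem Supp.dual {P : I → J → Prop} (h : κ.Supp P) : κ.dual.Supp fun j i => P i j := by
  cases κ
  · trivial
  · exact h
  · exact h

theorem Supp.of_index {P : I → J → Prop} (hI : Kind.fin.Index I) (hJ : Kind.fin.Index J) :
    κ.Supp P := by
  have : Finite I := hI
  have : Finite J := hJ
  exact Supp.of_finite (fun _ => Set.toFinite _) fun _ => Set.toFinite _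

theorem Supp.mid {P : I → J → Prop} {Q : J → K → Prop} (hJ : κ.Index J) (hP : κ.Supp P)
    (hQ : κ.Supp Q) (i : I) (k : K) : {j | P i j ∧ Q j k}.Finite := by
  cases κ
  · have : Finite J := hJ
    exact Set.toFinite _
  · exact (hP i).subset fun _ h => h.1
  · exact (hQ k).subset fun _ h => h.2

theorem Supp.comp {P : I → J → Prop} {Q : J → K → Prop} (hP : κ.Supp P) (hQ : κ.Supp Q) :
    κ.Supp fun i k => ∃ j, P i j ∧ Q j k := by
  cases κ
  · trivial
  · refine fun i => ((hP i).biUnion fun j _ => hQ j).subset fun k ⟨j, h, h'⟩ => ?_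
    exact Set.mem_biUnion (show j ∈ {j | P i j} from h) h'
  · refine fun k => ((hQ k).biUnion fun j _ => hP j).subset fun i ⟨j, h, h'⟩ => ?_
    exact Set.mem_biUnion (show j ∈ {j | Q j k} from h') h

theorem Supp.mid₂ {P : I → J → Prop} {Q : J → K → Prop} {R : K → L → Prop} (hJ : κ.Index J)
    (hK : κ.Index K) (hP : κ.Supp P) (hQ : κ.Supp Q) (hR : κ.Supp R) (i : I) (l : L) :
    {x : J × K | P i x.1 ∧ Q x.1 x.2 ∧ R x.2 l}.Finite := by
  have h1 := Supp.mid hJ hP (hQ.comp hR) i l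
  have h2 := Supp.mid hK (hP.comp hQ) hR i l
  exact (h1.prod h2).subset fun x h => ⟨⟨h.1, x.2, h.2.1, h.2.2⟩, ⟨x.1, h.1, h.2.1⟩, h.2.2⟩

theorem Supp.prod {I' J' : Type} {P : I → J → Prop} {Q : I' → J' → Prop} (hP : κ.Supp P)
    (hQ : κ.Supp Q) : κ.Supp fun (i : I × I') (j : J × J') => P i.1 j.1 ∧ Q i.2 j.2 := by
  cases κ
  · trivial
  · exact fun i => (hP i.1).prod (hQ i.2)
  · exact fun j => (hP j.1).prod (hQ j.2)

theorem Supp.sigma {I' : I → Type} {J' : J → Type} {P : I → J → Prop}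
    {Q : ∀ i j, I' i → J' j → Prop} (hP : κ.Supp P) (hQ : ∀ i j, κ.Supp (Q i j)) :
    κ.Supp fun (x : Σ i, I' i) (y : Σ j, J' j) => P x.1 y.1 ∧ Q x.1 y.1 x.2 y.2 := by
  cases κ
  · trivial
  · refine fun x => ((hP x.1).biUnion fun j _ => (hQ x.1 j x.2).image (Sigma.mk j)).subset ?_
    rintro ⟨j, y⟩ ⟨h, h'⟩
    exact Set.mem_biUnion (show j ∈ {j | P x.1 j} from h) ⟨y, h', rfl⟩
  · refine fun y => ((hP y.1).biUnion fun i _ => (hQ i y.1 y.2).image (Sigma.mk i)).subset ?_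
    rintro ⟨i, x⟩ ⟨h, h'⟩
    exact Set.mem_biUnion (show i ∈ {i | P i y.1} from h) ⟨x, h', rfl⟩

end Kind

/-- Formal finite sums, countable sums or countable products of objects of `C`. -/
structure Clo (κ : Kind) (C : Type*) where
  ι : Type
  index : κ.Index ι
  X : ι → C

namespace Clo

variable {C D E : Type*} [Category C] [Preadditive C] [Category D] [Preadditive D] [Category E]
  [Preadditive E] {κ : Kind}

/-- Matrices of morphisms that satisfy the finiteness condition. -/
def homs (Y Z : Clo κ C) : AddSubgroup (∀ i j, Y.X i ⟶ Z.X j) where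
  carrier := {f | κ.Supp fun i j => f i j ≠ 0}
  zero_mem' := Kind.Supp.of_finite (fun i => by simp) fun i => by simp
  add_mem' {f g} hf hg := (Kind.Supp.or hf hg).mono fun i j h => by
    by_contra h'
    push Not at h'
    exact h (by rw [Pi.add_apply, Pi.add_apply, h'.1, h'.2, add_zero])
  neg_mem' {f} hf := Kind.Supp.mono (fun i j h => by simpa using h) hf

/-- The product of two matrices of morphisms. -/
noncomputable def mul {Y Z W : Clo κ C} (f : homs Y Z) (g : homs Z W) : homs Y W :=
  ⟨fun i k => ∑ᶠ j, f.1 i j ≫ g.1 j k, (Kind.Supp.comp f.2 g.2).mono fun i k h => by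
    by_contra h'
    push Not at h'
    refine h ?_
    have : ∀ j, f.1 i j ≫ g.1 j k = 0 := fun j => by
      by_cases hj : f.1 i j = 0
      · rw [hj, Limits.zero_comp]
      · have h'' : g.1 j k = 0 := by
          by_contra h2
          exact h2 (h' j hj)
        rw [h'', Limits.comp_zero]
    simp only [this, finsum_zero]⟩

theorem mul_support {Y Z W : Clo κ C} (f : homs Y Z) (g : homs Z W) (i : Y.ι) (k : W.ι) :
    (Function.support fun j => f.1 i j ≫ g.1 j k).Finite :=
  (Kind.Supp.mid Z.index f.2 g.2 i k).subset fun j h =>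
    ⟨fun h' => h (by simp only [h', Limits.zero_comp]),
      fun h' => h (by simp only [h', Limits.comp_zero])⟩

open scoped Classical in
/-- The identity matrix. -/
noncomputable def one (Y : Clo κ C) : homs Y Y :=
  ⟨fun i j => if h : i = j then eqToHom (congrArg Y.X h) else 0, Kind.Supp.eq.mono fun i j h => by
    by_contra h'
    exact h (dif_neg h')⟩

theorem one_self (Y : Clo κ C) (i : Y.ι) : (one Y).1 i i = 𝟙 (Y.X i) := dif_pos rfl

theorem one_ne (Y : Clo κ C) {i j : Y.ι} (h : i ≠ j) : (one Y).1 i j = 0 := dif_neg h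

theorem finsum_comm_of_finite {J K M : Type*} [AddCommMonoid M] (t : J → K → M)
    (h : (Function.support fun x : J × K => t x.1 x.2).Finite) :
    ∑ᶠ k, ∑ᶠ j, t j k = ∑ᶠ j, ∑ᶠ k, t j k := by
  rw [← finsum_curry (fun x : J × K => t x.1 x.2) h]
  have h' : (Function.support fun x : K × J => t x.2 x.1).Finite := by
    refine (h.preimage (Prod.swap_injective.injOn)).subset fun x hx => ?_
    exact hx
  rw [← finsum_curry (fun x : K × J => t x.2 x.1) h']
  exact finsum_comp_equiv (Equiv.prodComm K J) (f := fun x : J × K => t x.1 x.2)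

theorem finsum_comp {J : Type*} {x y z : C} (t : J → (x ⟶ y)) (g : y ⟶ z)
    (h : (Function.support t).Finite) : (∑ᶠ j, t j) ≫ g = ∑ᶠ j, t j ≫ g :=
  AddMonoidHom.map_finsum (Preadditive.rightComp x g) h

theorem comp_finsum {J : Type*} {x y z : C} (f : x ⟶ y) (t : J → (y ⟶ z))
    (h : (Function.support t).Finite) : f ≫ (∑ᶠ j, t j) = ∑ᶠ j, f ≫ t j :=
  AddMonoidHom.map_finsum (Preadditive.leftComp z f) h

noncomputable instance : Category (Clo κ C) where
  Hom Y Z := homs Y Z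
  id := one
  comp := mul
  id_comp {Y Z} f := Subtype.ext (funext₂ fun i j => by
    refine (finsum_eq_single _ i fun k hk => ?_).trans ?_
    · rw [one_ne _ hk.symm, Limits.zero_comp]
    · rw [one_self, Category.id_comp])
  comp_id {Y Z} f := Subtype.ext (funext₂ fun i j => by
    refine (finsum_eq_single _ j fun k hk => ?_).trans ?_
    · rw [one_ne _ hk, Limits.comp_zero]
    · rw [one_self, Category.comp_id])
  assoc {Y Z W V} f g h := Subtype.ext (funext₂ fun i l => by
    change ∑ᶠ k, (∑ᶠ j, f.1 i j ≫ g.1 j k) ≫ h.1 k l = ∑ᶠ j, f.1 i j ≫ ∑ᶠ k, g.1 j k ≫ h.1 k l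
    have h1 : ∀ k, (∑ᶠ j, f.1 i j ≫ g.1 j k) ≫ h.1 k l = ∑ᶠ j, f.1 i j ≫ g.1 j k ≫ h.1 k l :=
      fun k => by
        rw [finsum_comp _ _ (mul_support f g i k)]
        simp only [Category.assoc]
    have h2 : ∀ j, f.1 i j ≫ ∑ᶠ k, g.1 j k ≫ h.1 k l = ∑ᶠ k, f.1 i j ≫ g.1 j k ≫ h.1 k l :=
      fun j => comp_finsum _ _ (mul_support g h j l)
    simp only [h1, h2]
    refine finsum_comm_of_finite (fun j k => f.1 i j ≫ g.1 j k ≫ h.1 k l) ?_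
    refine (Kind.Supp.mid₂ Z.index W.index f.2 g.2 h.2 i l).subset fun x hx => ⟨?_, ?_, ?_⟩
    · exact fun h' => hx (by simp only [h', Limits.zero_comp])
    · exact fun h' => hx (by simp only [h', Limits.zero_comp, Limits.comp_zero])
    · exact fun h' => hx (by simp only [h', Limits.comp_zero]))

theorem hom_ext {Y Z : Clo κ C} {f g : Y ⟶ Z} (h : ∀ i j, f.1 i j = g.1 i j) : f = g :=
  Subtype.ext (funext₂ h)

theorem comp_apply {Y Z W : Clo κ C} (f : Y ⟶ Z) (g : Z ⟶ W) (i : Y.ι) (k : W.ι) :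
    (f ≫ g).1 i k = ∑ᶠ j, f.1 i j ≫ g.1 j k := rfl

noncomputable instance : Preadditive (Clo κ C) where
  homGroup Y Z := inferInstanceAs (AddCommGroup (homs Y Z))
  add_comp Y Z W f f' g := hom_ext fun i k => by
    change ∑ᶠ j, (f.1 i j + f'.1 i j) ≫ g.1 j k =
      (∑ᶠ j, f.1 i j ≫ g.1 j k) + ∑ᶠ j, f'.1 i j ≫ g.1 j k
    simp only [Preadditive.add_comp]
    exact finsum_add_distrib (mul_support f g i k) (mul_support f' g i k)
  comp_add Y Z W f g g' := hom_ext fun i k => by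
    change ∑ᶠ j, f.1 i j ≫ (g.1 j k + g'.1 j k) =
      (∑ᶠ j, f.1 i j ≫ g.1 j k) + ∑ᶠ j, f.1 i j ≫ g'.1 j k
    simp only [Preadditive.comp_add]
    exact finsum_add_distrib (mul_support f g i k) (mul_support f g' i k)

theorem add_apply {Y Z : Clo κ C} (f g : Y ⟶ Z) (i : Y.ι) (j : Z.ι) :
    (f + g).1 i j = f.1 i j + g.1 i j := rfl

theorem zero_apply {Y Z : Clo κ C} (i : Y.ι) (j : Z.ι) : (0 : Y ⟶ Z).1 i j = 0 := rfl

/-- A single object as a formal sum or product. -/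
def of (κ : Kind) (x : C) : Clo κ C := ⟨Unit, Kind.Index.of_finite κ Unit, fun _ => x⟩

/-- Finite formal sums as countable formal sums or products. -/
noncomputable def incl (κ : Kind) : Clo .fin C ⥤ Clo κ C where
  obj Y := ⟨Y.ι, have : Finite Y.ι := Y.index; Kind.Index.of_finite κ Y.ι, Y.X⟩
  map {Y Z} f := ⟨f.1, Kind.Supp.of_index Y.index Z.index⟩
  map_id _ := rfl
  map_comp _ _ := rfl

instance : (incl κ : Clo .fin C ⥤ Clo κ C).Additive where
  map_add := rfl

/-- The extension of an additive functor. -/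
noncomputable def map (F : C ⥤ D) [F.Additive] : Clo κ C ⥤ Clo κ D where
  obj Y := ⟨Y.ι, Y.index, fun i => F.obj (Y.X i)⟩
  map {Y Z} f := ⟨fun i j => F.map (f.1 i j), Kind.Supp.mono
    (Q := fun i j => f.1 i j ≠ 0) (fun i j h h' => h (by simp only [h', F.map_zero])) f.2⟩
  map_id Y := hom_ext fun i j => by
    by_cases h : i = j
    · subst h
      exact (congrArg F.map (one_self Y i)).trans ((F.map_id _).trans
        (one_self (⟨Y.ι, Y.index, fun i => F.obj (Y.X i)⟩ : Clo κ D) i).symm)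
    · exact (congrArg F.map (one_ne Y h)).trans ((F.map_zero _ _).trans
        (one_ne (⟨Y.ι, Y.index, fun i => F.obj (Y.X i)⟩ : Clo κ D) h).symm)
  map_comp {Y Z W} f g := hom_ext fun i k => by
    change F.map (∑ᶠ j, f.1 i j ≫ g.1 j k) = ∑ᶠ j, F.map (f.1 i j) ≫ F.map (g.1 j k)
    simp only [← F.map_comp]
    exact AddMonoidHom.map_finsum F.mapAddHom (mul_support f g i k)

instance (F : C ⥤ D) [F.Additive] : (map F : Clo κ C ⥤ Clo κ D).Additive where
  map_add := hom_ext fun _ _ => F.map_add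

/-- The extension of a contravariant additive functor: it exchanges sums and products and
transposes matrices. -/
noncomputable def dual (F : Cᵒᵖ ⥤ D) [F.Additive] : (Clo κ C)ᵒᵖ ⥤ Clo κ.dual D where
  obj Y := ⟨Y.unop.ι, Y.unop.index.dual, fun i => F.obj (.op (Y.unop.X i))⟩
  map {Y Z} f := ⟨fun j i => F.map (f.unop.1 i j).op, Kind.Supp.mono
    (Q := fun j i => f.unop.1 i j ≠ 0) (fun j i h h' => h (by simp only [h', Limits.op_zero, F.map_zero]))
    (Kind.Supp.dual f.unop.2)⟩
  map_id Y := hom_ext fun i j => by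
    by_cases h : i = j
    · subst h
      exact (congrArg (fun f => F.map f.op) (one_self Y.unop i)).trans
        ((F.map_id _).trans (one_self
          (⟨Y.unop.ι, Y.unop.index.dual, fun i => F.obj (.op (Y.unop.X i))⟩ : Clo κ.dual D) i).symm)
    · exact (congrArg (fun f => F.map f.op) (one_ne Y.unop (Ne.symm h))).trans
        ((F.map_zero _ _).trans (one_ne
          (⟨Y.unop.ι, Y.unop.index.dual, fun i => F.obj (.op (Y.unop.X i))⟩ : Clo κ.dual D) h).symm)
  map_comp {Y Z W} f g := hom_ext fun i k => by
    change F.map (∑ᶠ j, g.unop.1 k j ≫ f.unop.1 j i).op =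
      ∑ᶠ j, F.map (f.unop.1 j i).op ≫ F.map (g.unop.1 k j).op
    simp only [← F.map_comp, ← op_comp]
    exact AddMonoidHom.map_finsum (F.mapAddHom.comp (opHom _ _))
      (mul_support g.unop f.unop k i)

instance (F : Cᵒᵖ ⥤ D) [F.Additive] : (dual F : (Clo κ C)ᵒᵖ ⥤ Clo κ.dual D).Additive where
  map_add {Y Z f g} := hom_ext fun j i => by
    change F.map (f.unop.1 i j + g.unop.1 i j).op = _
    rw [op_add, F.map_add]
    rfl

end Clo

/-! ## Tensor products -/

namespace Clo

variable {C D E : Type*} [Category C] [Preadditive C] [Category D] [Preadditive D] [Category E]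
  [Preadditive E] {κ : Kind} (F : C ⥤ D ⥤ E) [F.Additive] [∀ x, (F.obj x).Additive]

/-- A biadditive bifunctor on morphisms. -/
def tens {x x' : C} {y y' : D} : (x ⟶ x') →+ (y ⟶ y') →+ ((F.obj x).obj y ⟶ (F.obj x').obj y') :=
  AddMonoidHom.mk' (fun u => AddMonoidHom.mk' (fun v => (F.map u).app y ≫ (F.obj x').map v)
    fun v v' => by rw [Functor.map_add, Preadditive.comp_add]) fun u u' => by
      ext v
      change (F.map (u + u')).app y ≫ (F.obj x').map v =
        (F.map u).app y ≫ (F.obj x').map v + (F.map u').app y ≫ (F.obj x').map v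
      rw [F.map_add, NatTrans.app_add, Preadditive.add_comp]

theorem tens_comp {x x' x'' : C} {y y' y'' : D} (u : x ⟶ x') (u' : x' ⟶ x'') (v : y ⟶ y')
    (v' : y' ⟶ y'') : tens F (u ≫ u') (v ≫ v') = tens F u v ≫ tens F u' v' := by
  change (F.map (u ≫ u')).app y ≫ (F.obj x'').map (v ≫ v') =
    ((F.map u).app y ≫ (F.obj x').map v) ≫ (F.map u').app y' ≫ (F.obj x'').map v'
  simp only [Functor.map_comp, NatTrans.comp_app, Category.assoc, NatTrans.naturality_assoc]

/-- The extension of a biadditive bifunctor to formal sums or products, on objects. -/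
def tensorObj (Y : Clo κ C) (Z : Clo κ D) : Clo κ E :=
  ⟨Y.ι × Z.ι, Y.index.prod Z.index, fun p => (F.obj (Y.X p.1)).obj (Z.X p.2)⟩

/-- The extension of a biadditive bifunctor to formal sums or products, on morphisms. -/
noncomputable def tensorHom {Y Y' : Clo κ C} {Z Z' : Clo κ D} :
    (Y ⟶ Y') →+ (Z ⟶ Z') →+ (tensorObj F Y Z ⟶ tensorObj F Y' Z') :=
  AddMonoidHom.mk' (fun f => AddMonoidHom.mk'
    (fun g => ⟨fun p p' => tens F (f.1 p.1 p'.1) (g.1 p.2 p'.2),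
      (Kind.Supp.prod f.2 g.2).mono fun p p' h =>
        ⟨fun h' => h (by simp only [h', map_zero]; rfl),
          fun h' => h (by simp only [h', map_zero]; rfl)⟩⟩)
    fun g g' => hom_ext fun p p' => map_add (tens F (f.1 p.1 p'.1)) _ _)
    fun f f' => by
      ext g
      exact hom_ext fun p p' => congrArg (fun h => h (g.1 p.2 p'.2))
        (map_add (tens F) (f.1 p.1 p'.1) (f'.1 p.1 p'.1))

theorem finsum_bilin {J K M N P : Type*} [AddCommMonoid M] [AddCommMonoid N] [AddCommMonoid P]
    (B : M →+ N →+ P) (a : J → M) (b : K → N) (ha : (Function.support a).Finite)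
    (hb : (Function.support b).Finite) :
    B (∑ᶠ j, a j) (∑ᶠ k, b k) = ∑ᶠ x : J × K, B (a x.1) (b x.2) := by
  rw [finsum_curry _ ((ha.prod hb).subset fun x h => ⟨fun h' => h ?_, fun h' => h ?_⟩)]
  · rw [AddMonoidHom.map_finsum (B.flip (∑ᶠ k, b k)) ha |> fun h => (by exact h :
      B (∑ᶠ j, a j) (∑ᶠ k, b k) = ∑ᶠ j, B (a j) (∑ᶠ k, b k))]
    exact finsum_congr fun j => AddMonoidHom.map_finsum (B (a j)) hb
  · simp only [h', map_zero, AddMonoidHom.zero_apply]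
  · simp only [h', map_zero]

theorem tensorHom_comp {Y Y' Y'' : Clo κ C} {Z Z' Z'' : Clo κ D} (f : Y ⟶ Y') (f' : Y' ⟶ Y'')
    (g : Z ⟶ Z') (g' : Z' ⟶ Z'') :
    tensorHom F (f ≫ f') (g ≫ g') = tensorHom F f g ≫ tensorHom F f' g' :=
  hom_ext fun p r => by
    refine (finsum_bilin (tens F) _ _ (mul_support f f' p.1 r.1)
      (mul_support g g' p.2 r.2)).trans ?_
    exact finsum_congr fun q => tens_comp F _ _ _ _

theorem sum_apply {S : Type*} {Y Z : Clo κ C} (s : Finset S) (f : S → (Y ⟶ Z)) (i : Y.ι)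
    (j : Z.ι) : (∑ t ∈ s, f t).1 i j = ∑ t ∈ s, (f t).1 i j :=
  map_sum (AddMonoidHom.mk' (fun h : Y ⟶ Z => h.1 i j) fun _ _ => rfl) f s

end Clo

/-- Countable families are admissible. -/
class Kind.Infinitary (κ : Kind) : Prop where
  index (I : Type) [Countable I] : κ.Index I

instance : Kind.sum.Infinitary := ⟨fun I => inferInstanceAs (Countable I)⟩

instance : Kind.prod.Infinitary := ⟨fun I => inferInstanceAs (Countable I)⟩

namespace Clo

variable {C D E : Type*} [Category C] [Preadditive C] [Category D] [Preadditive D] [Category E]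
  [Preadditive E] {κ : Kind} [κ.Infinitary] {I J K : Type} [Countable I] [Countable J]
  [Countable K]

/-- The direct sum (or product) of a countable family. -/
def sigma (Y : I → Clo κ C) : Clo κ C :=
  ⟨Σ i, (Y i).ι, (Kind.Infinitary.index I).sigma fun i => (Y i).index, fun x => (Y x.1).X x.2⟩

/-- Block matrices. -/
noncomputable def sigmaHom {Y : I → Clo κ C} {Z : J → Clo κ C} (f : ∀ i j, Y i ⟶ Z j)
    (hf : κ.Supp fun i j => f i j ≠ 0) : sigma Y ⟶ sigma Z :=
  ⟨fun x y => (f x.1 y.1).1 x.2 y.2,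
    (Kind.Supp.sigma hf fun i j => (f i j).2).mono fun x y h =>
      ⟨fun h' => h (congrArg (fun u => u.1 x.2 y.2) h'), h⟩⟩

theorem sigmaHom_eq_zero {Y : I → Clo κ C} {Z : J → Clo κ C} (f : ∀ i j, Y i ⟶ Z j)
    (hf : κ.Supp fun i j => f i j ≠ 0) (h : ∀ i j, f i j = 0) : sigmaHom f hf = 0 :=
  hom_ext fun x y => by
    change (f x.1 y.1).1 x.2 y.2 = 0
    rw [h, zero_apply]

theorem sigmaHom_comp_eq_zero {Y : I → Clo κ C} {Z : J → Clo κ C} {W : K → Clo κ C}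
    (f : ∀ i j, Y i ⟶ Z j) (hf : κ.Supp fun i j => f i j ≠ 0) (g : ∀ j k, Z j ⟶ W k)
    (hg : κ.Supp fun j k => g j k ≠ 0)
    (h : ∀ i k, ∃ s : Finset J, (∀ j, j ∉ s → f i j = 0 ∨ g j k = 0) ∧
      ∑ j ∈ s, f i j ≫ g j k = 0) : sigmaHom f hf ≫ sigmaHom g hg = 0 :=
  hom_ext fun x z => by
    obtain ⟨s, h1, h2⟩ := h x.1 z.1
    have h3 : (Function.support fun y : Σ j, (Z j).ι =>
        (f x.1 y.1).1 x.2 y.2 ≫ (g y.1 z.1).1 y.2 z.2).Finite :=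
      mul_support (sigmaHom f hf) (sigmaHom g hg) x z
    change ∑ᶠ y : Σ j, (Z j).ι, (f x.1 y.1).1 x.2 y.2 ≫ (g y.1 z.1).1 y.2 z.2 = 0
    have h4 : ∀ j, ((Sigma.mk j) ⁻¹' (Function.support fun y : Σ j, (Z j).ι =>
        (f x.1 y.1).1 x.2 y.2 ≫ (g y.1 z.1).1 y.2 z.2)).Finite :=
      fun j => h3.preimage sigma_mk_injective.injOn
    rw [finsum_eq_sum_of_support_subset (s := s.sigma fun j => (h4 j).toFinset),
      Finset.sum_sigma]
    · have h5 := congrArg (fun u : Y x.1 ⟶ W z.1 => u.1 x.2 z.2) h2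
      refine Eq.trans ?_ h5
      change _ = (∑ j ∈ s, f x.1 j ≫ g j z.1).1 x.2 z.2
      rw [sum_apply]
      refine Finset.sum_congr rfl fun j _ => ?_
      rw [comp_apply]
      refine (finsum_eq_sum_of_support_subset _ ?_).symm
      rw [Set.Finite.coe_toFinset]
      exact fun y hy => hy
    · rintro ⟨j, y⟩ hy
      rw [Finset.mem_coe, Finset.mem_sigma]
      refine ⟨?_, (Set.Finite.mem_toFinset _).2 hy⟩
      by_contra hj
      refine hy ?_
      rcases h1 j hj with h | h
      · exact (congrArg (fun u => u.1 x.2 y ≫ (g j z.1).1 y z.2) h).trans Limits.zero_comp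
      · exact (congrArg (fun u => (f x.1 j).1 x.2 y ≫ u.1 y z.2) h).trans Limits.comp_zero

end Clo

/-! ## Complexes -/

section Total

variable {C D E : Type*} [Category C] [Preadditive C] [Category D] [Preadditive D] [Category E]
  [Preadditive E]

/-- The identity of a chain group, as a morphism between chain groups in degrees `q` and `q'`
(zero if these are different). -/
noncomputable def idm (K : CochainComplex C ℤ) (q q' : ℤ) : K.X q ⟶ K.X q' :=
  if h : q = q' then eqToHom (congrArg K.X h) else 0

theorem idm_ne (K : CochainComplex C ℤ) {q q' : ℤ} (h : q ≠ q') : idm K q q' = 0 := dif_neg h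

theorem idm_d (K : CochainComplex C ℤ) {q q' : ℤ} (h : q = q') (r : ℤ) :
    idm K q q' ≫ K.d q' r = K.d q r := by
  subst h
  rw [idm, dif_pos rfl, eqToHom_refl, Category.id_comp]

theorem d_idm (K : CochainComplex C ℤ) {r r' : ℤ} (h : r = r') (q : ℤ) :
    K.d q r ≫ idm K r r' = K.d q r' := by
  subst h
  rw [idm, dif_pos rfl, eqToHom_refl, Category.comp_id]

theorem d_ne (K : CochainComplex C ℤ) {q q' : ℤ} (h : q + 1 ≠ q') : K.d q q' = 0 :=
  K.shape _ _ h

variable {κ : Kind} (F : C ⥤ D ⥤ E) [F.Additive] [∀ x, (F.obj x).Additive]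
  (A : CochainComplex (Clo κ C) ℤ) (B : CochainComplex (Clo κ D) ℤ)

/-- The component of the differential `d ⊗ 1 + (-1) ^ i (1 ⊗ d)` from `A i ⊗ B (k - i)` to
`A i' ⊗ B (k' - i')`. -/
noncomputable def totalBlock (k k' i i' : ℤ) :
    Clo.tensorObj F (A.X i) (B.X (k - i)) ⟶ Clo.tensorObj F (A.X i') (B.X (k' - i')) :=
  Clo.tensorHom F (A.d i i') (idm B (k - i) (k' - i')) +
    i.negOnePow • Clo.tensorHom F (idm A i i') (B.d (k - i) (k' - i'))

theorem totalBlock_zero {k k' i i' : ℤ} (h1 : i + 1 = i' → k - i ≠ k' - i')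
    (h2 : i = i' → k - i + 1 ≠ k' - i') : totalBlock F A B k k' i i' = 0 := by
  have e1 : Clo.tensorHom F (A.d i i') (idm B (k - i) (k' - i')) = 0 := by
    by_cases h : i + 1 = i'
    · rw [idm_ne _ (h1 h), map_zero]
    · rw [d_ne _ h, map_zero, AddMonoidHom.zero_apply]
  have e2 : Clo.tensorHom F (idm A i i') (B.d (k - i) (k' - i')) = 0 := by
    by_cases h : i = i'
    · rw [d_ne _ (h2 h), map_zero]
    · rw [idm_ne _ h, map_zero, AddMonoidHom.zero_apply]
  rw [totalBlock, e1, e2, smul_zero, add_zero]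

theorem totalBlock_shape {k k' : ℤ} (h : k + 1 ≠ k') (i i' : ℤ) :
    totalBlock F A B k k' i i' = 0 :=
  totalBlock_zero F A B (by omega) (by omega)

theorem totalBlock_supp (k k' : ℤ) : κ.Supp fun i i' => totalBlock F A B k k' i i' ≠ 0 := by
  refine Kind.Supp.of_finite (fun i => ?_) fun i' => ?_
  · refine (Set.toFinite {i, i + 1}).subset fun i' h => ?_
    by_contra h'
    simp only [Set.mem_insert_iff, Set.mem_singleton_iff, not_or] at h'
    exact h (totalBlock_zero F A B (by omega) (by omega))
  · refine (Set.toFinite {i', i' - 1}).subset fun i h => ?_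
    by_contra h'
    simp only [Set.mem_insert_iff, Set.mem_singleton_iff, not_or] at h'
    exact h (totalBlock_zero F A B (by omega) (by omega))

theorem totalBlock_comp (k k' k'' i i' i'' : ℤ) :
    totalBlock F A B k k' i i' ≫ totalBlock F A B k' k'' i' i'' =
      i'.negOnePow • Clo.tensorHom F (A.d i i' ≫ idm A i' i'')
        (idm B (k - i) (k' - i') ≫ B.d (k' - i') (k'' - i'')) +
      i.negOnePow • Clo.tensorHom F (idm A i i' ≫ A.d i' i'')
        (B.d (k - i) (k' - i') ≫ idm B (k' - i') (k'' - i'')) := by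
  have e1 : Clo.tensorHom F (A.d i i') (idm B (k - i) (k' - i')) ≫
      Clo.tensorHom F (A.d i' i'') (idm B (k' - i') (k'' - i'')) = 0 := by
    rw [← Clo.tensorHom_comp, A.d_comp_d, map_zero, AddMonoidHom.zero_apply]
  have e2 : Clo.tensorHom F (idm A i i') (B.d (k - i) (k' - i')) ≫
      Clo.tensorHom F (idm A i' i'') (B.d (k' - i') (k'' - i'')) = 0 := by
    rw [← Clo.tensorHom_comp, B.d_comp_d, map_zero]
  rw [totalBlock, totalBlock, Preadditive.add_comp, Preadditive.comp_add, Preadditive.comp_add, e1,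
    Linear.units_smul_comp, Linear.units_smul_comp, Linear.comp_units_smul,
    Linear.comp_units_smul, e2, smul_zero, smul_zero, add_zero, zero_add,
    Clo.tensorHom_comp, Clo.tensorHom_comp]

variable [κ.Infinitary]

/-- The total complex of the bicomplex `A i ⊗ B j`, formed with sums or with products. -/
noncomputable def total : CochainComplex (Clo κ E) ℤ where
  X k := Clo.sigma fun i : ℤ => Clo.tensorObj F (A.X i) (B.X (k - i))
  d k k' := Clo.sigmaHom (totalBlock F A B k k') (totalBlock_supp F A B k k')
  shape _ _ h := Clo.sigmaHom_eq_zero _ _ (totalBlock_shape F A B h)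
  d_comp_d' k k' k'' h h' := by
    have h : k + 1 = k' := h
    have h' : k' + 1 = k'' := h'
    refine Clo.sigmaHom_comp_eq_zero _ _ _ _ fun i i'' => ⟨{i, i + 1}, ?_, ?_⟩
    · intro i' hi
      simp only [Finset.mem_insert, Finset.mem_singleton, not_or] at hi
      exact Or.inl (totalBlock_zero F A B (by omega) (by omega))
    · rw [Finset.sum_pair (by omega), totalBlock_comp, totalBlock_comp]
      rw [d_ne A (q := i) (q' := i) (by omega), idm_ne A (q := i) (q' := i + 1) (by omega)]
      simp only [Limits.zero_comp, map_zero, AddMonoidHom.zero_apply, smul_zero, zero_add, add_zero]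
      by_cases hi : i + 1 = i''
      · rw [idm_d A rfl, d_idm A hi, idm_d B (by omega), d_idm B (by omega), Int.negOnePow_succ,
          Units.neg_smul, add_neg_cancel]
      · rw [idm_d A rfl, idm_ne A hi, d_ne A hi]
        simp only [Limits.comp_zero, map_zero, AddMonoidHom.zero_apply, smul_zero, add_zero]

end Total

/-- The categories of formal (finite sums, countable sums, or countable products) of shifted
diagrams with `m` endpoints on top and `n` on the bottom. -/
abbrev BN (κ : Kind) (m n : ℕ) := Clo κ (Cob m n)

namespace BN

variable {κ : Kind} {m n k : ℕ}

/-- The planar composition of `A` above `B`. -/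
noncomputable def tensor [κ.Infinitary] (A : CochainComplex (BN κ m k) ℤ)
    (B : CochainComplex (BN κ k n) ℤ) : CochainComplex (BN κ m n) ℤ :=
  total (Cob.gluing m k n) A B

/-- Complexes of finite sums as complexes of countable sums or products. -/
noncomputable def incl (κ : Kind) (A : CochainComplex (BN .fin m n) ℤ) :
    CochainComplex (BN κ m n) ℤ :=
  ((Clo.incl κ).mapHomologicalComplex _).obj A

/-- The dual of an object: reflect all diagrams, reverse all shifts. -/
noncomputable abbrev dualObj (Y : BN κ m n) : BN κ.dual n m :=
  (Clo.dual (Cob.duality m n)).obj (.op Y)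

/-- The dual of a morphism. -/
noncomputable abbrev dualHom {Y Z : BN κ m n} (f : Y ⟶ Z) : dualObj Z ⟶ dualObj Y :=
  (Clo.dual (Cob.duality m n)).map f.op

/-- The dual complex. -/
noncomputable def dual (A : CochainComplex (BN κ m n) ℤ) : CochainComplex (BN κ.dual n m) ℤ where
  X k := dualObj (A.X (-k))
  d k k' := (k + 1).negOnePow • dualHom (A.d (-k') (-k))
  shape k k' h := by
    have h : k + 1 ≠ k' := h
    rw [d_ne A (by omega), dualHom, Limits.op_zero, Functor.map_zero, smul_zero]
  d_comp_d' k k' k'' _ _ := by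
    rw [Linear.units_smul_comp, Linear.comp_units_smul, dualHom, dualHom, ← Functor.map_comp,
      ← op_comp, A.d_comp_d, Limits.op_zero, Functor.map_zero, smul_zero, smul_zero]

/-- A complex is contractible if it is homotopy equivalent to zero. -/
def Contractible (A : CochainComplex (BN κ m n) ℤ) : Prop := Nonempty (Homotopy (𝟙 A) 0)

noncomputable instance (b : Cob k n) : ((Cob.gluing m k n).flip.obj b).Additive where
  map_add {_ _ f f'} := Cob.hom_ext
    (congrArg (fun h => h (CobHom.of (Mov.id b.diag))) (map_add CobHom.glue f.1 f'.1))

/-- The planar composition of a single diagram above a complex. -/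
noncomputable def above (a : Diag m k) (B : CochainComplex (BN κ k n) ℤ) :
    CochainComplex (BN κ m n) ℤ :=
  ((Clo.map ((Cob.gluing m k n).obj (Cob.ofDiag a))).mapHomologicalComplex _).obj B

/-- The planar composition of a single diagram below a complex. -/
noncomputable def below (A : CochainComplex (BN κ m k) ℤ) (b : Diag k n) :
    CochainComplex (BN κ m n) ℤ :=
  ((Clo.map ((Cob.gluing m k n).flip.obj (Cob.ofDiag b))).mapHomologicalComplex _).obj A

/-- Composition with any turnback on top gives a contractible complex. -/
def KillsAbove : {m n : ℕ} → CochainComplex (BN κ m n) ℤ → Prop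
  | m + 2, _, A => ∀ i : Fin (m + 1), Contractible (above (.cap m i) A)
  | _, _, _ => True

/-- Composition with any turnback on the bottom gives a contractible complex. -/
def KillsBelow : {m n : ℕ} → CochainComplex (BN κ m n) ℤ → Prop
  | _, n + 2, A => ∀ i : Fin (n + 1), Contractible (below A (.cup n i))
  | _, _, _ => True

/-- Universal projectors. -/
structure IsUniversalProjector {n : ℕ} (P : CochainComplex (BN .fin n n) ℤ) : Prop where
  /-- `P` is supported in nonpositive degrees. -/
  nonpos : ∀ k, 0 < k → Limits.IsZero (P.X k)
  /-- The degree zero chain group is the identity diagram. -/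
  degree_zero : Nonempty (P.X 0 ≅ Clo.of .fin (Cob.ofDiag (.strands n)))
  /-- No shift of the identity diagram is a direct summand of any other chain group. -/
  other : ∀ k, k ≠ 0 → ∀ s : ℤ,
    IsEmpty (Retract (Clo.of .fin (⟨s, .strands n⟩ : Cob n n)) (P.X k))
  kills_above : KillsAbove P
  kills_below : KillsBelow P

end BN

end BarNatan

/-! The theorem rests on counting endpoints and on the finiteness conditions of the two completions.

Counting: a diagram with fewer endpoints on top than on the bottom has a turnback on the bottom, so
it factors as a diagram above a `cap` (`Diag.exists_match_glue_cap`); reflection gives a `cup` on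
top in the opposite case. This is proved by a normal form rather than by planar topology. Read from
top to bottom, a diagram is some diagram ending in at most `m` points, followed by caps only
(`Diag.splits`): a cup attached below caps is straightened by a zigzag, closes up to a circle that
floats to the top, or passes a distant cap. Two diagrams are identified as soon as their components
match relative to the endpoints, because the cylinders over such a matching are mutually inverse
morphisms of degree 0. Hence `P_j`, which kills cups from below, is contractible after gluing any
diagram with fewer than `j` bottom points below it. Its dual kills caps from above
(`BN.KillsBelow.dual`) and is contractible below any diagram with fewer than `j` top points.

In part 1, put `X = P_i ⊗ A`. All rows `X^p ⊗ P_j^∨` of the double complex are contractible, since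
each is block diagonal with one contractible block per summand of `X^p`. The row contractions, with
signs, form a homotopy `h` on the total complex, and `dh + hd = 1 + e` where `e` moves bidegree `(p,
q)` to `(p + 1, q - 1)`. As `P_j^∨` lives in degrees `q ≥ 0`, only finitely many powers of `e` are
nonzero on a given source summand. The geometric series for `(1 + e)⁻¹` is therefore a matrix with
finite rows, that is, a morphism of countable sums (`Clo.isIso_of_lt_sum`). Then `(1 + e)⁻¹ h`
contracts the total complex (`Contraction.nonempty_of_isIso`).

In part 2, the columns `P_j ⊗ A^q` are contractible, and the error `e` moves `(p, q)` to `(p - 1, q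
+ 1)`. As `P_j` lives in degrees `p ≤ 0`, only finitely many powers of `e` reach a given target
summand, which is what countable products require (`Clo.isIso_of_lt_prod`). The further factor
`P_i^∨` is handled in the same way: the columns are contractible because `P_j ⊗ A` is, and the bound
is now `q ≥ 0` on the second factor. -/

namespace BarNatan

/-! ## Matchings of diagrams -/

namespace Diag

namespace Match

variable {m n k : ℕ}

/-- A matching of components given by maps between pieces that are inverse up to adjacency. -/
def ofPieces {a b : Diag m n} (f : a.Piece → b.Piece) (g : b.Piece → a.Piece)
    (hf : ∀ x y, a.Adj x y → b.comp (f x) = b.comp (f y))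
    (hg : ∀ x y, b.Adj x y → a.comp (g x) = a.comp (g y))
    (hgf : ∀ x, a.comp (g (f x)) = a.comp x) (hfg : ∀ y, b.comp (f (g y)) = b.comp y)
    (ht : ∀ i, b.comp (f (a.top i)) = b.comp (b.top i))
    (hb : ∀ i, b.comp (f (a.bot i)) = b.comp (b.bot i)) : a.Match b where
  e :=
    { toFun := Quot.lift (fun x => b.comp (f x)) hf
      invFun := Quot.lift (fun x => a.comp (g x)) hg
      left_inv := by rintro ⟨x⟩; exact hgf x
      right_inv := by rintro ⟨x⟩; exact hfg x }
  top := ht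
  bot := hb

/-- The identity matching. -/
def refl (a : Diag m n) : a.Match a := ⟨Equiv.refl _, fun _ => rfl, fun _ => rfl⟩

/-- The inverse matching. -/
def symm {a b : Diag m n} (e : a.Match b) : b.Match a :=
  ⟨e.e.symm, fun i => by rw [← e.top, Equiv.symm_apply_apply],
    fun i => by rw [← e.bot, Equiv.symm_apply_apply]⟩

/-- The composition of matchings. -/
def trans {a b c : Diag m n} (e : a.Match b) (e' : b.Match c) : a.Match c :=
  ⟨e.e.trans e'.e, fun i => by rw [Equiv.trans_apply, e.top, e'.top],
    fun i => by rw [Equiv.trans_apply, e.bot, e'.bot]⟩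

/-- A representative of the component matched with the component of a piece. -/
noncomputable def rep {a b : Diag m n} (e : a.Match b) (x : a.Piece) : b.Piece :=
  Quot.out (e.e (a.comp x))

theorem comp_rep {a b : Diag m n} (e : a.Match b) (x : a.Piece) :
    b.comp (e.rep x) = e.e (a.comp x) := Quot.out_eq _

theorem comp_rep_congr {a b : Diag m n} (e : a.Match b) {x y : a.Piece} (h : a.Adj x y) :
    b.comp (e.rep x) = b.comp (e.rep y) := by
  rw [comp_rep, comp_rep, show a.comp x = a.comp y from Quot.sound h]

theorem comp_rep_symm_rep {a b : Diag m n} (e : a.Match b) (x : a.Piece) :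
    a.comp (e.symm.rep (e.rep x)) = a.comp x := by
  rw [comp_rep, comp_rep]
  exact e.e.symm_apply_apply _

/-- Gluing of matchings. -/
noncomputable def glue {a b : Diag m k} {a' b' : Diag k n} (e : a.Match b) (e' : a'.Match b') :
    (a.glue a').Match (b.glue b') := by
  -- Both auxiliary facts quantify over all matchings, so that they also apply to the inverse ones.
  -- Representatives of components suffice since only components of the gluing matter.
  have key : ∀ {a b : Diag m k} {a' b' : Diag k n} (e : a.Match b) (e' : a'.Match b')
      (x y : (a.glue a').Piece), (a.glue a').Adj x y →
      (b.glue b').comp (Sum.map e.rep e'.rep x) = (b.glue b').comp (Sum.map e.rep e'.rep y) := by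
    intro a b a' b' e e' x y h
    cases h with
    | left h => exact GlueRel.mk_left (e.comp_rep_congr h)
    | right h => exact GlueRel.mk_right (e'.comp_rep_congr h)
    | link i =>
      exact (GlueRel.mk_left ((e.comp_rep _).trans (e.bot i))).trans
        ((Quot.sound (GlueRel.link i)).trans
          (GlueRel.mk_right ((e'.comp_rep _).trans (e'.top i)).symm))
  have inv : ∀ {a b : Diag m k} {a' b' : Diag k n} (e : a.Match b) (e' : a'.Match b')
      (x : (a.glue a').Piece), (a.glue a').comp (Sum.map e.symm.rep e'.symm.rep
        (Sum.map e.rep e'.rep x)) = (a.glue a').comp x := by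
    intro a b a' b' e e' x
    rcases x with x | x
    · exact GlueRel.mk_left (e.comp_rep_symm_rep x)
    · exact GlueRel.mk_right (e'.comp_rep_symm_rep x)
  exact ofPieces (Sum.map e.rep e'.rep) (Sum.map e.symm.rep e'.symm.rep) (key e e')
    (key e.symm e'.symm) (inv e e') (inv e.symm e'.symm)
    (fun i => GlueRel.mk_left ((e.comp_rep _).trans (e.top i)))
    (fun i => GlueRel.mk_right ((e'.comp_rep _).trans (e'.bot i)))

/-- Associativity of gluing. -/
def assoc {l : ℕ} (a : Diag m k) (b : Diag k l) (c : Diag l n) :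
    ((a.glue b).glue c).Match (a.glue (b.glue c)) := by
  refine ofPieces (a := (a.glue b).glue c) (b := a.glue (b.glue c)) (Equiv.sumAssoc _ _ _)
    (Equiv.sumAssoc _ _ _).symm ?_ ?_ ?_ ?_ (fun _ => rfl) (fun _ => rfl)
  · rintro _ _ ((h | h | i) | h | i)
    · exact Quot.sound (.left h)
    · exact Quot.sound (.right (.left h))
    · exact Quot.sound (.link i)
    · exact Quot.sound (.right (.right h))
    · exact Quot.sound (.right (.link i))
  · rintro _ _ (h | (h | h | i) | i)
    · exact Quot.sound (.left (.left h))
    · exact Quot.sound (.left (.right h))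
    · exact Quot.sound (.right h)
    · exact Quot.sound (.link i)
    · exact Quot.sound (.left (.link i))
  · rintro ((x | x) | x) <;> rfl
  · rintro (x | x | x) <;> rfl

/-- Strands on top can be removed. -/
def strandsGlue (a : Diag m n) : ((strands m).glue a).Match a := by
  refine ofPieces (a := (strands m).glue a) (Sum.elim a.top id) Sum.inr ?_ ?_ ?_
    (fun _ => rfl) (fun _ => rfl) (fun _ => rfl)
  · rintro _ _ (h | h | i)
    · exact h.elim
    · exact Quot.sound h
    · rfl
  · exact fun _ _ h => Quot.sound (.right h)
  · rintro (x | x)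
    · exact (Quot.sound (GlueRel.link x)).symm
    · rfl

/-- Strands on the bottom can be removed. -/
def glueStrands (a : Diag m n) : (a.glue (strands n)).Match a := by
  refine ofPieces (a := a.glue (strands n)) (Sum.elim id a.bot) Sum.inl ?_ ?_ ?_
    (fun _ => rfl) (fun _ => rfl) (fun _ => rfl)
  · rintro _ _ (h | h | i)
    · exact Quot.sound h
    · exact h.elim
    · rfl
  · exact fun _ _ h => Quot.sound (.left h)
  · rintro (x | x)
    · rfl
    · exact Quot.sound (GlueRel.link x)

/-- Circles can be moved to the top. -/
def glueCircle (a : Diag m n) (i : Fin (n + 1)) :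
    (a.glue (circle n i)).Match ((circle m 0).glue a) := by
  -- The halves of the circle correspond to the new circle, while a through strand of the old layer
  -- is absorbed into the piece of `a` at its endpoint; `g` does the same on the other side.
  let f : Option (Fin n) → ((circle m 0).glue a).Piece := fun o =>
    o.elim (.inl (.inl (none : Option (Fin m)))) fun l => .inr (a.bot l)
  let g : Option (Fin m) → (a.glue (circle n i)).Piece := fun o =>
    o.elim (.inr (.inl (none : Option (Fin n)))) fun l => .inl (a.top l)
  refine ofPieces (a := a.glue (circle n i)) (b := (circle m 0).glue a)
    (Sum.elim .inr (Sum.elim f f)) (Sum.elim (Sum.elim g g) .inl) ?_ ?_ ?_ ?_ ?_ (fun _ => rfl)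
  · rintro _ _ (h | (h | h | j) | j)
    · exact Quot.sound (.right h)
    · exact h.elim
    · exact h.elim
    · rfl
    · rfl
  · rintro _ _ ((h | h | j) | h | j)
    · exact h.elim
    · exact h.elim
    · rfl
    · exact Quot.sound (.left h)
    · rfl
  · have h : ∀ o : Option (Fin n), (a.glue (circle n i)).comp
        (Sum.elim (Sum.elim g g) Sum.inl (f o)) = (a.glue (circle n i)).comp (.inr (.inl o)) := by
      rintro (_ | l)
      · rfl
      · exact Quot.sound (.link l)
    rintro (x | x | x)
    · rfl
    · exact h x
    · exact (h x).trans (GlueRel.mk_right (circle_comp n i x))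
  · have h : ∀ o : Option (Fin m), ((circle m 0).glue a).comp
        (Sum.elim Sum.inr (Sum.elim f f) (g o)) = ((circle m 0).glue a).comp (.inl (.inl o)) := by
      rintro (_ | l)
      · rfl
      · refine Eq.trans ?_ (GlueRel.mk_left (circle_comp m 0 (some l))).symm
        exact (Quot.sound (.link l)).symm
    rintro ((x | x) | x)
    · exact h x
    · exact (h x).trans (GlueRel.mk_left (circle_comp m 0 x))
    · rfl
  · intro l
    refine Eq.trans ?_ (GlueRel.mk_left (circle_comp m 0 (some l))).symm
    exact (Quot.sound (.link l)).symm

end Match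

end Diag

/-! ### Numbering of the endpoints of a turnback -/

theorem bend_of_lt {n : ℕ} {i : Fin (n + 1)} {j : Fin (n + 2)} (h : j.val < i.val) :
    bend n i j = some ⟨j.val, by omega⟩ := dif_pos h

theorem bend_eq_none {n : ℕ} {i : Fin (n + 1)} {j : Fin (n + 2)} (h : i.val ≤ j.val)
    (h' : j.val < i.val + 2) : bend n i j = none :=
  (dif_neg (by omega)).trans (dif_pos h')

theorem bend_of_le {n : ℕ} {i : Fin (n + 1)} {j : Fin (n + 2)} (h : i.val + 2 ≤ j.val) :
    bend n i j = some ⟨j.val - 2, by omega⟩ :=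
  (dif_neg (by omega)).trans (dif_neg (by omega))

/-- The endpoint of the through strand `l` on the side with `n + 2` endpoints. -/
def unbend (n : ℕ) (i : Fin (n + 1)) (l : Fin n) : Fin (n + 2) :=
  if l.val < i.val then ⟨l.val, by omega⟩ else ⟨l.val + 2, by omega⟩

theorem unbend_val (n : ℕ) (i : Fin (n + 1)) (l : Fin n) :
    (unbend n i l).val = if l.val < i.val then l.val else l.val + 2 := by
  unfold unbend
  split <;> rfl

/-- Together with `unbend_val` and `bend_none_iff` this turns every question about which piece an
endpoint lies on into linear arithmetic. -/
theorem bend_eq_some {n : ℕ} {i : Fin (n + 1)} {j : Fin (n + 2)} {l : Fin n} :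
    bend n i j = some l ↔ j = unbend n i l := by
  rw [Fin.ext_iff, unbend_val]
  rcases lt_or_ge j.val i.val with h | h
  · rw [bend_of_lt h, Option.some_inj, Fin.ext_iff]
    split_ifs <;> simp only
    omega
  · rcases lt_or_ge j.val (i.val + 2) with h' | h'
    · rw [bend_eq_none h h']
      simp only [reduceCtorEq, false_iff]
      split_ifs <;> omega
    · rw [bend_of_le h', Option.some_inj, Fin.ext_iff]
      split_ifs <;> simp only <;> omega

theorem bend_unbend (n : ℕ) (i : Fin (n + 1)) (l : Fin n) : bend n i (unbend n i l) = some l :=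
  bend_eq_some.2 rfl

theorem bend_none_iff {n : ℕ} {i : Fin (n + 1)} {j : Fin (n + 2)} :
    bend n i j = none ↔ j.val = i.val ∨ j.val = i.val + 1 := by
  rcases lt_or_ge j.val i.val with h | h
  · rw [bend_of_lt h]
    simp only [reduceCtorEq, false_iff]
    omega
  · rcases lt_or_ge j.val (i.val + 2) with h' | h'
    · rw [bend_eq_none h h']
      simp only [true_iff]
      omega
    · rw [bend_of_le h']
      simp only [reduceCtorEq, false_iff]
      omega

/-! ### Local moves between caps and cups -/

namespace Diag

theorem capCup_link (n : ℕ) (i j : Fin (n + 1)) (k : Fin (n + 2)) {o o' : Option (Fin n)}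
    (h : bend n i k = o) (h' : bend n j k = o') :
    ((cap n i).glue (cup n j)).comp (.inl o) = ((cap n i).glue (cup n j)).comp (.inr o') := by
  subst h h'
  exact Quot.sound (GlueRel.link (r := (cap n i).Adj) (s := (cup n j).Adj)
    (f := (cap n i).bot) (g := (cup n j).top) k)

theorem cupCap_link (n : ℕ) (i j : Fin (n + 1)) (l : Fin n) :
    ((cup n i).glue (cap n j)).comp (.inl (some l : Option (Fin n))) =
      ((cup n i).glue (cap n j)).comp (.inr (some l : Option (Fin n))) :=
  Quot.sound (GlueRel.link (r := (cup n i).Adj) (s := (cap n j).Adj)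
    (f := (cup n i).bot) (g := (cap n j).top) l)

namespace Match

/-- The zigzag relation. -/
def zigzag (n : ℕ) (i j : Fin (n + 1)) (h : i.val + 1 = j.val) :
    ((cap n i).glue (cup n j)).Match (strands n) := by
  -- Both turnbacks lie on the strand that the zigzag straightens to, the one with number `i`.
  let f : Option (Fin n) → Fin n := fun o => o.elim ⟨i.val, by omega⟩ id
  refine ofPieces (a := (cap n i).glue (cup n j)) (b := strands n) (Sum.elim f f)
    (fun l => .inl (some l : Option (Fin n))) ?_ (fun _ _ h => h.elim) ?_ (fun _ => rfl)
    (fun _ => rfl) (fun _ => rfl)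
  · rintro _ _ (h | h | k)
    · exact h.elim
    · exact h.elim
    · refine congrArg (strands n).comp ?_
      change f (bend n i k) = f (bend n j k)
      rcases hi : bend n i k with _ | l <;> rcases hj : bend n j k with _ | l'
      · rfl
      · rw [bend_none_iff] at hi
        rw [bend_eq_some, Fin.ext_iff, unbend_val] at hj
        refine Fin.ext ?_
        change i.val = l'.val
        split_ifs at hj <;> omega
      · rw [bend_none_iff] at hj
        rw [bend_eq_some, Fin.ext_iff, unbend_val] at hi
        refine Fin.ext ?_
        change l.val = i.val
        split_ifs at hi <;> omega
      · rw [bend_eq_some, Fin.ext_iff, unbend_val] at hi hj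
        refine Fin.ext ?_
        change l.val = l'.val
        split_ifs at hi hj <;> omega
  -- The zigzag is followed through the glued endpoints `i + 2`, `i + 1` and `i`: from the strand of
  -- the cap to the turnback of the cup, on to the turnback of the cap, and out along the strand of
  -- the cup.
  · have e1 : ((cap n i).glue (cup n j)).comp
        (.inl (some ⟨i.val, by omega⟩ : Option (Fin n))) =
        ((cap n i).glue (cup n j)).comp (.inr (none : Option (Fin n))) :=
      capCup_link n i j ⟨i.val + 2, by omega⟩ (bend_of_le le_rfl)
        (bend_eq_none (by simp only; omega) (by simp only; omega))
    have e2 : ((cap n i).glue (cup n j)).comp (.inl (none : Option (Fin n))) =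
        ((cap n i).glue (cup n j)).comp (.inr (none : Option (Fin n))) :=
      capCup_link n i j ⟨i.val + 1, by omega⟩ (bend_eq_none (by simp only; omega)
        (by simp only; omega)) (bend_eq_none (by simp only; omega) (by simp only; omega))
    have e3 : ((cap n i).glue (cup n j)).comp (.inl (none : Option (Fin n))) =
        ((cap n i).glue (cup n j)).comp (.inr (some ⟨i.val, by omega⟩ : Option (Fin n))) :=
      capCup_link n i j ⟨i.val, by omega⟩ (bend_eq_none (by simp only; omega)
        (by simp only; omega)) (bend_of_lt (by simp only; omega))
    rintro ((_ | l) | (_ | l))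
    · exact e1.trans e2.symm
    · rfl
    · exact e1
    · change ((cap n i).glue (cup n j)).comp (.inl (some l : Option (Fin n))) =
        ((cap n i).glue (cup n j)).comp (.inr (some l : Option (Fin n)))
      by_cases hl : l.val = i.val
      · have : l = ⟨i.val, by omega⟩ := Fin.ext hl
        rw [this]
        exact e1.trans (e2.symm.trans e3)
      · refine capCup_link n i j (unbend n i l) (bend_unbend n i l) (bend_eq_some.2 (Fin.ext ?_))
        rw [unbend_val, unbend_val]
        split_ifs <;> omega

/-- Distant turnbacks commute. -/
def far (n : ℕ) (i j : Fin (n + 3)) (i' j' : Fin (n + 1)) (hi : i.val = i'.val)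
    (hj : j.val = j'.val + 2) (hij : i'.val ≤ j'.val) :
    ((cap (n + 2) i).glue (cup (n + 2) j)).Match ((cup n j').glue (cap n i')) := by
  -- Each turnback goes to the turnback of the same type, which has changed layers. A through strand
  -- of the upper layer ends at a top point and goes to the piece at that point; likewise for the
  -- lower layer and bottom points.
  let f : Option (Fin (n + 2)) → ((cup n j').glue (cap n i')).Piece := fun o =>
    o.elim (.inr (none : Option (Fin n))) fun l => .inl (bend n j' l)
  let f' : Option (Fin (n + 2)) → ((cup n j').glue (cap n i')).Piece := fun o =>
    o.elim (.inl (none : Option (Fin n))) fun l => .inr (bend n i' l)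
  let g : Option (Fin n) → ((cap (n + 2) i).glue (cup (n + 2) j)).Piece := fun o =>
    o.elim (.inr (none : Option (Fin (n + 2)))) fun l => .inl (some (unbend n j' l))
  let g' : Option (Fin n) → ((cap (n + 2) i).glue (cup (n + 2) j)).Piece := fun o =>
    o.elim (.inl (none : Option (Fin (n + 2)))) fun l => .inr (some (unbend n i' l))
  refine ofPieces (a := (cap (n + 2) i).glue (cup (n + 2) j)) (b := (cup n j').glue (cap n i'))
    (Sum.elim f f') (Sum.elim g g') ?_ ?_ ?_ ?_ (fun _ => rfl) (fun _ => rfl)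
  · rintro _ _ (h | h | k)
    · exact h.elim
    · exact h.elim
    · change ((cup n j').glue (cap n i')).comp (f (bend (n + 2) i k)) =
        ((cup n j').glue (cap n i')).comp (f' (bend (n + 2) j k))
      rcases h1 : bend (n + 2) i k with _ | l <;> rcases h2 : bend (n + 2) j k with _ | l'
      · rw [bend_none_iff] at h1 h2
        omega
      · have h3 : bend n i' l' = none := by
          rw [bend_none_iff] at h1 ⊢
          rw [bend_eq_some, Fin.ext_iff, unbend_val] at h2
          split_ifs at h2 <;> omega
        change _ = ((cup n j').glue (cap n i')).comp (.inr (bend n i' l'))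
        rw [h3]
        rfl
      · have h3 : bend n j' l = none := by
          rw [bend_none_iff] at h2 ⊢
          rw [bend_eq_some, Fin.ext_iff, unbend_val] at h1
          split_ifs at h1 <;> omega
        change ((cup n j').glue (cap n i')).comp (.inl (bend n j' l)) = _
        rw [h3]
        rfl
      · change ((cup n j').glue (cap n i')).comp (.inl (bend n j' l)) =
          ((cup n j').glue (cap n i')).comp (.inr (bend n i' l'))
        rw [bend_eq_some, Fin.ext_iff, unbend_val] at h1 h2
        rcases h3 : bend n j' l with _ | q
        · rw [bend_none_iff] at h3
          split_ifs at h1 h2 <;> omega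
        · have h4 : bend n i' l' = some q := by
            rw [bend_eq_some, Fin.ext_iff, unbend_val] at h3 ⊢
            split_ifs at h1 h2 h3 ⊢ <;> omega
          rw [h4]
          exact cupCap_link n j' i' q
  · rintro _ _ (h | h | l)
    · exact h.elim
    · exact h.elim
    · refine capCup_link (n + 2) i j (unbend (n + 2) i (unbend n j' l)) (bend_unbend _ _ _)
        (bend_eq_some.2 (Fin.ext ?_))
      rw [unbend_val, unbend_val, unbend_val, unbend_val]
      split_ifs <;> omega
  · rintro ((_ | l) | (_ | l))
    · rfl
    · change ((cap (n + 2) i).glue (cup (n + 2) j)).comp (Sum.elim g g' (.inl (bend n j' l))) = _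
      rcases h : bend n j' l with _ | q
      · refine (capCup_link (n + 2) i j (unbend (n + 2) i l) (bend_unbend _ _ _) ?_).symm
        rw [bend_none_iff] at h ⊢
        rw [unbend_val]
        split_ifs <;> omega
      · rw [bend_eq_some] at h
        rw [h]
        rfl
    · rfl
    · change ((cap (n + 2) i).glue (cup (n + 2) j)).comp (Sum.elim g g' (.inr (bend n i' l))) = _
      rcases h : bend n i' l with _ | q
      · refine capCup_link (n + 2) i j (unbend (n + 2) j l) ?_ (bend_unbend _ _ _)
        rw [bend_none_iff] at h ⊢
        rw [unbend_val]
        split_ifs <;> omega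
      · rw [bend_eq_some] at h
        rw [h]
        rfl
  · rintro ((_ | l) | (_ | l))
    · rfl
    · change ((cup n j').glue (cap n i')).comp (.inl (bend n j' (unbend n j' l))) = _
      rw [bend_unbend]
    · rfl
    · change ((cup n j').glue (cap n i')).comp (.inr (bend n i' (unbend n i' l))) = _
      rw [bend_unbend]

end Match

/-! ## Diagrams with more endpoints on the bottom than on top -/

/-- Diagrams composed of turnbacks on the bottom. -/
inductive IsCaps : {m n : ℕ} → Diag m n → Prop
  | strands (n : ℕ) : IsCaps (strands n)
  | snoc {m n : ℕ} {a : Diag m n} (h : IsCaps a) (i : Fin (n + 1)) : IsCaps (a.glue (cap n i))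

/-- The diagram matches one with a bottom part that consists of turnbacks attached to at most `m`
strands. -/
def Splits {m n : ℕ} (a : Diag m n) : Prop :=
  ∃ t ≤ m, ∃ (u : Diag m t) (d : Diag t n), d.IsCaps ∧ Nonempty (a.Match (u.glue d))

namespace Splits

variable {m n k : ℕ}

theorem of_match {a b : Diag m n} (e : a.Match b) (h : b.Splits) : a.Splits := by
  obtain ⟨t, ht, u, d, hd, ⟨f⟩⟩ := h
  exact ⟨t, ht, u, d, hd, ⟨e.trans f⟩⟩

theorem of_isCaps {d : Diag m n} (h : d.IsCaps) : d.Splits :=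
  ⟨m, le_rfl, strands m, d, h, ⟨(Match.strandsGlue d).symm⟩⟩

theorem glue_left {a : Diag m k} (hk : k ≤ m) {b : Diag k n} (h : b.Splits) :
    (a.glue b).Splits := by
  obtain ⟨t, ht, u, d, hd, ⟨f⟩⟩ := h
  exact ⟨t, ht.trans hk, a.glue u, d, hd,
    ⟨((Match.refl a).glue f).trans (Match.assoc a u d).symm⟩⟩

theorem glue_cap {a : Diag m n} (h : a.Splits) (i : Fin (n + 1)) : (a.glue (cap n i)).Splits := by
  obtain ⟨t, ht, u, d, hd, ⟨f⟩⟩ := h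
  exact ⟨t, ht, u, _, hd.snoc i, ⟨(f.glue (Match.refl _)).trans (Match.assoc _ _ _)⟩⟩

end Splits

/-- The cup meets the lowest cap. If they share exactly one endpoint they cancel by a zigzag, if
they share both they form a circle, and otherwise they change places and the cup moves on to a cap
higher up, with two endpoints fewer. A cup that gets past all caps belongs to the upper part of the
splitting, where it lowers the number of strands. -/
theorem IsCaps.splits_glue_cup {m n : ℕ} {d : Diag m (n + 2)} (hd : d.IsCaps) (j : Fin (n + 1)) :
    (d.glue (cup n j)).Splits := by
  induction n using Nat.strong_induction_on generalizing m with
  | _ n ih =>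
    cases hd with
    | strands =>
      exact ⟨n, by omega, cup n j, Diag.strands n, .strands n,
        ⟨(Match.strandsGlue _).trans (Match.glueStrands _).symm⟩⟩
    | @snoc _ d hd i =>
      refine .of_match (Match.assoc _ _ _) ?_
      -- After the exchange the cup sits directly below `d`, so the induction hypothesis for `n'`
      -- splits that part, and the cap is appended afterwards. The equation on `n` stays explicit so
      -- that both distant cases can use this.
      have far : ∀ n', n = n' + 2 → ∀ i' j' : Fin (n' + 1),
          (∀ h : n = n' + 2, Nonempty (((cap n i).glue (cup n j)).Match
            (h ▸ ((cup n' j').glue (cap n' i'))))) →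
          (d.glue ((cap n i).glue (cup n j))).Splits := by
        rintro n' rfl i' j' h
        obtain ⟨e⟩ := h rfl
        refine .of_match (((Match.refl d).glue e).trans (Match.assoc _ _ _).symm) ?_
        exact (ih n' (by omega) hd j').glue_cap i'
      rcases lt_trichotomy i.val j.val with h | h | h
      · rcases (show i.val + 1 = j.val ∨ i.val + 2 ≤ j.val by omega) with h' | h'
        · exact .of_match (((Match.refl d).glue (.zigzag n i j h')).trans (.glueStrands d))
            (.of_isCaps hd)
        · obtain ⟨n', rfl⟩ : ∃ n', n = n' + 2 := ⟨n - 2, by omega⟩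
          exact far n' rfl ⟨i.val, by omega⟩ ⟨j.val - 2, by omega⟩ fun _ =>
            ⟨.far n' i j _ _ rfl (by simp only; omega) (by simp only; omega)⟩
      · obtain rfl := Fin.ext h
        -- On top the circle is part of the upper diagram and does not disturb the caps.
        refine .of_match (Match.glueCircle d i) ?_
        exact .glue_left le_rfl (.of_isCaps hd)
      · rcases (show j.val + 1 = i.val ∨ j.val + 2 ≤ i.val by omega) with h' | h'
        -- Reflection exchanges the two types of zigzag; the distant case below uses the same
        -- symmetry.
        · exact .of_match (((Match.refl d).glue (Match.zigzag n j i h').reflect.symm).trans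
            (.glueStrands d)) (.of_isCaps hd)
        · obtain ⟨n', rfl⟩ : ∃ n', n = n' + 2 := ⟨n - 2, by omega⟩
          have e := Match.far n' j i ⟨j.val, by omega⟩ ⟨i.val - 2, by omega⟩ rfl
            (by simp only; omega) (by simp only; omega)
          exact far n' rfl ⟨i.val - 2, by omega⟩ ⟨j.val, by omega⟩ fun _ => ⟨e.reflect.symm⟩

/-- The induction over `b` carries caps above it, so that in a gluing the caps produced by the first
factor can be pushed through the second one. The upper parts accumulate, and the number of strands
below them never exceeds `m`. -/
theorem IsCaps.splits_glue {m k n : ℕ} {d : Diag m k} (hd : d.IsCaps) (b : Diag k n) :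
    (d.glue b).Splits := by
  induction b generalizing m with
  | strands n => exact .of_match (Match.glueStrands d) (.of_isCaps hd)
  | cap n i => exact .of_isCaps (hd.snoc i)
  | cup n j => exact hd.splits_glue_cup j
  | glue b c ihb ihc =>
    obtain ⟨t, ht, u, d', hd', ⟨e⟩⟩ := ihb hd
    refine .of_match ((Match.assoc _ _ _).symm.trans ((e.glue (Match.refl c)).trans
      (Match.assoc _ _ _))) ?_
    exact .glue_left ht (ihc hd')

theorem splits {m n : ℕ} (a : Diag m n) : a.Splits :=
  .of_match (Match.strandsGlue a).symm ((IsCaps.strands m).splits_glue a)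

/-- A diagram with more endpoints on the bottom than on top contains a turnback on the bottom. -/
theorem exists_match_glue_cap {m n : ℕ} (a : Diag m (n + 2)) (h : m < n + 2) :
    ∃ (b : Diag m n) (i : Fin (n + 1)), Nonempty (a.Match (b.glue (cap n i))) := by
  obtain ⟨t, ht, u, d, hd, ⟨e⟩⟩ := a.splits
  -- A cap part without caps would have `t = n + 2` strands, but `t ≤ m < n + 2`; hence there is a
  -- lowest cap.
  cases hd with
  | strands => omega
  | @snoc _ d hd i => exact ⟨u.glue d, i, ⟨e.trans (Match.assoc _ _ _).symm⟩⟩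

/-- Every cap leaves at least two bottom points, so the cap part of a splitting consists of one
strand, which forces `1 ≤ m`. This covers the case where there is no room for a turnback. -/
theorem not_lt_one {m : ℕ} (a : Diag m 1) : ¬ m < 1 := by
  obtain ⟨t, ht, u, d, hd, -⟩ := a.splits
  cases hd
  omega

end Diag

/-! ## Cylinders -/

namespace Surf

variable {m n k : ℕ}

theorem cl_src_eq {a b : Diag m n} (S : Surf a b) {x y : a.Piece} (h : a.comp x = a.comp y) :
    S.cl (S.src x) = S.cl (S.src y) :=
  congrArg (Quot.lift (fun p => S.cl (S.src p)) S.src_adj) h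

theorem cl_tgt_eq {a b : Diag m n} (S : Surf a b) {x y : b.Piece} (h : b.comp x = b.comp y) :
    S.cl (S.tgt x) = S.cl (S.tgt y) :=
  congrArg (Quot.lift (fun p => S.cl (S.tgt p)) S.tgt_adj) h

/-- A criterion for two surfaces without weights to be homeomorphic. -/
theorem Same.of_map_zero {a b : Diag m n} {S T : Surf a b} (f : S.Cell → T.Cell)
    (g : T.Cell → S.Cell) (hf : ∀ x y, S.adj x y → T.cl (f x) = T.cl (f y))
    (hg : ∀ x y, T.adj x y → S.cl (g x) = S.cl (g y))
    (hgf : ∀ x, S.cl (g (f x)) = S.cl x) (hfg : ∀ y, T.cl (f (g y)) = T.cl y)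
    (hs : ∀ p, T.cl (f (S.src p)) = T.cl (T.src p))
    (ht : ∀ p, T.cl (f (S.tgt p)) = T.cl (T.tgt p)) (hS : ∀ x, S.wt x = 0)
    (hT : ∀ x, T.wt x = 0) : S.Same T := by
  refine ⟨{ toFun := Quot.lift (fun x => T.cl (f x)) hf
            invFun := Quot.lift (fun x => S.cl (g x)) hg
            left_inv := by rintro ⟨x⟩; exact hgf x
            right_inv := by rintro ⟨x⟩; exact hfg x }, hs, ht, fun c => ?_⟩
  rw [total, total, Finset.sum_eq_zero fun x _ => hT x, Finset.sum_eq_zero fun x _ => hS x]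

/-- The surface obtained by attaching cylinders to the target. -/
noncomputable def relabelTgt {a b c : Diag m n} (S : Surf a b) (e : b.Match c) : Surf a c where
  Cell := S.Cell
  fin := S.fin
  adj := S.adj
  src := S.src
  tgt p := S.tgt (e.symm.rep p)
  wt := S.wt
  src_adj := S.src_adj
  tgt_adj _ _ h := S.cl_tgt_eq (e.symm.comp_rep_congr h)
  side_top i := (S.side_top i).trans
    (S.cl_tgt_eq ((e.symm.comp_rep _).trans (e.symm.top i))).symm
  side_bot i := (S.side_bot i).trans
    (S.cl_tgt_eq ((e.symm.comp_rep _).trans (e.symm.bot i))).symm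

/-- The surface obtained by attaching cylinders to the source. -/
noncomputable def relabelSrc {a b c : Diag m n} (S : Surf b c) (e : a.Match b) : Surf a c where
  Cell := S.Cell
  fin := S.fin
  adj := S.adj
  src p := S.src (e.rep p)
  tgt := S.tgt
  wt := S.wt
  src_adj _ _ h := S.cl_src_eq (e.comp_rep_congr h)
  tgt_adj := S.tgt_adj
  side_top i := (S.cl_src_eq ((e.comp_rep _).trans (e.top i))).trans (S.side_top i)
  side_bot i := (S.cl_src_eq ((e.comp_rep _).trans (e.bot i))).trans (S.side_bot i)

/-- A cylinder retracts onto its boundary, so attaching cylinders only renames the boundary of `S`.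
Through this and `cyl_comp_same`, surfaces composed with cylinders are compared on the cells of `S`
alone. -/
theorem comp_cyl_same {a b c : Diag m n} (S : Surf a b) (e : b.Match c) :
    (S.comp (cyl e)).Same (S.relabelTgt e) := by
  refine Same.of_map (S := S.comp (cyl e)) (T := S.relabelTgt e)
    (Sum.elim _root_.id fun c : b.Comp => S.tgt (Quot.out c)) Sum.inl ?_ ?_ ?_ ?_ ?_ ?_ ?_
  · rintro _ _ (h | h | p)
    · exact Quot.sound h
    · exact h.elim
    · exact S.cl_tgt_eq (Quot.out_eq (b.comp p)).symm
  · exact fun _ _ h => Quot.sound (.left h)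
  · rintro (x | c)
    · rfl
    · refine (Quot.sound (GlueRel.link (Quot.out c))).trans ?_
      change (S.comp (cyl e)).cl (.inr (b.comp (Quot.out c))) = _
      rw [show b.comp (Quot.out c) = c from Quot.out_eq c]
  · exact fun _ => rfl
  · exact fun _ => rfl
  · exact fun _ => rfl
  · rintro (x | x)
    · exact ⟨fun h => (h rfl).elim, fun _ => rfl⟩
    · exact ⟨fun _ => rfl, fun h => by cases h⟩

theorem cyl_comp_same {a b c : Diag m n} (S : Surf b c) (e : a.Match b) :
    ((cyl e).comp S).Same (S.relabelSrc e) := by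
  refine Same.of_map (S := (cyl e).comp S) (T := S.relabelSrc e)
    (Sum.elim (fun c : a.Comp => S.src (Quot.out (e.e c))) _root_.id) Sum.inr ?_ ?_ ?_ ?_ ?_ ?_ ?_
  · rintro _ _ (h | h | p)
    · exact h.elim
    · exact Quot.sound h
    · refine S.cl_src_eq ((Quot.out_eq _).trans ?_)
      exact e.e.apply_symm_apply _
  · exact fun _ _ h => Quot.sound (.right h)
  · rintro (c | x)
    · refine (Quot.sound (GlueRel.link (Quot.out (e.e c)))).symm.trans ?_
      change ((cyl e).comp S).cl (.inl (e.e.symm (b.comp (Quot.out (e.e c))))) = _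
      rw [show b.comp (Quot.out (e.e c)) = e.e c from Quot.out_eq _]
      exact congrArg (fun y => ((cyl e).comp S).cl (.inl y)) (e.e.symm_apply_apply c)
    · rfl
  · exact fun _ => rfl
  · exact fun _ => rfl
  · exact fun _ => rfl
  · rintro (x | x)
    · exact ⟨fun _ => rfl, fun h => by cases h⟩
    · exact ⟨fun h => (h rfl).elim, fun _ => rfl⟩

theorem cyl_refl_same (a : Diag m n) : (cyl (Diag.Match.refl a)).Same (Surf.id a 0) := by
  refine Same.of_map_zero (S := cyl (Diag.Match.refl a)) (T := Surf.id a 0)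
    (fun c : a.Comp => Quot.out c) a.comp (fun _ _ h => h.elim) ?_ ?_ ?_ ?_ ?_
    (fun _ => rfl) (fun _ => rfl)
  · exact fun _ _ h => congrArg _ (Quot.sound h)
  · exact fun c => congrArg _ (Quot.out_eq c)
  · exact fun p => Quot.out_eq (a.comp p)
  · exact fun p => Quot.out_eq (a.comp p)
  · exact fun p => Quot.out_eq (a.comp p)

theorem cyl_comp_cyl_symm_same {a b : Diag m n} (e : a.Match b) :
    ((cyl e).comp (cyl e.symm)).Same (Surf.id a 0) := by
  refine ((comp_cyl_same (cyl e) e.symm).trans ?_).trans (cyl_refl_same a)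
  refine Same.of_map_zero (S := (cyl e).relabelTgt e.symm) (T := cyl (Diag.Match.refl a))
    _root_.id _root_.id (fun _ _ h => h.elim) (fun _ _ h => h.elim) (fun _ => rfl) (fun _ => rfl)
    (fun _ => rfl) ?_ (fun _ => rfl) (fun _ => rfl)
  intro p
  refine congrArg (Quot.mk _) ?_
  refine (congrArg e.e.symm (e.symm.symm.comp_rep p)).trans ?_
  exact e.e.symm_apply_apply _

theorem deg_cyl {a b : Diag m n} (e : a.Match b) : (cyl e).deg = 0 :=
  Finset.sum_eq_zero fun _ _ => rfl

/-- With the cylinders absorbed into the boundary labels, both sides have the same cells up to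
rebracketing of disjoint unions. The labels differ by chosen representatives, which agree at the
level of components. -/
theorem assoc_natural_same {l : ℕ} {a a' : Diag m k} {b b' : Diag k l} {c c' : Diag l n}
    (S : Surf a a') (T : Surf b b') (U : Surf c c') :
    (((S.glue T).glue U).comp (cyl (.assoc a' b' c'))).Same
      ((cyl (.assoc a b c)).comp (S.glue (T.glue U))) := by
  refine (comp_cyl_same _ _).trans (Same.trans ?_ (cyl_comp_same _ _).symm)
  refine Same.of_map (S := ((S.glue T).glue U).relabelTgt (.assoc a' b' c'))
    (T := (S.glue (T.glue U)).relabelSrc (.assoc a b c))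
    (Equiv.sumAssoc _ _ _) (Equiv.sumAssoc _ _ _).symm ?_ ?_ ?_ ?_ ?_ ?_ ?_
  · rintro _ _ ((h | h | i) | h | i)
    · exact Quot.sound (.left h)
    · exact Quot.sound (.right (.left h))
    · exact Quot.sound (.link i)
    · exact Quot.sound (.right (.right h))
    · exact Quot.sound (.right (.link i))
  · rintro _ _ (h | (h | h | i) | i)
    · exact Quot.sound (.left (.left h))
    · exact Quot.sound (.left (.right h))
    · exact Quot.sound (.right h)
    · exact Quot.sound (.link i)
    · exact Quot.sound (.left (.link i))
  · rintro ((x | x) | x) <;> rfl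
  · rintro (x | x | x) <;> rfl
  · intro p
    refine Eq.trans ?_ ((S.glue (T.glue U)).cl_src_eq
      (x := Equiv.sumAssoc _ _ _ p) ((Diag.Match.assoc a b c).comp_rep p).symm)
    rcases p with (p | p) | p <;> rfl
  · intro p
    obtain ⟨p, rfl⟩ := (Equiv.sumAssoc a'.Piece b'.Piece c'.Piece).surjective p
    have h := ((S.glue T).glue U).cl_tgt_eq (y := p)
      (((Diag.Match.assoc a' b' c').symm.comp_rep (Equiv.sumAssoc _ _ _ p)).trans
        (congrArg ((a'.glue b').glue c').comp (Equiv.symm_apply_apply _ p)))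
    have key : ∀ x y : ((S.glue T).glue U).Cell, ((S.glue T).glue U).cl x =
        ((S.glue T).glue U).cl y → (S.glue (T.glue U)).cl (Equiv.sumAssoc _ _ _ x) =
        (S.glue (T.glue U)).cl (Equiv.sumAssoc _ _ _ y) := by
      intro x y h
      refine congrArg (Quot.lift (fun x => (S.glue (T.glue U)).cl (Equiv.sumAssoc _ _ _ x)) ?_) h
      rintro _ _ ((h | h | i) | h | i)
      · exact Quot.sound (.left h)
      · exact Quot.sound (.right (.left h))
      · exact Quot.sound (.link i)
      · exact Quot.sound (.right (.right h))
      · exact Quot.sound (.right (.link i))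
    refine (key _ _ h).trans ?_
    rcases p with (p | p) | p <;> rfl
  · rintro ((x | x) | x) <;> exact ⟨fun h => (h rfl).elim, fun _ => rfl⟩

end Surf

/-! ### Cylinders as morphisms modulo the local relations -/

namespace CobHom

variable {m n k l : ℕ}

theorem cyl_comp_cyl_symm {a b : Diag m n} (e : a.Match b) :
    comp (of (Mov.cyl e)) (of (Mov.cyl e.symm)) = of (Mov.id a) := by
  rw [comp_of]
  exact of_eq (Surf.cyl_comp_cyl_symm_same e)

theorem of_cyl_refl (a : Diag m n) : of (Mov.cyl (Diag.Match.refl a)) = of (Mov.id a) :=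
  of_eq (Surf.cyl_refl_same a)

theorem cyl_mem {a b : Diag m n} (e : a.Match b) : of (Mov.cyl e) ∈ part a b 0 :=
  AddSubgroup.subset_closure ⟨Mov.cyl e, 0, by rw [Mov.surf, Surf.deg_cyl]; rfl,
    by rw [pow_zero, one_smul]⟩

theorem assoc_natural {a a' : Diag m k} {b b' : Diag k l} {c c' : Diag l n}
    (x : CobHom a a') (y : CobHom b b') (z : CobHom c c') :
    comp (glue (glue x y) z) (of (Mov.cyl (.assoc a' b' c'))) =
      comp (of (Mov.cyl (.assoc a b c))) (glue x (glue y z)) := by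
  induction x using induction_on with
  | h0 => simp only [map_zero, LinearMap.zero_apply]
  | ha x x' h h' => simp only [map_add, LinearMap.add_apply, h, h']
  | hs r S =>
    simp only [map_smul, LinearMap.smul_apply]
    congr 1
    induction y using induction_on with
    | h0 => simp only [map_zero, LinearMap.zero_apply]
    | ha x x' h h' => simp only [map_add, LinearMap.add_apply, h, h']
    | hs r T =>
      simp only [map_smul, LinearMap.smul_apply]
      congr 1
      induction z using induction_on with
      | h0 => simp only [map_zero, LinearMap.zero_apply]
      | ha x x' h h' => simp only [map_add, LinearMap.add_apply, h, h']
      | hs r U =>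
        simp only [map_smul, LinearMap.smul_apply, comp_of, glue_of]
        congr 1
        exact of_eq (Surf.assoc_natural_same _ _ _)

theorem reflect_glue {a b : Diag m k} {a' b' : Diag k n} (x : CobHom a b) (y : CobHom a' b') :
    reflect (glue x y) = glue (reflect y) (reflect x) := by
  induction x using induction_on with
  | h0 => simp only [map_zero, LinearMap.zero_apply]; rfl
  | ha u v h h' => simp only [map_add, LinearMap.add_apply, h, h']; rfl
  | hs r S =>
    simp only [map_smul, LinearMap.smul_apply]
    congr 1
    induction y using induction_on with
    | h0 => simp only [map_zero, LinearMap.zero_apply]; rfl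
    | ha u v h h' => simp only [map_add, LinearMap.add_apply, h, h']; rfl
    | hs r T =>
      simp only [map_smul, LinearMap.smul_apply, glue_of, reflect_of]
      rfl

end CobHom

/-! ### Isomorphisms between glued and shifted diagrams -/

namespace Cob

variable {m n k l : ℕ}

/-- Matching diagrams with equal shifts are isomorphic. -/
noncomputable def isoOfMatch {Y Z : Cob m n} (h : Y.shift = Z.shift) (e : Y.diag.Match Z.diag) :
    Y ≅ Z where
  hom := ⟨CobHom.of (Mov.cyl e), CobHom.part_congr (by rw [h, sub_self]) (CobHom.cyl_mem e)⟩
  inv := ⟨CobHom.of (Mov.cyl e.symm),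
    CobHom.part_congr (by rw [h, sub_self]) (CobHom.cyl_mem e.symm)⟩
  hom_inv_id := hom_ext (CobHom.cyl_comp_cyl_symm e)
  inv_hom_id := hom_ext (CobHom.cyl_comp_cyl_symm e.symm)

/-- Gluing is associative. -/
noncomputable def assocIso (Y : Cob m k) (Z : Cob k l) (W : Cob l n) :
    glueObj (glueObj Y Z) W ≅ glueObj Y (glueObj Z W) :=
  isoOfMatch (add_assoc _ _ _) (.assoc _ _ _)

theorem assocIso_natural {Y Y' : Cob m k} {Z Z' : Cob k l} {W W' : Cob l n} (f : Y ⟶ Y')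
    (g : Z ⟶ Z') (h : W ⟶ W') :
    glueHom (glueHom f g) h ≫ (assocIso Y' Z' W').hom =
      (assocIso Y Z W).hom ≫ glueHom f (glueHom g h) :=
  hom_ext (CobHom.assoc_natural f.1 g.1 h.1)

/-- Gluing `glueObj Y Z` above other diagrams. -/
noncomputable def gluingObjGlue (Y : Cob m k) (Z : Cob k l) :
    (gluing m l n).obj (glueObj Y Z) ≅ (gluing k l n).obj Z ⋙ (gluing m k n).obj Y :=
  NatIso.ofComponents (assocIso Y Z) fun {W W'} h => by
    have := assocIso_natural (𝟙 Y) (𝟙 Z) h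
    rwa [glueHom_id] at this

/-- Gluing `glueObj Z W` below other diagrams. -/
noncomputable def gluingFlipObjGlue (Z : Cob k l) (W : Cob l n) :
    (gluing m k n).flip.obj (glueObj Z W) ≅
      (gluing m k l).flip.obj Z ⋙ (gluing m l n).flip.obj W :=
  (NatIso.ofComponents (fun Y => assocIso Y Z W) fun {Y Y'} f => by
    have := assocIso_natural f (𝟙 Z) (𝟙 W)
    rwa [glueHom_id] at this).symm

/-- The dual of a gluing. -/
noncomputable def dualityGlue (Y : Cob m k) (b : Diag k n) :
    (duality m n).obj (.op (glueObj Y (ofDiag b))) ≅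
      glueObj (ofDiag b.reflect) ((duality m k).obj (.op Y)) :=
  isoOfMatch (show -(Y.shift + 0) = 0 + -Y.shift by ring) (.refl (Y.diag.glue b).reflect)

/-- The two diagrams are the same and only their shifts are written differently, so the cylinders
are identities and what remains is that reflection reverses gluing. -/
theorem dualityGlue_natural {Y Z : Cob m k} (f : Y ⟶ Z) (b : Diag k n) :
    (duality m n).map (glueHom f (𝟙 (ofDiag b))).op ≫ (dualityGlue Y b).hom =
      (dualityGlue Z b).hom ≫ glueHom (𝟙 (ofDiag b.reflect)) ((duality m k).map f.op) := by
  refine hom_ext ?_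
  change CobHom.comp (CobHom.reflect (CobHom.glue f.1 (CobHom.of (Mov.id b))))
      (CobHom.of (Mov.cyl (Diag.Match.refl _))) =
    CobHom.comp (CobHom.of (Mov.cyl (Diag.Match.refl _)))
      (CobHom.glue (CobHom.of (Mov.id b.reflect)) (CobHom.reflect f.1))
  rw [CobHom.of_cyl_refl, CobHom.of_cyl_refl, CobHom.comp_id, CobHom.reflect_glue,
    CobHom.reflect_of]
  exact (CobHom.id_comp _).symm

/-- A diagram with more endpoints on the bottom than on top factors through a turnback on the
bottom. -/
theorem exists_iso_glue_cap (Y : Cob m (n + 2)) (h : m < n + 2) :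
    ∃ (b : Cob m n) (i : Fin (n + 1)), Nonempty (Y ≅ glueObj b (ofDiag (.cap n i))) := by
  obtain ⟨b, i, ⟨e⟩⟩ := Y.diag.exists_match_glue_cap h
  exact ⟨⟨Y.shift, b⟩, i, ⟨isoOfMatch (add_zero _).symm e⟩⟩

/-- A diagram with more endpoints on top than on the bottom factors through a turnback on top. -/
theorem exists_iso_cup_glue (Y : Cob (m + 2) n) (h : n < m + 2) :
    ∃ (b : Cob m n) (i : Fin (m + 1)), Nonempty (Y ≅ glueObj (ofDiag (.cup m i)) b) := by
  obtain ⟨s, a⟩ := Y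
  obtain ⟨b, i, ⟨e⟩⟩ := a.reflect.exists_match_glue_cap h
  -- The factorization of the reflected diagram is reflected back, which turns the bottom cap into a
  -- top cup.
  refine ⟨⟨s, b.reflect⟩, i, ⟨isoOfMatch (zero_add _).symm ?_⟩⟩
  have e' := e.reflect.symm
  rw [a.reflect_reflect] at e'
  exact e'

end Cob

/-! ## Contractions -/

section Contraction

variable {C D : Type*} [Category C] [Preadditive C] [Category D] [Preadditive D]

theorem idm_self (K : CochainComplex C ℤ) (q : ℤ) : idm K q q = 𝟙 (K.X q) := dif_pos rfl

/-- A null homotopy of the identity of a complex. -/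
structure Contraction (K : CochainComplex C ℤ) where
  h : ∀ q q', K.X q ⟶ K.X q'
  shape : ∀ q q', q' + 1 ≠ q → h q q' = 0
  eq : ∀ q, K.d q (q + 1) ≫ h (q + 1) q + h q (q - 1) ≫ K.d (q - 1) q = 𝟙 (K.X q)

namespace Contraction

variable {K L : CochainComplex C ℤ}

theorem eq_of (c : Contraction K) {q r s : ℤ} (hr : q + 1 = r) (hs : s + 1 = q) :
    K.d q r ≫ c.h r q + c.h q s ≫ K.d s q = 𝟙 (K.X q) := by
  obtain rfl : s = q - 1 := by omega
  subst hr
  exact c.eq q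

/-- The contraction given by a homotopy from the identity to zero. -/
def ofHomotopy (H : Homotopy (𝟙 K) 0) : Contraction K where
  h := H.hom
  shape q q' h := H.zero q q' h
  eq q := by
    have h := H.comm q
    rw [dNext_eq H.hom (show (ComplexShape.up ℤ).Rel q (q + 1) from rfl),
      prevD_eq H.hom (show (ComplexShape.up ℤ).Rel (q - 1) q from sub_add_cancel q 1)] at h
    rw [HomologicalComplex.id_f, HomologicalComplex.zero_f, add_zero] at h
    exact h.symm

/-- The homotopy from the identity to zero given by a contraction. -/
def toHomotopy (c : Contraction K) : Homotopy (𝟙 K) 0 where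
  hom := c.h
  zero q q' h := c.shape q q' h
  comm q := by
    rw [dNext_eq c.h (show (ComplexShape.up ℤ).Rel q (q + 1) from rfl),
      prevD_eq c.h (show (ComplexShape.up ℤ).Rel (q - 1) q from sub_add_cancel q 1)]
    rw [HomologicalComplex.id_f, HomologicalComplex.zero_f, add_zero]
    exact (c.eq q).symm

/-- Contractions are preserved by additive functors. -/
def map (c : Contraction K) (G : C ⥤ D) [G.Additive] :
    Contraction ((G.mapHomologicalComplex _).obj K) where
  h q q' := G.map (c.h q q')
  shape q q' h := (congrArg G.map (c.shape q q' h)).trans (G.map_zero _ _)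
  eq q := by
    have h : G.map (K.d q (q + 1)) ≫ G.map (c.h (q + 1) q) +
        G.map (c.h q (q - 1)) ≫ G.map (K.d (q - 1) q) = 𝟙 (G.obj (K.X q)) := by
      rw [← G.map_comp, ← G.map_comp, ← G.map_add, c.eq, G.map_id]
    exact h

/-- Contractions are preserved by isomorphisms. -/
def ofIso (c : Contraction K) (e : K ≅ L) : Contraction L where
  h q q' := e.inv.f q ≫ c.h q q' ≫ e.hom.f q'
  shape q q' h := by rw [c.shape q q' h, Limits.zero_comp, Limits.comp_zero]
  eq q := by
    rw [← e.inv.comm_assoc, Category.assoc, Category.assoc, e.hom.comm, ← Preadditive.comp_add]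
    rw [← Category.assoc (K.d q (q + 1)), ← Category.assoc (c.h q (q - 1)),
      ← Preadditive.add_comp, c.eq, Category.id_comp]
    exact HomologicalComplex.congr_hom e.inv_hom_id q

/-- A homotopy from an automorphism to zero gives a contraction. -/
theorem nonempty_of_isIso (h : ∀ q q', K.X q ⟶ K.X q') (shape : ∀ q q', q' + 1 ≠ q → h q q' = 0)
    (iso : ∀ q, IsIso (K.d q (q + 1) ≫ h (q + 1) q + h q (q - 1) ≫ K.d (q - 1) q)) :
    Nonempty (Contraction K) := by
  -- `u = dh + hd` commutes with `d`, both composites being `dhd`. So does its inverse, and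
  -- therefore `u⁻¹ h` satisfies the equation of a contraction.
  let u : ∀ q, K.X q ⟶ K.X q := fun q =>
    K.d q (q + 1) ≫ h (q + 1) q + h q (q - 1) ≫ K.d (q - 1) q
  have iso' : ∀ q, IsIso (u q) := iso
  have comm : ∀ q r, q + 1 = r → K.d q r ≫ inv (u r) = inv (u q) ≫ K.d q r := by
    rintro q _ rfl
    rw [IsIso.comp_inv_eq, Category.assoc, IsIso.eq_inv_comp]
    change (K.d q (q + 1) ≫ h (q + 1) q + h q (q - 1) ≫ K.d (q - 1) q) ≫ K.d q (q + 1) =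
      K.d q (q + 1) ≫ (K.d (q + 1) (q + 1 + 1) ≫ h (q + 1 + 1) (q + 1) +
        h (q + 1) (q + 1 - 1) ≫ K.d (q + 1 - 1) (q + 1))
    rw [Preadditive.add_comp, Preadditive.comp_add, K.d_comp_d_assoc, Limits.zero_comp, zero_add,
      Category.assoc, Category.assoc, K.d_comp_d, Limits.comp_zero, add_zero, add_sub_cancel_right]
  refine ⟨⟨fun q q' => inv (u q) ≫ h q q', fun q q' e => ?_, fun q => ?_⟩⟩
  · rw [shape q q' e, Limits.comp_zero]
  · rw [← Category.assoc, comm q _ rfl, Category.assoc, Category.assoc, ← Preadditive.comp_add]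
    exact IsIso.inv_hom_id (u q)

end Contraction

end Contraction

/-! ## Triangular matrices -/

namespace Clo

variable {C D E : Type*} [Category C] [Preadditive C] [Category D] [Preadditive D] [Category E]
  [Preadditive E] {κ : Kind}

theorem id_apply_self (Y : Clo κ C) (i : Y.ι) : (𝟙 Y : Y ⟶ Y).1 i i = 𝟙 (Y.X i) := one_self Y i

theorem id_apply_ne (Y : Clo κ C) {i j : Y.ι} (h : i ≠ j) : (𝟙 Y : Y ⟶ Y).1 i j = 0 := one_ne Y h

theorem sub_apply {Y Z : Clo κ C} (f g : Y ⟶ Z) (i : Y.ι) (j : Z.ι) :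
    (f - g).1 i j = f.1 i j - g.1 i j := rfl

theorem smul_apply {Y Z : Clo κ C} (r : ℤˣ) (f : Y ⟶ Z) (i : Y.ι) (j : Z.ι) :
    (r • f).1 i j = r • f.1 i j := by
  rcases Int.units_eq_one_or r with rfl | rfl
  · rw [one_smul, one_smul]
  · rw [Units.neg_smul, Units.neg_smul, one_smul, one_smul]
    rfl

/-- A zero formal sum may have a nonempty index set, but the diagonal entries of its identity
vanish, so each summand is itself zero. The family `f` need not satisfy any finiteness condition. -/
theorem apply_eq_zero_of_isZero {Y Z : Clo κ C} (h : Limits.IsZero Y) (f : ∀ i j, Y.X i ⟶ Z.X j)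
    (i : Y.ι) (j : Z.ι) : f i j = 0 := by
  have h1 : 𝟙 (Y.X i) = 0 := by
    rw [← id_apply_self, h.eq_of_src (𝟙 Y) 0, zero_apply]
  rw [← Category.id_comp (f i j), h1, Limits.zero_comp]

/-- The partial sums of the geometric series. -/
noncomputable def geom {Y : Clo κ C} (N : Y ⟶ Y) : ℕ → (Y ⟶ Y)
  | 0 => 0
  | r + 1 => 𝟙 Y + N ≫ geom N r

theorem geom_succ' {Y : Clo κ C} (N : Y ⟶ Y) (r : ℕ) :
    geom N (r + 1) = 𝟙 Y + geom N r ≫ N := by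
  induction r with
  | zero => exact congrArg (𝟙 Y + ·) (Limits.comp_zero.trans Limits.zero_comp.symm)
  | succ r ih =>
    have h : geom N (r + 1 + 1) = 𝟙 Y + N ≫ geom N (r + 1) := rfl
    have h' : geom N (r + 1) = 𝟙 Y + N ≫ geom N r := rfl
    rw [h]
    nth_rewrite 1 [ih]
    rw [h', Preadditive.comp_add, Preadditive.add_comp, Category.comp_id, Category.id_comp,
      Category.assoc]

/-- If the geometric series becomes stationary in every entry, then it gives an inverse. -/
theorem isIso_of_geom {Y : Clo κ C} (N : Y ⟶ Y) (ρ : Y.ι → Y.ι → ℕ)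
    (h1 : ∀ x y z, N.1 x z ≠ 0 → ρ z y ≤ ρ x y) (h2 : ∀ x y z, N.1 z y ≠ 0 → ρ x z ≤ ρ x y)
    (stab : ∀ x y r, ρ x y ≤ r → (geom N r).1 x y = (geom N (ρ x y)).1 x y)
    (supp : κ.Supp fun x y => (geom N (ρ x y)).1 x y ≠ 0) : IsIso (𝟙 Y - N) := by
  -- `ρ x y` is a stage from which the entry at `(x, y)` no longer changes, so `V` is the entrywise
  -- limit of the series. By monotonicity of `ρ`, all entries of `V` that contribute to one entry of
  -- `N ≫ V` or `V ≫ N` can be read off at a common stage.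
  let V : Y ⟶ Y := ⟨fun x y => (geom N (ρ x y)).1 x y, supp⟩
  have e1 : N ≫ V = V - 𝟙 Y := hom_ext fun x y => by
    have h : ∀ z, N.1 x z ≫ V.1 z y = N.1 x z ≫ (geom N (ρ x y)).1 z y := fun z => by
      by_cases hz : N.1 x z = 0
      · rw [hz, Limits.zero_comp, Limits.zero_comp]
      · rw [stab z y _ (h1 x y z hz)]
    rw [comp_apply, finsum_congr h, ← comp_apply, sub_apply, eq_sub_iff_add_eq', ← add_apply]
    exact stab x y (ρ x y + 1) (Nat.le_succ _)
  have e2 : V ≫ N = V - 𝟙 Y := hom_ext fun x y => by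
    have h : ∀ z, V.1 x z ≫ N.1 z y = (geom N (ρ x y)).1 x z ≫ N.1 z y := fun z => by
      by_cases hz : N.1 z y = 0
      · rw [hz, Limits.comp_zero, Limits.comp_zero]
      · rw [stab x z _ (h2 x y z hz)]
    rw [comp_apply, finsum_congr h, ← comp_apply, sub_apply, eq_sub_iff_add_eq', ← add_apply,
      ← geom_succ']
    exact stab x y (ρ x y + 1) (Nat.le_succ _)
  refine ⟨V, ?_, ?_⟩
  · rw [Preadditive.sub_comp, Category.id_comp, e1, sub_sub_cancel]
  · rw [Preadditive.comp_sub, Category.comp_id, e2, sub_sub_cancel]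

/-- Matrices of sums that are lower triangular with respect to a grading. -/
theorem isIso_of_lt_sum {Y : Clo .sum C} (u : Y ⟶ Y) (w : Y.ι → ℕ)
    (hw : ∀ x y, (u - 𝟙 Y).1 x y ≠ 0 → w y < w x) : IsIso u := by
  obtain ⟨N, rfl⟩ : ∃ N, u = 𝟙 Y - N := ⟨𝟙 Y - u, (sub_sub_cancel _ _).symm⟩
  replace hw : ∀ x y, N.1 x y ≠ 0 → w y < w x := fun x y h => hw x y (by
    rw [sub_sub_cancel_left]
    exact neg_ne_zero.2 h)
  -- A nonzero path from `x` lowers the weight at each step and so has length at most `w x`. Row `x`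
  -- of the limit is a row of one partial sum, hence finite, as required for sums.
  have stab : ∀ r x y, w x < r → (geom N (r + 1)).1 x y = (geom N r).1 x y := by
    intro r
    induction r with
    | zero => exact fun x y h => absurd h (Nat.not_lt_zero _)
    | succ r ih =>
      intro x y h
      change (𝟙 Y + N ≫ geom N (r + 1)).1 x y = (𝟙 Y + N ≫ geom N r).1 x y
      rw [add_apply, add_apply, comp_apply, comp_apply]
      refine congrArg _ (finsum_congr fun z => ?_)
      by_cases hz : N.1 x z = 0
      · rw [hz, Limits.zero_comp, Limits.zero_comp]
      · have := hw x z hz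
        rw [ih z y (by omega)]
  refine isIso_of_geom N (fun x _ => w x + 1) (fun x y z h => ?_) (fun _ _ _ _ => le_rfl)
    (fun x y r h => ?_) fun x => (geom N (w x + 1)).2 x
  · have := hw x z h
    omega
  · induction r, h using Nat.le_induction with
    | base => rfl
    | succ r h ih => rw [stab r x y h, ih]

/-- Matrices of products that are upper triangular with respect to a grading. -/
theorem isIso_of_lt_prod {Y : Clo .prod C} (u : Y ⟶ Y) (w : Y.ι → ℕ)
    (hw : ∀ x y, (u - 𝟙 Y).1 x y ≠ 0 → w x < w y) : IsIso u := by
  obtain ⟨N, rfl⟩ : ∃ N, u = 𝟙 Y - N := ⟨𝟙 Y - u, (sub_sub_cancel _ _).symm⟩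
  replace hw : ∀ x y, N.1 x y ≠ 0 → w x < w y := fun x y h => hw x y (by
    rw [sub_sub_cancel_left]
    exact neg_ne_zero.2 h)
  -- Here paths ending at `y` have length at most `w y`, so columns become stationary. Peeling off
  -- the last factor of a path needs the form `geom_succ'` of the recursion.
  have stab : ∀ r x y, w y < r → (geom N (r + 1)).1 x y = (geom N r).1 x y := by
    intro r
    induction r with
    | zero => exact fun x y h => absurd h (Nat.not_lt_zero _)
    | succ r ih =>
      intro x y h
      have e : ∀ r, (geom N (r + 1)).1 x y = (𝟙 Y + geom N r ≫ N).1 x y := fun r => by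
        rw [geom_succ']
      rw [e, e, add_apply, add_apply, comp_apply, comp_apply]
      refine congrArg _ (finsum_congr fun z => ?_)
      by_cases hz : N.1 z y = 0
      · rw [hz, Limits.comp_zero, Limits.comp_zero]
      · have := hw z y hz
        rw [ih x z (by omega)]
  refine isIso_of_geom N (fun _ y => w y + 1) (fun _ _ _ _ => le_rfl) (fun x y z h => ?_)
    (fun x y r h => ?_) fun y => (geom N (w y + 1)).2 y
  · have := hw z y h
    omega
  · induction r, h using Nat.le_induction with
    | base => rfl
    | succ r h ih => rw [stab r x y h, ih]

/-! ## Natural transformations and diagonal matrices -/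

open scoped Classical in
/-- A diagonal matrix. -/
noncomputable def diag {I : Type} (hI : κ.Index I) {X X' : I → C} (e : ∀ i, X i ⟶ X' i) :
    (⟨I, hI, X⟩ : Clo κ C) ⟶ ⟨I, hI, X'⟩ :=
  ⟨fun i j => if h : i = j then e i ≫ eqToHom (congrArg X' h) else 0,
    Kind.Supp.eq.mono fun i j h => by
      by_contra h'
      exact h (dif_neg h')⟩

theorem diag_apply_self {I : Type} (hI : κ.Index I) {X X' : I → C} (e : ∀ i, X i ⟶ X' i) (i : I) :
    (diag hI e).1 i i = e i := (dif_pos rfl).trans (Category.comp_id _)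

theorem diag_apply_ne {I : Type} (hI : κ.Index I) {X X' : I → C} (e : ∀ i, X i ⟶ X' i) {i j : I}
    (h : i ≠ j) : (diag hI e).1 i j = 0 := dif_neg h

theorem diag_comp_apply {I : Type} (hI : κ.Index I) {X X' : I → C} (e : ∀ i, X i ⟶ X' i)
    {Z : Clo κ C} (f : (⟨I, hI, X'⟩ : Clo κ C) ⟶ Z) (i : I) (k : Z.ι) :
    (diag hI e ≫ f).1 i k = e i ≫ f.1 i k := by
  rw [comp_apply]
  refine (finsum_eq_single _ i fun j hj => ?_).trans ?_
  · rw [diag_apply_ne hI e hj.symm, Limits.zero_comp]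
  · rw [diag_apply_self]

theorem comp_diag_apply {I : Type} (hI : κ.Index I) {X X' : I → C} (e : ∀ i, X i ⟶ X' i)
    {Z : Clo κ C} (f : Z ⟶ (⟨I, hI, X⟩ : Clo κ C)) (k : Z.ι) (i : I) :
    (f ≫ diag hI e).1 k i = f.1 k i ≫ e i := by
  rw [comp_apply]
  refine (finsum_eq_single _ i fun j hj => ?_).trans ?_
  · rw [diag_apply_ne hI e hj, Limits.comp_zero]
  · rw [diag_apply_self]

theorem diag_comp_diag {I : Type} (hI : κ.Index I) {X X' : I → C} (e : ∀ i, X i ⟶ X' i)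
    (e' : ∀ i, X' i ⟶ X i) (h : ∀ i, e i ≫ e' i = 𝟙 (X i)) : diag hI e ≫ diag hI e' = 𝟙 _ :=
  hom_ext fun i j => by
    rw [diag_comp_apply]
    by_cases hij : i = j
    · subst hij
      rw [diag_apply_self]
      exact (h i).trans (id_apply_self (⟨I, hI, X⟩ : Clo κ C) i).symm
    · rw [diag_apply_ne hI e' hij, Limits.comp_zero]
      exact (id_apply_ne (⟨I, hI, X⟩ : Clo κ C) hij).symm

/-- An isomorphism of formal sums or products given by isomorphisms of the summands. -/
noncomputable def diagIso {I : Type} (hI : κ.Index I) {X X' : I → C} (e : ∀ i, X i ≅ X' i) :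
    (⟨I, hI, X⟩ : Clo κ C) ≅ ⟨I, hI, X'⟩ where
  hom := diag hI fun i => (e i).hom
  inv := diag hI fun i => (e i).inv
  hom_inv_id := diag_comp_diag hI _ _ fun i => (e i).hom_inv_id
  inv_hom_id := diag_comp_diag hI _ _ fun i => (e i).inv_hom_id

/-- The extension of a natural isomorphism. -/
noncomputable def mapIso {F G : C ⥤ D} [F.Additive] [G.Additive] (α : F ≅ G) :
    (map F : Clo κ C ⥤ Clo κ D) ≅ map G :=
  NatIso.ofComponents (fun Y => diagIso Y.index fun i => α.app (Y.X i)) fun {Y Z} f =>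
    hom_ext fun i j => by
      refine (comp_diag_apply Z.index _ _ i j).trans
        (Eq.trans ?_ (diag_comp_apply Y.index _ _ i j).symm)
      exact α.hom.naturality (f.1 i j)

/-- Contractibility of the image of a complex only depends on the functor up to isomorphism. -/
noncomputable def contractionOfIso {F G : C ⥤ D} [F.Additive] [G.Additive] (α : F ≅ G)
    {K : CochainComplex (Clo κ C) ℤ}
    (c : Contraction (((map F).mapHomologicalComplex _).obj K)) :
    Contraction (((map G).mapHomologicalComplex _).obj K) :=
  c.ofIso ((NatIso.mapHomologicalComplex (mapIso α) _).app K)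

/-! ## Block diagonal matrices -/

/-- The part of a formal sum or product with indices given by a map. -/
abbrev restr (P : Clo κ C) {J : Type} (hJ : κ.Index J) (σ : J → P.ι) : Clo κ C :=
  ⟨J, hJ, fun j => P.X (σ j)⟩

section Block

variable {I J J' J'' : Type} {hJ : κ.Index J} {hJ' : κ.Index J'} {hJ'' : κ.Index J''}
  {P P' P'' : Clo κ C} (σ : I × J ≃ P.ι) (σ' : I × J' ≃ P'.ι) (σ'' : I × J'' ≃ P''.ι)

/-- The matrix is block diagonal with the given blocks. -/
def IsBlock (f : ∀ x, restr P hJ (fun j => σ (x, j)) ⟶ restr P' hJ' fun j => σ' (x, j))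
    (g : P ⟶ P') : Prop :=
  (∀ x j j', g.1 (σ (x, j)) (σ' (x, j')) = (f x).1 j j') ∧
    ∀ x x' j j', x ≠ x' → g.1 (σ (x, j)) (σ' (x', j')) = 0

/-- Every row and every column of a block diagonal matrix meets a single block, so the finiteness
condition is inherited from the blocks however many of them there are. This is why contractions of
countably many summands can be assembled both in sums and in products. -/
theorem exists_isBlock
    (f : ∀ x, restr P hJ (fun j => σ (x, j)) ⟶ restr P' hJ' fun j => σ' (x, j)) :
    ∃ g, IsBlock σ σ' f g := by
  -- An index of `P` has the form `σ (x, j)` only up to a propositional equality, whence the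
  -- heterogeneous equality. The second clause records where nonzero entries come from and gives the
  -- support condition.
  have h : ∀ s s', ∃ φ : P.X s ⟶ P'.X s',
      (∀ x j j', s = σ (x, j) → s' = σ' (x, j') → HEq φ ((f x).1 j j')) ∧
      (φ ≠ 0 → ∃ x j j', s = σ (x, j) ∧ s' = σ' (x, j') ∧ (f x).1 j j' ≠ 0) := by
    intro s s'
    by_cases h : ∃ x j j', s = σ (x, j) ∧ s' = σ' (x, j')
    · obtain ⟨x, j, j', rfl, rfl⟩ := h
      refine ⟨(f x).1 j j', fun y l l' h1 h2 => ?_, fun h => ⟨x, j, j', rfl, rfl, h⟩⟩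
      have h1 := σ.injective h1
      have h2 := σ'.injective h2
      simp only [Prod.mk.injEq] at h1 h2
      obtain ⟨rfl, rfl⟩ := h1
      obtain ⟨-, rfl⟩ := h2
      rfl
    · exact ⟨0, fun x j j' h1 h2 => absurd ⟨x, j, j', h1, h2⟩ h, fun h => absurd rfl h⟩
  choose φ h1 h2 using h
  refine ⟨⟨φ, ?_⟩, fun x j j' => eq_of_heq (h1 _ _ x j j' rfl rfl), fun x x' j j' hx => ?_⟩
  · cases κ
    · trivial
    · intro s
      obtain ⟨⟨x, j⟩, rfl⟩ := σ.surjective s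
      refine (((f x).2 j).image fun j' => σ' (x, j')).subset fun s' h => ?_
      obtain ⟨y, l, l', e, rfl, h⟩ := h2 _ _ h
      have e := σ.injective e
      simp only [Prod.mk.injEq] at e
      obtain ⟨rfl, rfl⟩ := e
      exact ⟨l', h, rfl⟩
    · intro s'
      obtain ⟨⟨x, j'⟩, rfl⟩ := σ'.surjective s'
      refine (((f x).2 j').image fun j => σ (x, j)).subset fun s h => ?_
      obtain ⟨y, l, l', rfl, e, h⟩ := h2 _ _ h
      have e := σ'.injective e
      simp only [Prod.mk.injEq] at e
      obtain ⟨rfl, rfl⟩ := e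
      exact ⟨l, h, rfl⟩
  · by_contra h
    obtain ⟨y, l, l', e, e', -⟩ := h2 _ _ h
    have e := σ.injective e
    have e' := σ'.injective e'
    simp only [Prod.mk.injEq] at e e'
    exact hx (e.1.trans e'.1.symm)

variable {σ σ' σ''}

theorem IsBlock.comp {f : ∀ x, restr P hJ (fun j => σ (x, j)) ⟶ restr P' hJ' fun j => σ' (x, j)}
    {f' : ∀ x, restr P' hJ' (fun j => σ' (x, j)) ⟶ restr P'' hJ'' fun j => σ'' (x, j)}
    {g : P ⟶ P'} {g' : P' ⟶ P''} (h : IsBlock σ σ' f g) (h' : IsBlock σ' σ'' f' g') :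
    IsBlock σ σ'' (fun x => f x ≫ f' x) (g ≫ g') := by
  refine ⟨fun x j j'' => ?_, fun x x'' j j'' hx => ?_⟩
  · change _ = ∑ᶠ j', (f x).1 j j' ≫ (f' x).1 j' j''
    rw [comp_apply]
    have e : ∀ j', (f x).1 j j' ≫ (f' x).1 j' j'' =
        g.1 (σ (x, j)) (σ' (x, j')) ≫ g'.1 (σ' (x, j')) (σ'' (x, j'')) := fun j' => by
      rw [h.1, h'.1]
    refine Eq.trans ?_ (finsum_congr e).symm
    have inj : Function.Injective fun j' : J' => σ' (x, j') :=
      fun l l' e => congrArg Prod.snd (σ'.injective e)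
    refine Eq.trans ?_ (finsum_mem_range (f := fun s => g.1 (σ (x, j)) s ≫ g'.1 s (σ'' (x, j'')))
      inj)
    rw [← finsum_mem_univ]
    refine finsum_mem_inter_support_eq' _ _ _ fun s hs => ⟨fun _ => ?_, fun _ => Set.mem_univ s⟩
    obtain ⟨⟨y, l⟩, rfl⟩ := σ'.surjective s
    by_cases hy : x = y
    · exact ⟨l, by rw [hy]⟩
    · refine absurd ?_ hs
      change g.1 _ _ ≫ g'.1 _ _ = 0
      rw [h.2 x y j l hy, Limits.zero_comp]
  · rw [comp_apply]
    refine finsum_eq_zero_of_forall_eq_zero fun s => ?_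
    obtain ⟨⟨y, l⟩, rfl⟩ := σ'.surjective s
    by_cases hy : x = y
    · rw [h'.2 y x'' l j'' (hy ▸ hx), Limits.comp_zero]
    · rw [h.2 x y j l hy, Limits.zero_comp]

theorem IsBlock.add {f f' : ∀ x, restr P hJ (fun j => σ (x, j)) ⟶ restr P' hJ' fun j => σ' (x, j)}
    {g g' : P ⟶ P'} (h : IsBlock σ σ' f g) (h' : IsBlock σ σ' f' g') :
    IsBlock σ σ' (fun x => f x + f' x) (g + g') :=
  ⟨fun x j j' => congrArg₂ (· + ·) (h.1 x j j') (h'.1 x j j'),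
    fun x x' j j' hx => by rw [add_apply, h.2 x x' j j' hx, h'.2 x x' j j' hx, add_zero]⟩

theorem IsBlock.zero : IsBlock (hJ := hJ) (hJ' := hJ') σ σ' (fun _ => 0) 0 :=
  ⟨fun _ _ _ => rfl, fun _ _ _ _ _ => rfl⟩

theorem IsBlock.id : IsBlock (hJ := hJ) (hJ' := hJ) σ σ (fun _ => 𝟙 _) (𝟙 P) := by
  refine ⟨fun x j j' => ?_, fun x x' j j' hx => ?_⟩
  · by_cases h : j = j'
    · subst h
      rw [id_apply_self]
      exact (id_apply_self (restr P hJ fun j => σ (x, j)) j).symm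
    · rw [id_apply_ne P fun e => h (congrArg Prod.snd (σ.injective e))]
      exact (id_apply_ne (restr P hJ fun j => σ (x, j)) h).symm
  · exact id_apply_ne P fun e => hx (congrArg Prod.fst (σ.injective e))

/-- Identities between block diagonal matrices, such as the contraction equation, may therefore be
checked on the blocks. -/
theorem IsBlock.unique
    {f : ∀ x, restr P hJ (fun j => σ (x, j)) ⟶ restr P' hJ' fun j => σ' (x, j)}
    {g g' : P ⟶ P'} (h : IsBlock σ σ' f g) (h' : IsBlock σ σ' f g') : g = g' :=
  hom_ext fun s s' => by
    obtain ⟨⟨x, j⟩, rfl⟩ := σ.surjective s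
    obtain ⟨⟨x', j'⟩, rfl⟩ := σ'.surjective s'
    by_cases hx : x = x'
    · subst hx
      rw [h.1, h'.1]
    · rw [h.2 x x' j j' hx, h'.2 x x' j j' hx]

/-- Contractions of all diagonal blocks give a contraction. -/
theorem nonempty_contraction_of_isBlock (K : CochainComplex (Clo κ C) ℤ) {J : ℤ → Type}
    {hJ : ∀ q, κ.Index (J q)} (σ : ∀ q, I × J q ≃ (K.X q).ι)
    (d h : ∀ q q' x, restr (K.X q) (hJ q) (fun j => σ q (x, j)) ⟶
      restr (K.X q') (hJ q') fun j => σ q' (x, j))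
    (hd : ∀ q q', IsBlock (σ q) (σ q') (d q q') (K.d q q'))
    (shape : ∀ q q' x, q' + 1 ≠ q → h q q' x = 0)
    (eq : ∀ q x, d q (q + 1) x ≫ h (q + 1) q x + h q (q - 1) x ≫ d (q - 1) q x = 𝟙 _) :
    Nonempty (Contraction K) := by
  choose H hH using fun q q' => exists_isBlock (σ q) (σ q') (h q q')
  refine ⟨⟨H, fun q q' e => ?_, fun q => ?_⟩⟩
  · have e : h q q' = fun _ => 0 := funext fun x => shape q q' x e
    exact (hH q q').unique (e ▸ .zero)
  · refine (((hd q (q + 1)).comp (hH _ _)).add ((hH q (q - 1)).comp (hd _ _))).unique ?_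
    rw [show (fun x => d q (q + 1) x ≫ h (q + 1) q x + h q (q - 1) x ≫ d (q - 1) q x) =
      fun _ => 𝟙 _ from funext fun x => eq q x]
    exact .id

end Block

/-! ## Tensor products with a single object -/

section Tensor

variable (F : C ⥤ D ⥤ E) [F.Additive] [∀ x, (F.obj x).Additive]

theorem tens_id_left {x : C} {y y' : D} (v : y ⟶ y') :
    tens F (𝟙 x) v = (F.obj x).map v := by
  change (F.map (𝟙 x)).app y ≫ (F.obj x).map v = _
  rw [F.map_id, NatTrans.id_app, Category.id_comp]

theorem tens_id_right {x x' : C} {y : D} (u : x ⟶ x') :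
    tens F u (𝟙 y) = (F.flip.obj y).map u := by
  change (F.map u).app y ≫ (F.obj x').map (𝟙 y) = (F.map u).app y
  rw [(F.obj x').map_id, Category.comp_id]

theorem tensorHom_id (Y : Clo κ C) (Z : Clo κ D) :
    tensorHom F (𝟙 Y) (𝟙 Z) = 𝟙 (tensorObj F Y Z) :=
  hom_ext fun p p' => by
    change tens F ((𝟙 Y : Y ⟶ Y).1 p.1 p'.1) ((𝟙 Z : Z ⟶ Z).1 p.2 p'.2) = _
    by_cases h1 : p.1 = p'.1
    · by_cases h2 : p.2 = p'.2
      · obtain rfl : p = p' := Prod.ext h1 h2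
        rw [id_apply_self, id_apply_self, id_apply_self, tens_id_left]
        exact (F.obj (Y.X p.1)).map_id _
      · rw [id_apply_ne Z h2, map_zero]
        exact (id_apply_ne (tensorObj F Y Z) fun h => h2 (congrArg Prod.snd h)).symm
    · rw [id_apply_ne Y h1, map_zero, AddMonoidHom.zero_apply]
      exact (id_apply_ne (tensorObj F Y Z) fun h => h1 (congrArg Prod.fst h)).symm

/-- Tensor products with a fixed first factor. -/
noncomputable def tensorLeft (Y : Clo κ C) : Clo κ D ⥤ Clo κ E where
  obj Z := tensorObj F Y Z
  map g := tensorHom F (𝟙 Y) g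
  map_id Z := tensorHom_id F Y Z
  map_comp g g' := by rw [← tensorHom_comp, Category.comp_id]

instance (Y : Clo κ C) : (tensorLeft F Y).Additive where
  map_add := map_add (tensorHom F (𝟙 Y)) _ _

/-- Tensor products with a fixed second factor. -/
noncomputable def tensorRight (Z : Clo κ D) : Clo κ C ⥤ Clo κ E where
  obj Y := tensorObj F Y Z
  map f := tensorHom F f (𝟙 Z)
  map_id Y := tensorHom_id F Y Z
  map_comp g g' := by rw [← tensorHom_comp, Category.comp_id]

instance (Z : Clo κ D) : (tensorRight F Z).Additive where
  map_add {_ _ f f'} := by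
    change tensorHom F (f + f') (𝟙 Z) = tensorHom F f (𝟙 Z) + tensorHom F f' (𝟙 Z)
    rw [map_add, AddMonoidHom.add_apply]

/-- A tensor product is contractible if the tensor products with all summands of the first factor
are contractible. -/
theorem nonempty_contraction_tensorLeft (Y : Clo κ C) (B : CochainComplex (Clo κ D) ℤ)
    (c : ∀ x, Nonempty (Contraction (((map (F.obj (Y.X x))).mapHomologicalComplex _).obj B))) :
    Nonempty (Contraction (((tensorLeft F Y).mapHomologicalComplex _).obj B)) := by
  -- The differential is `1 ⊗ d` and the matrix of `1` is diagonal, so the complex splits into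
  -- blocks indexed by the summands of `Y`.
  refine nonempty_contraction_of_isBlock (((tensorLeft F Y).mapHomologicalComplex _).obj B)
    (hJ := fun q => (B.X q).index)
    (fun q => (Equiv.refl (Y.ι × (B.X q).ι)))
    (fun q q' x => (map (F.obj (Y.X x))).map (B.d q q')) (fun q q' x => (c x).some.h q q')
    (fun q q' => ⟨fun x j j' => ?_, fun x x' j j' h => ?_⟩)
    (fun q q' x h => (c x).some.shape q q' h) fun q x => (c x).some.eq q
  · change tens F ((𝟙 Y : Y ⟶ Y).1 x x) ((B.d q q').1 j j') = (F.obj (Y.X x)).map ((B.d q q').1 j j')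
    rw [id_apply_self, tens_id_left]
  · change tens F ((𝟙 Y : Y ⟶ Y).1 x x') ((B.d q q').1 j j') = 0
    rw [id_apply_ne Y h, map_zero, AddMonoidHom.zero_apply]

/-- A tensor product is contractible if the tensor products with all summands of the second factor
are contractible. -/
theorem nonempty_contraction_tensorRight [∀ y, (F.flip.obj y).Additive] (Z : Clo κ D)
    (A : CochainComplex (Clo κ C) ℤ)
    (c : ∀ z, Nonempty
      (Contraction (((map (F.flip.obj (Z.X z))).mapHomologicalComplex _).obj A))) :
    Nonempty (Contraction (((tensorRight F Z).mapHomologicalComplex _).obj A)) := by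
  refine nonempty_contraction_of_isBlock (((tensorRight F Z).mapHomologicalComplex _).obj A)
    (hJ := fun q => (A.X q).index)
    (fun q => (Equiv.prodComm Z.ι (A.X q).ι))
    (fun q q' x => (map (F.flip.obj (Z.X x))).map (A.d q q')) (fun q q' x => (c x).some.h q q')
    (fun q q' => ⟨fun x j j' => ?_, fun x x' j j' h => ?_⟩)
    (fun q q' x h => (c x).some.shape q q' h) fun q x => (c x).some.eq q
  · change tens F ((A.d q q').1 j j') ((𝟙 Z : Z ⟶ Z).1 x x) =
      (F.flip.obj (Z.X x)).map ((A.d q q').1 j j')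
    rw [id_apply_self, tens_id_right]
  · change tens F ((A.d q q').1 j j') ((𝟙 Z : Z ⟶ Z).1 x x') = 0
    rw [id_apply_ne Z h, map_zero]

end Tensor

end Clo

/-! ## Total complexes -/

section Total

variable {C D E : Type*} [Category C] [Preadditive C] [Category D] [Preadditive D] [Category E]
  [Preadditive E] {κ : Kind}

/-- In the total complex, a block of `dh` or of `hd` has a single possible middle index, because `h`
has at most one nonzero block in each block row and column. -/
theorem Clo.sigmaHom_comp_apply [κ.Infinitary] {I J K : Type} [Countable I] [Countable J]
    [Countable K] {Y : I → Clo κ C} {Z : J → Clo κ C} {W : K → Clo κ C}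
    (f : ∀ i j, Y i ⟶ Z j) (hf : κ.Supp fun i j => f i j ≠ 0) (g : ∀ j k, Z j ⟶ W k)
    (hg : κ.Supp fun j k => g j k ≠ 0) (i : I) (k : K) (j : J)
    (h : ∀ j', j' ≠ j → f i j' = 0 ∨ g j' k = 0) (a : (Y i).ι) (b : (W k).ι) :
    (sigmaHom f hf ≫ sigmaHom g hg).1 ⟨i, a⟩ ⟨k, b⟩ = (f i j ≫ g j k).1 a b := by
  change ∑ᶠ y : Σ j, (Z j).ι, (f i y.1).1 a y.2 ≫ (g y.1 k).1 y.2 b =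
    ∑ᶠ y : (Z j).ι, (f i j).1 a y ≫ (g j k).1 y b
  refine Eq.trans ?_ (finsum_mem_range (f := fun y : Σ j, (Z j).ι =>
    (f i y.1).1 a y.2 ≫ (g y.1 k).1 y.2 b) (sigma_mk_injective (i := j)))
  rw [← finsum_mem_univ]
  refine finsum_mem_inter_support_eq' _ _ _ fun y hy => ⟨fun _ => ?_, fun _ => Set.mem_univ y⟩
  obtain ⟨j', y⟩ := y
  by_cases hj : j' = j
  · subst hj
    exact ⟨y, rfl⟩
  · refine absurd ?_ hy
    change (f i j').1 a y ≫ (g j' k).1 y b = 0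
    rcases h j' hj with h | h
    · rw [h, zero_apply, Limits.zero_comp]
    · rw [h, zero_apply, Limits.comp_zero]

theorem Clo.sigma_id_apply [κ.Infinitary] {I : Type} [Countable I] (Y : I → Clo κ C) (i : I)
    (a b : (Y i).ι) : (𝟙 (sigma Y) : sigma Y ⟶ sigma Y).1 ⟨i, a⟩ ⟨i, b⟩ = (𝟙 (Y i) :).1 a b := by
  by_cases h : a = b
  · subst h
    exact (id_apply_self (sigma Y) _).trans (id_apply_self (Y i) a).symm
  · refine (id_apply_ne (sigma Y) fun e => h ?_).trans (id_apply_ne (Y i) h).symm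
    exact eq_of_heq (Sigma.mk.inj e).2

variable (F : C ⥤ D ⥤ E) [F.Additive] [∀ x, (F.obj x).Additive]
  (A : CochainComplex (Clo κ C) ℤ) (B : CochainComplex (Clo κ D) ℤ)

theorem Clo.isZero_tensorObj_left {Y : Clo κ C} (h : Limits.IsZero Y) (Z : Clo κ D) :
    Limits.IsZero (tensorObj F Y Z) := by
  rw [Limits.IsZero.iff_id_eq_zero, ← tensorHom_id, h.eq_of_src (𝟙 Y) 0, map_zero,
    AddMonoidHom.zero_apply]

theorem Clo.isZero_tensorObj_right (Y : Clo κ C) {Z : Clo κ D} (h : Limits.IsZero Z) :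
    Limits.IsZero (tensorObj F Y Z) := by
  rw [Limits.IsZero.iff_id_eq_zero, ← tensorHom_id, h.eq_of_src (𝟙 Z) 0, map_zero]

/-- For removing `idm` between chain groups whose degrees are equal but not definitionally so, such
as `k - i` and `k + 1 - (i + 1)`. The same holds for `tensorHom_idm_idm`. -/
theorem tensorHom_idm_comp {Y Y' : Clo κ C} (f : Y ⟶ Y') {q q' : ℤ} (e : q = q')
    (h : ∀ q, Clo.tensorObj F Y' (B.X q) ⟶ Clo.tensorObj F Y (B.X q)) :
    Clo.tensorHom F f (idm B q q') ≫ h q' ≫ Clo.tensorHom F (𝟙 Y) (idm B q' q) =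
      Clo.tensorHom F f (𝟙 (B.X q)) ≫ h q := by
  subst e
  rw [idm_self, Clo.tensorHom_id, Category.comp_id]

theorem tensorHom_idm_idm {Y Y' : Clo κ C} (f : Y ⟶ Y') {q q' : ℤ} (e : q = q') :
    Clo.tensorHom F (𝟙 Y) (idm B q q') ≫ Clo.tensorHom F f (idm B q' q) =
      Clo.tensorHom F f (𝟙 (B.X q)) := by
  subst e
  rw [idm_self, ← Clo.tensorHom_comp, Category.id_comp, Category.id_comp]

variable [κ.Infinitary]

/-- A block homotopy on the total complex, with blocks that do not change the first degree. -/
theorem exists_total_homotopy_left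
    (c : ∀ i, Contraction (((Clo.tensorLeft F (A.X i)).mapHomologicalComplex _).obj B)) :
    ∃ h : ∀ k k', (total F A B).X k ⟶ (total F A B).X k',
      (∀ k k', k' + 1 ≠ k → h k k' = 0) ∧ ∀ k x y,
        ((total F A B).d k (k + 1) ≫ h (k + 1) k + h k (k - 1) ≫ (total F A B).d (k - 1) k -
          𝟙 _).1 x y ≠ 0 → y.1 = x.1 + 1 := by
  let g : ∀ i q q', Clo.tensorObj F (A.X i) (B.X q) ⟶ Clo.tensorObj F (A.X i) (B.X q') :=
    fun i => (c i).h
  have g_shape : ∀ i q q', q' + 1 ≠ q → g i q q' = 0 := fun i => (c i).shape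
  have g_eq : ∀ i q r s, q + 1 = r → s + 1 = q →
      Clo.tensorHom F (𝟙 (A.X i)) (B.d q r) ≫ g i r q +
        g i q s ≫ Clo.tensorHom F (𝟙 (A.X i)) (B.d s q) = 𝟙 _ := fun i q r s => (c i).eq_of
  -- The sign cancels the sign `(-1) ^ i` of `1 ⊗ d` in the total differential. The factor `idm A i
  -- i'` makes the off-diagonal blocks zero and lets the diagonal ones have the required type.
  let b : ∀ k k' i i' : ℤ, Clo.tensorObj F (A.X i) (B.X (k - i)) ⟶
      Clo.tensorObj F (A.X i') (B.X (k' - i')) := fun k k' i i' =>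
    i.negOnePow • (g i (k - i) (k' - i') ≫ Clo.tensorHom F (idm A i i') (𝟙 (B.X (k' - i'))))
  have b_ne : ∀ k k' i i', i ≠ i' → b k k' i i' = 0 := fun k k' i i' h => by
    change _ • (_ ≫ Clo.tensorHom F (idm A i i') _) = 0
    rw [idm_ne A h, map_zero, AddMonoidHom.zero_apply, Limits.comp_zero, smul_zero]
  have b_self : ∀ k k' i, b k k' i i = i.negOnePow • g i (k - i) (k' - i) := fun k k' i => by
    change _ • (_ ≫ Clo.tensorHom F (idm A i i) _) = _
    rw [idm_self, Clo.tensorHom_id, Category.comp_id]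
  have b_supp : ∀ k k', κ.Supp fun i i' => b k k' i i' ≠ 0 := fun k k' =>
    Kind.Supp.eq.mono fun i i' h => by
      by_contra h'
      exact h (b_ne k k' i i' h')
  have t_self : ∀ k k' i, totalBlock F A B k k' i i =
      i.negOnePow • Clo.tensorHom F (𝟙 (A.X i)) (B.d (k - i) (k' - i)) := fun k k' i => by
    rw [totalBlock, d_ne A (by omega), map_zero, AddMonoidHom.zero_apply, zero_add, idm_self]
  refine ⟨fun k k' => Clo.sigmaHom (b k k') (b_supp k k'), fun k k' h => ?_, ?_⟩
  · refine Clo.sigmaHom_eq_zero _ _ fun i i' => ?_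
    by_cases hi : i = i'
    · subst hi
      rw [b_self, g_shape _ _ _ (by omega), smul_zero]
    · exact b_ne k k' i i' hi
  · rintro k ⟨i, x⟩ ⟨i', y⟩ h
    by_contra hi
    change ¬ i' = i + 1 at hi
    -- Since `h` preserves the first degree, the middle index is `i'` in `dh` and `i` in `hd`. The
    -- diagonal blocks give the contraction equation of row `i`; off the diagonal only `d ⊗ 1`
    -- contributes, and it raises the first degree by one.
    refine h (sub_eq_zero.2 ((Clo.add_apply _ _ _ _).trans (Eq.trans (congrArg₂ (· + ·)
      (Clo.sigmaHom_comp_apply (totalBlock F A B k (k + 1)) (totalBlock_supp F A B _ _)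
        (b (k + 1) k) (b_supp _ _) i i' i'
        (fun j hj => .inr (b_ne _ _ _ _ hj)) x y)
      (Clo.sigmaHom_comp_apply (b k (k - 1)) (b_supp _ _)
        (totalBlock F A B (k - 1) k) (totalBlock_supp F A B _ _) i i' i
        (fun j hj => .inl (b_ne _ _ _ _ (Ne.symm hj))) x y))
      ?_)))
    change (totalBlock F A B k (k + 1) i i' ≫ b (k + 1) k i' i').1 x y +
      (b k (k - 1) i i ≫ totalBlock F A B (k - 1) k i i').1 x y = _
    by_cases hii : i = i'
    · subst hii
      refine Eq.trans ?_ (Clo.sigma_id_apply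
        (fun i => Clo.tensorObj F (A.X i) (B.X (k - i))) i x y).symm
      rw [b_self, b_self, t_self, t_self, Linear.units_smul_comp, Linear.comp_units_smul,
        Linear.units_smul_comp, Linear.comp_units_smul, smul_smul, smul_smul, Int.units_mul_self,
        one_smul, one_smul]
      exact congrArg (fun u => u.1 x y) (g_eq i (k - i) (k + 1 - i) (k - 1 - i) (by omega)
        (by omega))
    · refine Eq.trans ?_ (Clo.id_apply_ne ((total F A B).X k) (i := ⟨i, x⟩)
        (j := ⟨i', y⟩) fun e => hii (congrArg Sigma.fst e)).symm
      rw [totalBlock_zero F A B (fun e => absurd e.symm hi) (fun e => absurd e hii),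
        totalBlock_zero F A B (fun e => absurd e.symm hi) (fun e => absurd e hii),
        Limits.zero_comp, Limits.comp_zero]
      exact add_zero _

/-- A block homotopy on the total complex, with blocks that do not change the second degree. -/
theorem exists_total_homotopy_right
    (c : ∀ q, Contraction (((Clo.tensorRight F (B.X q)).mapHomologicalComplex _).obj A)) :
    ∃ h : ∀ k k', (total F A B).X k ⟶ (total F A B).X k',
      (∀ k k', k' + 1 ≠ k → h k k' = 0) ∧ ∀ k x y,
        ((total F A B).d k (k + 1) ≫ h (k + 1) k + h k (k - 1) ≫ (total F A B).d (k - 1) k -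
          𝟙 _).1 x y ≠ 0 → y.1 + 1 = x.1 := by
  let g : ∀ q p p', Clo.tensorObj F (A.X p) (B.X q) ⟶ Clo.tensorObj F (A.X p') (B.X q) :=
    fun q => (c q).h
  have g_shape : ∀ q p p', p' + 1 ≠ p → g q p p' = 0 := fun q => (c q).shape
  have g_eq : ∀ q p, Clo.tensorHom F (A.d p (p + 1)) (𝟙 (B.X q)) ≫ g q (p + 1) p +
      g q p (p - 1) ≫ Clo.tensorHom F (A.d (p - 1) p) (𝟙 (B.X q)) = 𝟙 _ := fun q => (c q).eq
  -- No sign is needed, as `d ⊗ 1` carries none. Here `idm B` identifies the second degrees `k - i`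
  -- and `k' - i'`, which agree when both `i` and `k` drop by one.
  let b : ∀ k k' i i' : ℤ, Clo.tensorObj F (A.X i) (B.X (k - i)) ⟶
      Clo.tensorObj F (A.X i') (B.X (k' - i')) := fun k k' i i' =>
    g (k - i) i i' ≫ Clo.tensorHom F (𝟙 (A.X i')) (idm B (k - i) (k' - i'))
  have b_ne : ∀ k k' i i', i' + 1 ≠ i → b k k' i i' = 0 := fun k k' i i' h => by
    change g (k - i) i i' ≫ _ = 0
    rw [g_shape _ i i' h, Limits.zero_comp]
  have b_supp : ∀ k k', κ.Supp fun i i' => b k k' i i' ≠ 0 := fun k k' => by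
    refine Kind.Supp.of_finite (fun i => ?_) fun i' => ?_
    · refine (Set.finite_singleton (i - 1)).subset fun i' h => ?_
      by_contra h'
      exact h (b_ne _ _ _ _ fun e => h' (Set.mem_singleton_iff.2 (by omega)))
    · refine (Set.finite_singleton (i' + 1)).subset fun i h => ?_
      by_contra h'
      exact h (b_ne _ _ _ _ fun e => h' (Set.mem_singleton_iff.2 (by omega)))
  have t_succ : ∀ k k' i i', i + 1 = i' → totalBlock F A B k k' i i' =
      Clo.tensorHom F (A.d i i') (idm B (k - i) (k' - i')) := fun k k' i i' h => by
    rw [totalBlock, idm_ne A (by omega : i ≠ i'), map_zero, AddMonoidHom.zero_apply, smul_zero,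
      add_zero]
  refine ⟨fun k k' => Clo.sigmaHom (b k k') (b_supp k k'), fun k k' h => ?_, ?_⟩
  · refine Clo.sigmaHom_eq_zero _ _ fun i i' => ?_
    by_cases hi : i' + 1 = i
    · change g (k - i) i i' ≫ Clo.tensorHom F (𝟙 (A.X i')) (idm B (k - i) (k' - i')) = 0
      rw [idm_ne B (by omega), map_zero, Limits.comp_zero]
    · exact b_ne k k' i i' hi
  · rintro k ⟨i, x⟩ ⟨i', y⟩ h
    by_contra hi
    change i' + 1 ≠ i at hi
    -- Since `h` lowers the first degree by one, the middle index is `i' + 1` in `dh` and `i - 1` in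
    -- `hd`. The terms with `1 ⊗ d` do not restore that degree and form the error, which lowers it
    -- by one.
    refine h (sub_eq_zero.2 ((Clo.add_apply _ _ _ _).trans (Eq.trans (congrArg₂ (· + ·)
      (Clo.sigmaHom_comp_apply (totalBlock F A B k (k + 1)) (totalBlock_supp F A B _ _)
        (b (k + 1) k) (b_supp _ _) i i' (i' + 1)
        (fun j hj => .inr (b_ne _ _ _ _ (Ne.symm hj))) x y)
      (Clo.sigmaHom_comp_apply (b k (k - 1)) (b_supp _ _)
        (totalBlock F A B (k - 1) k) (totalBlock_supp F A B _ _) i i' (i - 1)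
        (fun j hj => .inl (b_ne _ _ _ _ fun e => hj (by omega))) x y)) ?_)))
    change (totalBlock F A B k (k + 1) i (i' + 1) ≫ b (k + 1) k (i' + 1) i').1 x y +
      (b k (k - 1) i (i - 1) ≫ totalBlock F A B (k - 1) k (i - 1) i').1 x y = _
    by_cases hii : i = i'
    · subst hii
      refine Eq.trans ?_ (Clo.sigma_id_apply
        (fun i => Clo.tensorObj F (A.X i) (B.X (k - i))) i x y).symm
      rw [t_succ _ _ _ _ rfl, t_succ _ _ _ _ (sub_add_cancel i 1)]
      refine Eq.trans ?_ (congrArg (fun u => u.1 x y) (g_eq (k - i) i))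
      suffices H : Clo.tensorHom F (A.d i (i + 1)) (idm B (k - i) (k + 1 - (i + 1))) ≫
          b (k + 1) k (i + 1) i + b k (k - 1) i (i - 1) ≫
          Clo.tensorHom F (A.d (i - 1) i) (idm B (k - 1 - (i - 1)) (k - i)) = _ from
        congrArg (fun u => u.1 x y) H
      refine congrArg₂ (· + ·) ?_ ?_
      · exact tensorHom_idm_comp F B (A.d i (i + 1)) (q := k - i) (q' := k + 1 - (i + 1)) (by omega)
          fun q => g q (i + 1) i
      · refine (Category.assoc _ _ _).trans (congrArg (g (k - i) i (i - 1) ≫ ·) ?_)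
        exact tensorHom_idm_idm F B (A.d (i - 1) i) (q := k - i) (q' := k - 1 - (i - 1)) (by omega)
    · refine Eq.trans ?_ (Clo.id_apply_ne ((total F A B).X k) (i := ⟨i, x⟩)
        (j := ⟨i', y⟩) fun e => hii (congrArg Sigma.fst e)).symm
      rw [totalBlock_zero F A B (fun e => absurd (by omega) hii) (fun e => absurd e.symm hi),
        totalBlock_zero F A B (fun e => absurd (by omega) hii) (fun e => absurd (by omega) hi),
        Limits.zero_comp, Limits.comp_zero]
      exact add_zero _

end Total

/-! ### Contractibility of bounded total complexes -/

section Bounded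

variable {C D E : Type*} [Category C] [Preadditive C] [Category D] [Preadditive D] [Category E]
  [Preadditive E] (F : C ⥤ D ⥤ E) [F.Additive] [∀ x, (F.obj x).Additive]

/-- Converts vanishing of chain groups into bounds on the degrees at the source of a nonzero matrix
entry, so that weights with values in `ℕ` can be used. -/
theorem isZero_of_total_apply_ne {κ : Kind} [κ.Infinitary] {A : CochainComplex (Clo κ C) ℤ}
    {B : CochainComplex (Clo κ D) ℤ} {k : ℤ} {u : (total F A B).X k ⟶ (total F A B).X k}
    {x y : ((total F A B).X k).ι} (h : u.1 x y ≠ 0) :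
    ¬ Limits.IsZero (A.X x.1) ∧ ¬ Limits.IsZero (B.X (k - x.1)) := by
  have key : ¬ Limits.IsZero (Clo.tensorObj F (A.X x.1) (B.X (k - x.1))) := fun h' =>
    h (Clo.apply_eq_zero_of_isZero (Z := (total F A B).X k) h' (fun a b => u.1 ⟨x.1, a⟩ b) x.2 y)
  exact ⟨fun h' => key (Clo.isZero_tensorObj_left F h' _),
    fun h' => key (Clo.isZero_tensorObj_right F _ h')⟩

/-- The total complex formed with sums is contractible if it has contractible rows and is bounded
below in the direction of the rows. -/
theorem nonempty_contraction_total_sum (A : CochainComplex (Clo .sum C) ℤ)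
    (B : CochainComplex (Clo .sum D) ℤ) (hB : ∀ q < 0, Limits.IsZero (B.X q))
    (c : ∀ i, Nonempty
      (Contraction (((Clo.tensorLeft F (A.X i)).mapHomologicalComplex _).obj B))) :
    Nonempty (Contraction (total F A B)) := by
  obtain ⟨h, h1, h2⟩ := exists_total_homotopy_left F A B fun i => (c i).some
  refine Contraction.nonempty_of_isIso h h1 fun k =>
    -- The weight is the second degree plus one, and the error lowers it. The added one makes the
    -- inequality strict even if the source has second degree 0, so no bound on the target is
    -- needed.
    Clo.isIso_of_lt_sum _ (fun x => (k - x.1 + 1).toNat) fun x y hxy => ?_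
  have e := h2 k x y hxy
  have hx : 0 ≤ k - x.1 := by
    by_contra hx
    exact (isZero_of_total_apply_ne F hxy).2 (hB _ (by omega))
  simp only [e]
  omega

/-- The total complex formed with products is contractible if it has contractible columns and is
bounded above in the direction of the columns, or bounded below in the direction of the rows. -/
theorem nonempty_contraction_total_prod (A : CochainComplex (Clo .prod C) ℤ)
    (B : CochainComplex (Clo .prod D) ℤ)
    (hAB : (∀ p, 0 < p → Limits.IsZero (A.X p)) ∨ ∀ q < 0, Limits.IsZero (B.X q))
    (c : ∀ q, Nonempty
      (Contraction (((Clo.tensorRight F (B.X q)).mapHomologicalComplex _).obj A))) :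
    Nonempty (Contraction (total F A B)) := by
  obtain ⟨h, h1, h2⟩ := exists_total_homotopy_right F A B fun i => (c i).some
  -- The error lowers the first degree and raises the second. Under either bound, paths into a fixed
  -- target have bounded length; the weight is `1 - p` in the first case and `q + 1` in the second.
  rcases hAB with hA | hB
  · refine Contraction.nonempty_of_isIso h h1 fun k =>
      Clo.isIso_of_lt_prod _ (fun x => (1 - x.1).toNat) fun x y hxy => ?_
    have e := h2 k x y hxy
    have hx : x.1 ≤ 0 := by
      by_contra hx
      exact (isZero_of_total_apply_ne F hxy).1 (hA _ (by omega))
    simp only [← e] at hx ⊢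
    omega
  · refine Contraction.nonempty_of_isIso h h1 fun k =>
      Clo.isIso_of_lt_prod _ (fun x => (k - x.1 + 1).toNat) fun x y hxy => ?_
    have e := h2 k x y hxy
    have hx : 0 ≤ k - x.1 := by
      by_contra hx
      exact (isZero_of_total_apply_ne F hxy).2 (hB _ (by omega))
    simp only [← e] at hx ⊢
    omega

end Bounded

/-! ## Turnbacks and projectors -/

theorem map_units_smul_of_additive {C D : Type*} [Category C] [Preadditive C] [Category D]
    [Preadditive D] (G : C ⥤ D) [G.Additive] {x y : C} (r : ℤˣ) (f : x ⟶ y) :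
    G.map (r • f) = r • G.map f := by
  rcases Int.units_eq_one_or r with rfl | rfl
  · rw [one_smul, one_smul]
  · rw [Units.neg_smul, Units.neg_smul, one_smul, one_smul, G.map_neg]

/-- The inclusion of finite sums preserves contractibility of images under functors. -/
noncomputable def Clo.contractionIncl {C D : Type*} [Category C] [Preadditive C] [Category D]
    [Preadditive D] (κ : Kind) (G : C ⥤ D) [G.Additive] {K : CochainComplex (Clo .fin C) ℤ}
    (c : Contraction (((Clo.map G).mapHomologicalComplex _).obj K)) :
    Contraction (((Clo.map G).mapHomologicalComplex _).obj
      (((Clo.incl κ).mapHomologicalComplex _).obj K)) :=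
  c.map (Clo.incl κ)

/-! ### Duals, turnbacks and projectors -/

namespace BN

variable {κ : Kind} {m n k : ℕ}

theorem contractible_iff (A : CochainComplex (BN κ m n) ℤ) :
    Contractible A ↔ Nonempty (Contraction A) :=
  ⟨fun ⟨H⟩ => ⟨.ofHomotopy H⟩, fun ⟨c⟩ => ⟨c.toHomotopy⟩⟩

theorem dualHom_comp {X Y Z : BN κ m n} (f : X ⟶ Y) (g : Y ⟶ Z) :
    dualHom (f ≫ g) = dualHom g ≫ dualHom f :=
  (Clo.dual (Cob.duality m n)).map_comp g.op f.op

theorem dualHom_add {X Y : BN κ m n} (f g : X ⟶ Y) :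
    dualHom (f + g) = dualHom f + dualHom g :=
  (Clo.dual (Cob.duality m n)).map_add (f := f.op) (g := g.op)

theorem dualHom_zero (X Y : BN κ m n) : dualHom (0 : X ⟶ Y) = 0 :=
  (Clo.dual (Cob.duality m n)).map_zero _ _

theorem dualHom_id (X : BN κ m n) : dualHom (𝟙 X) = 𝟙 (dualObj X) :=
  (Clo.dual (Cob.duality m n)).map_id _

/-- The dual of a contractible complex is contractible. -/
noncomputable def contractionDual {A : CochainComplex (BN κ m n) ℤ} (c : Contraction A) :
    Contraction (dual A) where
  h q q' := q.negOnePow • dualHom (c.h (-q') (-q))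
  shape q q' h := by
    rw [c.shape _ _ (by omega), dualHom_zero]
    exact smul_zero (A := dualObj (A.X (-q)) ⟶ dualObj (A.X (-q'))) _
  eq q := by
    -- With the sign `(-1) ^ q` on the homotopy out of degree `q`, both signs in each composite are
    -- equal and cancel. Transposition exchanges the two terms of the contraction equation.
    change ((q + 1).negOnePow • dualHom (A.d (-(q + 1)) (-q))) ≫
        ((q + 1).negOnePow • dualHom (c.h (-q) (-(q + 1)))) +
      (q.negOnePow • dualHom (c.h (-(q - 1)) (-q))) ≫
        ((q - 1 + 1).negOnePow • dualHom (A.d (-q) (-(q - 1)))) = 𝟙 (dualObj (A.X (-q)))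
    rw [sub_add_cancel, Linear.units_smul_comp, Linear.comp_units_smul, Linear.units_smul_comp,
      Linear.comp_units_smul, smul_smul, smul_smul, Int.units_mul_self, Int.units_mul_self,
      one_smul, one_smul, ← dualHom_comp, ← dualHom_comp, ← dualHom_add, add_comm,
      c.eq_of (by omega) (by omega), dualHom_id]

theorem dual_d_apply (A : CochainComplex (BN κ m n) ℤ) (q q' : ℤ) (i : (A.X (-q)).ι)
    (j : (A.X (-q')).ι) : ((dual A).d q q').1 i j =
      (q + 1).negOnePow • (Cob.duality m n).map ((A.d (-q') (-q)).1 j i).op :=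
  Clo.smul_apply (q + 1).negOnePow (dualHom (A.d (-q') (-q))) i j

theorem above_dual_d_apply (A : CochainComplex (BN κ m k) ℤ) (b : Diag n k) (q q' : ℤ)
    (i : (A.X (-q)).ι) (j : (A.X (-q')).ι) : ((above b (dual A)).d q q').1 i j =
      (q + 1).negOnePow • Cob.glueHom (𝟙 (Cob.ofDiag b))
        ((Cob.duality m k).map ((A.d (-q') (-q)).1 j i).op) :=
  (congrArg ((Cob.gluing n k m).obj (Cob.ofDiag b)).map (dual_d_apply A q q' i j)).trans
    (map_units_smul_of_additive _ _ _)

/-- The dual of a planar composition with a diagram, in a single degree. -/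
noncomputable def dualBelowXIso (A : CochainComplex (BN κ m k) ℤ) (b : Diag k n) (q : ℤ) :
    (dual (below A b)).X q ≅ (above b.reflect (dual A)).X q :=
  Clo.diagIso (A.X (-q)).index.dual fun i => Cob.dualityGlue ((A.X (-q)).X i) b

theorem dualBelowXIso_comm (A : CochainComplex (BN κ m k) ℤ) (b : Diag k n) (q q' : ℤ) :
    (dualBelowXIso A b q).hom ≫ (above b.reflect (dual A)).d q q' =
      (dual (below A b)).d q q' ≫ (dualBelowXIso A b q').hom :=
  Clo.hom_ext fun i j => by
    refine (Clo.diag_comp_apply (A.X (-q)).index.dual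
      (fun i => (Cob.dualityGlue ((A.X (-q)).X i) b).hom) _ i j).trans (Eq.trans ?_
        (Clo.comp_diag_apply (A.X (-q')).index.dual
          (fun i => (Cob.dualityGlue ((A.X (-q')).X i) b).hom) _ i j).symm)
    refine (congrArg _ (above_dual_d_apply A b.reflect q q' i j)).trans (Eq.trans ?_
      (congrArg (· ≫ _) (dual_d_apply (below A b) q q' i j)).symm)
    refine (Linear.comp_units_smul _ _ _).trans
      (Eq.trans ?_ (Linear.units_smul_comp _ _ _).symm)
    exact congrArg ((q + 1).negOnePow • ·)
      (Cob.dualityGlue_natural ((A.d (-q') (-q)).1 j i) b).symm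

/-- The dual of a planar composition with a diagram. -/
noncomputable def dualBelowIso (A : CochainComplex (BN κ m k) ℤ) (b : Diag k n) :
    dual (below A b) ≅ above b.reflect (dual A) :=
  HomologicalComplex.Hom.isoOfComponents (dualBelowXIso A b) fun q q' _ =>
    dualBelowXIso_comm A b q q'

/-- The dual of `A` above a cup is the reflected cup, a cap, above the dual of `A`, and duals of
contractible complexes are contractible. -/
theorem KillsBelow.dual : {m n : ℕ} → {A : CochainComplex (BN κ m n) ℤ} → KillsBelow A →
    KillsAbove (BN.dual A)
  | _, 0, _, _ => trivial
  | _, 1, _, _ => trivial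
  | _, n + 2, A, h => fun i => by
    rw [contractible_iff]
    obtain ⟨c⟩ := (contractible_iff _).1 (h i)
    exact ⟨(contractionDual c).ofIso (dualBelowIso A (.cup n i))⟩

/-- A complex that is killed by turnbacks from below is killed by all diagrams with fewer
endpoints on the bottom. -/
theorem KillsBelow.nonempty_contraction {A : CochainComplex (BN κ m k) ℤ} (h : KillsBelow A)
    (Y : Cob k n) (hn : n < k) : Nonempty (Contraction
      (((Clo.map ((Cob.gluing m k n).flip.obj Y)).mapHomologicalComplex _).obj A)) := by
  match k, A, h, Y, hn with
  -- With a single strand there is no turnback to use, but a diagram with one point on top and none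
  -- on the bottom does not exist.
  | 1, _, _, Y, hn => exact absurd hn Y.diag.reflect.not_lt_one
  | k + 2, A, h, Y, hn =>
    obtain ⟨b, i, ⟨e⟩⟩ := Y.exists_iso_cup_glue hn
    obtain ⟨c⟩ := (contractible_iff _).1 (h i)
    -- Gluing `Y` below is, up to isomorphism, gluing the cup first and the rest `b` afterwards; the
    -- second step is an additive functor and preserves the contraction.
    have c' : Contraction (((Clo.map ((Cob.gluing m (k + 2) k).flip.obj (Cob.ofDiag (.cup k i)) ⋙
        (Cob.gluing m k n).flip.obj b)).mapHomologicalComplex _).obj A) :=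
      c.map (Clo.map ((Cob.gluing m k n).flip.obj b))
    exact ⟨Clo.contractionOfIso ((Cob.gluing m (k + 2) n).flip.mapIso e.symm)
      (Clo.contractionOfIso (Cob.gluingFlipObjGlue _ b).symm c')⟩

/-- A complex that is killed by turnbacks from above is killed by all diagrams with fewer
endpoints on top. -/
theorem KillsAbove.nonempty_contraction {A : CochainComplex (BN κ k n) ℤ} (h : KillsAbove A)
    (Y : Cob m k) (hm : m < k) : Nonempty (Contraction
      (((Clo.map ((Cob.gluing m k n).obj Y)).mapHomologicalComplex _).obj A)) := by
  match k, A, h, Y, hm with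
  | 1, _, _, Y, hm => exact absurd hm Y.diag.not_lt_one
  | k + 2, A, h, Y, hm =>
    obtain ⟨b, i, ⟨e⟩⟩ := Y.exists_iso_glue_cap hm
    obtain ⟨c⟩ := (contractible_iff _).1 (h i)
    have c' : Contraction (((Clo.map ((Cob.gluing k (k + 2) n).obj (Cob.ofDiag (.cap k i)) ⋙
        (Cob.gluing m k n).obj b)).mapHomologicalComplex _).obj A) :=
      c.map (Clo.map ((Cob.gluing m k n).obj b))
    exact ⟨Clo.contractionOfIso ((Cob.gluing m (k + 2) n).mapIso e.symm)
      (Clo.contractionOfIso (Cob.gluingObjGlue b _).symm c')⟩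

theorem isZero_incl {κ' : Kind} {A : CochainComplex (BN .fin m n) ℤ} {q : ℤ}
    (h : Limits.IsZero (A.X q)) : Limits.IsZero ((incl κ' A).X q) :=
  (Clo.incl κ').map_isZero h

theorem isZero_dual {A : CochainComplex (BN κ m n) ℤ} (h : ∀ q, 0 < q → Limits.IsZero (A.X q))
    (q : ℤ) (hq : q < 0) : Limits.IsZero ((dual A).X q) :=
  (Clo.dual (Cob.duality m n)).map_isZero (h (-q) (by omega)).op

/-- A complex of sums composed with the dual of a universal projector with more strands is
contractible. -/
theorem contractible_tensor_dual {Q : CochainComplex (BN .fin k k) ℤ}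
    (hQ : IsUniversalProjector Q) (hm : m < k) (A : CochainComplex (BN .sum m k) ℤ) :
    Contractible (tensor A (incl .sum (dual Q))) := by
  rw [contractible_iff]
  -- Duality moves the projector to nonnegative degrees. Each summand of `A` has only `m < k` top
  -- points, so gluing it above the dual gives a contractible block of the row.
  refine nonempty_contraction_total_sum _ A _ (fun q hq => isZero_incl (isZero_dual hQ.nonpos q hq))
    fun p => Clo.nonempty_contraction_tensorLeft _ _ _ fun x => ?_
  obtain ⟨c⟩ := hQ.kills_below.dual.nonempty_contraction ((A.X p).X x) hm
  exact ⟨Clo.contractionIncl .sum _ c⟩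

/-- A universal projector composed with a complex of products with fewer endpoints on the bottom is
contractible. -/
theorem contractible_projector_tensor {Q : CochainComplex (BN .fin k k) ℤ}
    (hQ : IsUniversalProjector Q) (hn : n < k) (A : CochainComplex (BN .prod k n) ℤ) :
    Contractible (tensor (incl .prod Q) A) := by
  rw [contractible_iff]
  refine nonempty_contraction_total_prod _ _ A (.inl fun p hp => isZero_incl (hQ.nonpos p hp))
    fun q => Clo.nonempty_contraction_tensorRight _ _ _ fun x => ?_
  obtain ⟨c⟩ := hQ.kills_below.nonempty_contraction ((A.X q).X x) hn
  exact ⟨Clo.contractionIncl .prod _ c⟩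

/-- Contractibility is preserved by the composition with the dual of a universal projector. -/
theorem Contractible.tensor_dual {P : CochainComplex (BN .fin n n) ℤ}
    (hP : IsUniversalProjector P) {A : CochainComplex (BN .prod m n) ℤ} (h : Contractible A) :
    Contractible (tensor A (incl .prod (dual P))) := by
  rw [contractible_iff] at h ⊢
  obtain ⟨c⟩ := h
  -- The columns are images of the contractible complex `A` under additive functors; the projector
  -- only provides the degree bound.
  exact nonempty_contraction_total_prod _ A _
    (.inr fun q hq => isZero_incl (isZero_dual hP.nonpos q hq)) fun q => ⟨c.map _⟩

end BN

end BarNatan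

/-! ### The semi-orthogonality rule -/

theorem mainTheorem4 (i j : ℕ) (hij : i < j)
    (P : CochainComplex (BarNatan.BN .fin i i) ℤ) (Q : CochainComplex (BarNatan.BN .fin j j) ℤ)
    (hP : BarNatan.BN.IsUniversalProjector P) (hQ : BarNatan.BN.IsUniversalProjector Q) :
    (∀ A : CochainComplex (BarNatan.BN .sum i j) ℤ,
      BarNatan.BN.Contractible
        (BarNatan.BN.tensor (BarNatan.BN.tensor (BarNatan.BN.incl .sum P) A)
          (BarNatan.BN.incl .sum (BarNatan.BN.dual Q)))) ∧
    (∀ A : CochainComplex (BarNatan.BN .prod j i) ℤ,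
      BarNatan.BN.Contractible
        (BarNatan.BN.tensor (BarNatan.BN.tensor (BarNatan.BN.incl .prod Q) A)
          (BarNatan.BN.incl .prod (BarNatan.BN.dual P)))) :=
  -- In both parts it is the larger projector that supplies contractibility: against all of `P ⊗ A`
  -- in the first, and against `A` alone in the second, before the dual of `P` is attached.
  ⟨fun A => BarNatan.BN.contractible_tensor_dual hQ hij
      (BarNatan.BN.tensor (BarNatan.BN.incl .sum P) A),
    fun A => (BarNatan.BN.contractible_projector_tensor hQ hij A).tensor_dual hP⟩
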